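/- **Setting.** Let $\mathscr L$ be a vertex Lie algebra over $\mathbb C$: a vector space with an endomorphism $\mathcal D$, a vector $\mathsf c$ with $\ker\mathcal D=\mathbb C\mathsf c$ and $\mathsf c\notin\operatorname{Im}\mathcal D$, and bilinear products $a_{(n)}b$ ($n\in\mathbb Z_{\ge 0}$), with $a_{(n)}b=0$ for $n\gg 0$, such that $(\mathcal Da)_{(n)}b=-n\,a_{(n-1)}b$, $a_{(n)}b=-\sum_{k\ge 0}\frac{(-1)^{n+k}}{k!}\mathcal D^k\big(b_{(n+k)}a\big)$ and $a_{(m)}(b_{(n)}e)-b_{(n)}(a_{(m)}e)=\sum_{k=0}^m\binom mk (a_{(k)}b)_{(m+n-k)}e$. Let $\mathscr L$ be $\mathbb Z_{\ge 0}$-graded, with $\deg\mathcal D=1$, $\deg\mathsf c=0$ and $\deg a_{(n)}b=\deg a+\deg b-n-1$. Fix a graded subspace $\mathscr L^o$ with $\mathscr L=\mathscr L^o\oplus\mathbb C\mathsf c\oplus\operatorname{Im}\mathcal D$. For a commutative, not necessarily unital, $\mathbb C$-algebra $\mathcal A$ with a derivation $\partial$, let $\mathrm{Lie}_{\mathcal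 A}\mathscr L=(\mathscr L\otimes\mathcal A)/\operatorname{Im}(\mathcal D\otimes 1+1\otimes\partial)$, with quotient map $\rho$ and Lie bracket $[\rho(a\otimes f),\rho(b\otimes g)]=\sum_{n\ge 0}\frac1{n!}\rho\big(a_{(n)}b\otimes(\partial^nf)g\big)$. Put $\mathsf L(\mathscr L)=\mathrm{Lie}_{\mathbb C((t))}\mathscr L$ and $a(n)=\rho(a\otimes t^n)$. All modules over $\mathsf L(\mathscr L)$ are assumed to be of level one: $\mathsf c(-1)$ acts as the identity. A module $M$ is *smooth* if for all $m\in M$ and $a\in\mathscr L$ there is an $N$ with $\rho(a\otimes f)m=0$ for every $f\in t^N\mathbb C[[t]]$. The vacuum Verma module $\mathbb V(\mathscr L)$ is the module generated by a vector $|0\rangle$ subject to the relations $\rho(a\otimes f)|0\rangle=0$ for $a\in\mathscr L$, $f\in\mathbb C[[t]]$, and $\mathsf c(-1)|0\rangle=|0\rangle$. Let $\Gamma\subset\mathbb C^\times$ be the group of $T$-th roots of unity, $T\ge 1$, with generator $\omega$, and let $\sigma$ be an automorphism of the graded vertex Lie algebra $\mathscr L$ with $\sigma^T=1$, $\sigma\mathsf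 c=\mathsf c$ and $\sigma(\mathscr L^o)\subset\mathscr L^o+\operatorname{Im}\mathcal D$. For $\alpha=\omega^k\in\Gamma$ let $R_\alpha a=\alpha^{\deg a}\sigma^ka$. For a finite set $\bm x\subset\mathbb C^\times$ let $\mathcal A$ be the algebra of rational functions of $t$ that vanish at infinity and have poles at most in $\Gamma\bm x$; let $\Gamma$ act on $\mathrm{Lie}_{\mathcal A}\mathscr L$ by $\alpha.\rho(a\otimes f(t))=\rho(\alpha^{-1}R_\alpha a\otimes f(\alpha^{-1}t))$; let $I$ be the span of the differences of the elements $\sum_{\alpha\in\Gamma}\rho\big(\mathsf c\otimes\frac1{t-\alpha x}\big)$, $x\in\bm x$; and let $\mathsf L^\Gamma_{\bm x}(\mathscr L)$ be the space of $\Gamma$-invariants in the image of $\rho(\mathscr L^o\otimes\mathcal A)$ in $\mathrm{Lie}_{\mathcal A}\mathscr L/I$. If the points of $\bm x$ lie in distinct $\Gamma$-orbits and a module $M_x$ is attached to every $x\in\bm x$, then $\mathsf L^\Gamma_{\bm x}(\mathscr L)$ acts on $\bigotimes_xM_x$ through the Laurent expansions $\iota_{t-x}$, with $t-x$ as the variable,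 on the factors $M_x$. The space of coinvariants is the quotient of $\bigotimes_xM_x$ by the span of the images of this action. Fix $N\ge 1$ points $\bm z=(z_1,\dots,z_N)$ of $\mathbb C^\times$ in pairwise distinct $\Gamma$-orbits and modules $M_{z_i}$ over $\mathsf L(\mathscr L)$. For $u\in\mathbb C^\times\setminus\Gamma\bm z$ attach $\mathbb V(\mathscr L)$ to the point $u$. **Proposition.** Suppose that all the modules $M_{z_i}$ are smooth, or that each of them is an inverse limit of an inverse system of smooth modules or a submodule of such an inverse limit. For every $u\in\mathbb C^\times\setminus\Gamma\bm z$ there is a unique linear isomorphism $$\mathbb V(\mathscr L)\otimes\bigotimes_{i=1}^NM_{z_i}\Big/\mathsf L^\Gamma_{u,\bm z}(\mathscr L)\;\xrightarrow{\ \sim\ }\;\bigotimes_{i=1}^NM_{z_i}\Big/\mathsf L^\Gamma_{\bm z}(\mathscr L)$$ that sends the class of $|0\rangle\otimes\bm m$ to the class of $\bm m$ for all $\bm m$. Let $F_u:\mathbb V(\mathscr L)\otimes\bigotimes_iM_{z_i}\to\bigotimes_iM_{z_i}/\mathsf L^\Gamma_{\bm z}(\mathscr L)$ be its composition with the projection to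 coinvariants. Then $F_u$ is a rational function of $u$ with poles at most at the points of $\Gamma\bm z\cup\{0\}$, in the following sense. Let $x\in\mathbb V(\mathscr L)\otimes\bigotimes_iM_{z_i}$. 1. If the $M_{z_i}$ are smooth, then $F_u(x)$ is a finite sum $\sum_jr_j(u)\,q_j$ with vectors $q_j\in\bigotimes_iM_{z_i}/\mathsf L^\Gamma_{\bm z}(\mathscr L)$ and rational functions $r_j$ with poles at most in $\Gamma\bm z\cup\{0\}$, none of which depend on $u$. 2. If $M_{z_i}$ is a submodule (possibly the whole) of the inverse limit $\varprojlim_kM_i^k$ of an inverse system $(M_i^k)_k$ of smooth modules, $i=1,\dots,N$, then there is a function $u\mapsto G(u)\in\bigotimes_iM_{z_i}$ on $\mathbb C^\times\setminus\Gamma\bm z$ such that $F_u(x)$ is the class of $G(u)$ for all $u$, and for all $k_1,\dots,k_N$ the image of $G(u)$ in $\bigotimes_iM_i^{k_i}$ is a finite sum $\sum_jr_j(u)\,q_j$ with vectors $q_j\in\bigotimes_iM_i^{k_i}$ and rational functions $r_j$ with poles at most in $\Gamma\bm z\cup\{0\}$ (the number of terms and the orders of the poles may depend on the $k_i$). -/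

import Mathlib

open scoped TensorProduct RatFunc

noncomputable section

namespace CycloCoinv

/-- A `ℤ_{≥0}`-graded vertex Lie algebra over `ℂ` with one-dimensional centre `ker D = ℂ c`: a
`ℂ[D]`-module `V` with `n`-th products `prod n a b = a_(n) b`, `n ≥ 0`, satisfying
* locality: `a_(n) b = 0` for `n` large;
* translation: `(D a)_(n) b = -n a_(n-1) b`;
* skew-symmetry: `a_(n) b = -∑_{k ≥ 0} (-1)^(n+k) / k! D^k (b_(n+k) a)` (a finite sum);
* the commutator formula: `[a_(m), b_(n)] = ∑_{k ≤ m} (m choose k) (a_(k) b)_(m+n-k)`;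
and graded by `V = ⨁_{n ≥ 0} gr n` in such a way that `D` has degree `1`, `c` has degree `0`, and
`a_(n) b` has degree `p + q - n - 1` for `a` of degree `p` and `b` of degree `q` (hence vanishes if
this number is negative). -/
class VertexLieAlgebra (V : Type*) [AddCommGroup V] [Module ℂ V] where
  D : V →ₗ[ℂ] V
  prod : ℕ → V →ₗ[ℂ] V →ₗ[ℂ] V
  c : V
  gr : ℕ → Submodule ℂ V
  ker_D : LinearMap.ker D = Submodule.span ℂ {c}
  c_notMem_range : c ∉ LinearMap.range D
  locality : ∀ a b : V, ∃ N : ℕ, ∀ n, N ≤ n → prod n a b = 0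
  translation_zero : ∀ a b : V, prod 0 (D a) b = 0
  translation_succ : ∀ (n : ℕ) (a b : V), prod (n + 1) (D a) b = -((n : ℂ) + 1) • prod n a b
  skew : ∀ (n : ℕ) (a b : V), prod n a b =
    -∑ᶠ k : ℕ, ((-1 : ℂ) ^ (n + k) / (k.factorial : ℂ)) • (D ^ k) (prod (n + k) b a)
  commutator : ∀ (m n : ℕ) (a b e : V), prod m a (prod n b e) - prod n b (prod m a e) =
    ∑ k ∈ Finset.range (m + 1), (m.choose k : ℂ) • prod (m + n - k) (prod k a b) e
  isInternal_gr : DirectSum.IsInternal gr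
  D_mem_gr : ∀ (n : ℕ) (a : V), a ∈ gr n → D a ∈ gr (n + 1)
  prod_mem_gr : ∀ (p q r n : ℕ) (a b : V), a ∈ gr p → b ∈ gr q → r + n + 1 = p + q →
    prod n a b ∈ gr r
  prod_eq_zero_of_gr : ∀ (p q n : ℕ) (a b : V), a ∈ gr p → b ∈ gr q → p + q < n + 1 →
    prod n a b = 0
  c_mem_gr : c ∈ gr 0

/-- A derivation on a commutative associative (not necessarily unital) `ℂ`-algebra. -/
class DiffAlg (A : Type*) [NonUnitalCommRing A] [Module ℂ A] where
  δ : A →ₗ[ℂ] A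
  leibniz : ∀ f g : A, δ (f * g) = δ f * g + f * δ g

open VertexLieAlgebra (D prod)
open DiffAlg (δ)

section LieA

variable (V : Type*) [AddCommGroup V] [Module ℂ V] [VertexLieAlgebra V]
variable (A : Type*) [NonUnitalCommRing A] [Module ℂ A] [IsScalarTower ℂ A A] [SMulCommClass ℂ A A]
  [DiffAlg A]

/-- The operator `∂ = D ⊗ 1 + 1 ⊗ δ` on `𝓛 ⊗ A`. -/
def bdry : V ⊗[ℂ] A →ₗ[ℂ] V ⊗[ℂ] A :=
  TensorProduct.map D LinearMap.id + TensorProduct.map LinearMap.id δ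

/-- `Lie_A 𝓛 = (𝓛 ⊗ A) / Im ∂`, with the bracket induced by
`[a ⊗ f, b ⊗ g] = ∑ₙ (1/n!) a_(n) b ⊗ (δⁿ f) g`; see `lie_rho` and `brT`. -/
def LieOf : Type _ := (V ⊗[ℂ] A) ⧸ LinearMap.range (bdry V A)

instance : AddCommGroup (LieOf V A) :=
  inferInstanceAs (AddCommGroup ((V ⊗[ℂ] A) ⧸ LinearMap.range (bdry V A)))

instance : Module ℂ (LieOf V A) :=
  inferInstanceAs (Module ℂ ((V ⊗[ℂ] A) ⧸ LinearMap.range (bdry V A)))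

variable {V A}

/-- The quotient map `ρ : 𝓛 ⊗ A → Lie_A 𝓛`. -/
def rho : V ⊗[ℂ] A →ₗ[ℂ] LieOf V A := (LinearMap.range (bdry V A)).mkQ

theorem rho_surjective : Function.Surjective (rho (V := V) (A := A)) :=
  Submodule.mkQ_surjective _

theorem rho_bdry (x : V ⊗[ℂ] A) : rho (bdry V A x) = 0 :=
  (Submodule.Quotient.mk_eq_zero _).2 ⟨x, rfl⟩

theorem rho_D (v : V) (h : A) : rho (D v ⊗ₜ[ℂ] h) = -rho (v ⊗ₜ[ℂ] δ h) := by
  have := rho_bdry (v ⊗ₜ[ℂ] h)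
  simp only [bdry, LinearMap.add_apply, TensorProduct.map_tmul, LinearMap.id_apply, map_add] at this
  exact eq_neg_of_add_eq_zero_left this

theorem rho_D_pow (k : ℕ) (v : V) (h : A) :
    rho ((D ^ k) v ⊗ₜ[ℂ] h) = (-1 : ℂ) ^ k • rho (v ⊗ₜ[ℂ] ((δ : A →ₗ[ℂ] A) ^ k) h) := by
  induction k generalizing h with
  | zero => simp
  | succ k ih =>
    rw [pow_succ' D, Module.End.mul_apply, rho_D, ih, pow_succ δ, Module.End.mul_apply, pow_succ,
      mul_neg_one, neg_smul]

/-- The `n`-th term `(1/n!) a_(n) b ⊗ (δⁿ f) g` of the bracket. -/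
def brTerm (n : ℕ) : V ⊗[ℂ] A →ₗ[ℂ] V ⊗[ℂ] A →ₗ[ℂ] V ⊗[ℂ] A :=
  ((n.factorial : ℂ)⁻¹) •
    TensorProduct.map₂ (prod n) ((LinearMap.mul ℂ A).comp ((δ : A →ₗ[ℂ] A) ^ n))

theorem brTerm_tmul (n : ℕ) (a b : V) (f g : A) : brTerm n (a ⊗ₜ[ℂ] f) (b ⊗ₜ[ℂ] g) =
    ((n.factorial : ℂ)⁻¹) • (prod n a b ⊗ₜ[ℂ] (((δ : A →ₗ[ℂ] A) ^ n) f * g)) := by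
  simp [brTerm]

theorem brTerm_eventually (x y : V ⊗[ℂ] A) : ∃ N : ℕ, ∀ n, N ≤ n → brTerm n x y = 0 := by
  induction x using TensorProduct.induction_on with
  | zero => exact ⟨0, by simp⟩
  | add x x' hx hx' =>
    obtain ⟨N, hN⟩ := hx
    obtain ⟨N', hN'⟩ := hx'
    exact ⟨max N N', fun n hn => by
      simp [hN n (le_trans (le_max_left _ _) hn), hN' n (le_trans (le_max_right _ _) hn)]⟩
  | tmul a f =>
    induction y using TensorProduct.induction_on with
    | zero => exact ⟨0, by simp⟩
    | add x x' hx hx' =>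
      obtain ⟨N, hN⟩ := hx
      obtain ⟨N', hN'⟩ := hx'
      exact ⟨max N N', fun n hn => by
        simp [hN n (le_trans (le_max_left _ _) hn), hN' n (le_trans (le_max_right _ _) hn)]⟩
    | tmul b g =>
      obtain ⟨N, hN⟩ := VertexLieAlgebra.locality a b
      exact ⟨N, fun n hn => by simp [brTerm_tmul, hN n hn]⟩

theorem finsum_eq_sum_range {M : Type*} [AddCommMonoid M] (F : ℕ → M) (N : ℕ)
    (h : ∀ n, N ≤ n → F n = 0) : ∑ᶠ n, F n = ∑ n ∈ Finset.range N, F n := by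
  apply finsum_eq_sum_of_support_subset
  intro n hn
  simp only [Finset.coe_range, Set.mem_Iio]
  by_contra hc
  exact hn (h n (not_lt.1 hc))

theorem brTerm_support (x y : V ⊗[ℂ] A) : (Function.support fun n => brTerm n x y).Finite := by
  obtain ⟨N, hN⟩ := brTerm_eventually x y
  refine (Finset.range N).finite_toSet.subset fun n hn => ?_
  simp only [Finset.coe_range, Set.mem_Iio]
  by_contra hc
  exact hn (hN n (not_lt.1 hc))

/-- The bilinear operation `(a ⊗ f, b ⊗ g) ↦ ∑ₙ (1/n!) a_(n) b ⊗ (δⁿ f) g` (a finite sum). -/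
def brT : V ⊗[ℂ] A →ₗ[ℂ] V ⊗[ℂ] A →ₗ[ℂ] V ⊗[ℂ] A :=
  LinearMap.mk₂ ℂ (fun x y => ∑ᶠ n : ℕ, brTerm n x y)
    (fun x x' y => by
      simp only [map_add, LinearMap.add_apply]
      exact finsum_add_distrib (brTerm_support x y) (brTerm_support x' y))
    (fun r x y => by
      simp only [map_smul, LinearMap.smul_apply]
      exact (smul_finsum' r (brTerm_support x y)).symm)
    (fun x y y' => by
      simp only [map_add]
      exact finsum_add_distrib (brTerm_support x y) (brTerm_support x y'))
    (fun r x y => by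
      simp only [map_smul]
      exact (smul_finsum' r (brTerm_support x y)).symm)

theorem brT_eq_sum (x y : V ⊗[ℂ] A) (N : ℕ) (h : ∀ n, N ≤ n → brTerm n x y = 0) :
    brT x y = ∑ n ∈ Finset.range N, brTerm n x y :=
  finsum_eq_sum_range _ N h

theorem brT_tmul (a b : V) (f g : A) (N : ℕ) (h : ∀ n, N ≤ n → prod n a b = 0) :
    brT (a ⊗ₜ[ℂ] f) (b ⊗ₜ[ℂ] g) = ∑ n ∈ Finset.range N,
      ((n.factorial : ℂ)⁻¹) • (prod n a b ⊗ₜ[ℂ] (((δ : A →ₗ[ℂ] A) ^ n) f * g)) := by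
  rw [brT_eq_sum _ _ N fun n hn => by simp [brTerm_tmul, h n hn]]
  simp only [brTerm_tmul]

theorem brT_bdry_left (x y : V ⊗[ℂ] A) : brT (bdry V A x) y = 0 := by
  induction x using TensorProduct.induction_on with
  | zero => simp
  | add x x' hx hx' => simp [hx, hx']
  | tmul a f =>
    induction y using TensorProduct.induction_on with
    | zero => simp
    | add x x' hx hx' => simp [hx, hx']
    | tmul b g =>
      obtain ⟨N, hN⟩ := VertexLieAlgebra.locality a b
      have h1 : ∀ n, N + 1 ≤ n → prod n (D a) b = 0 := by
        intro n hn
        obtain ⟨m, rfl⟩ : ∃ m, n = m + 1 := ⟨n - 1, by omega⟩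
        rw [VertexLieAlgebra.translation_succ, hN m (by omega), smul_zero]
      simp only [bdry, LinearMap.add_apply, TensorProduct.map_tmul, LinearMap.id_apply, map_add]
      rw [brT_tmul _ _ _ _ _ h1, brT_tmul _ _ _ _ N hN, Finset.sum_range_succ',
        VertexLieAlgebra.translation_zero, TensorProduct.zero_tmul, smul_zero, add_zero,
        ← Finset.sum_add_distrib]
      refine Finset.sum_eq_zero fun n _ => ?_
      rw [VertexLieAlgebra.translation_succ, ← TensorProduct.smul_tmul', smul_smul, pow_succ,
        Module.End.mul_apply, ← add_smul]
      convert zero_smul ℂ _ using 2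
      have : ((n : ℂ) + 1) ≠ 0 := by exact_mod_cast Nat.succ_ne_zero n
      have h2 : ((n.factorial : ℕ) : ℂ) ≠ 0 := by exact_mod_cast n.factorial_ne_zero
      rw [Nat.factorial_succ]
      push_cast
      field_simp
      ring

/-- Multiplication as a linear map out of the tensor square intertwines `δ ⊗ 1 + 1 ⊗ δ` and `δ`. -/
theorem delta_pow_mul_tensor (j : ℕ) (w : A ⊗[ℂ] A) :
    TensorProduct.lift (LinearMap.mul ℂ A)
      (((TensorProduct.map δ LinearMap.id + TensorProduct.map LinearMap.id δ :
        Module.End ℂ (A ⊗[ℂ] A)) ^ j) w) =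
    ((δ : A →ₗ[ℂ] A) ^ j) (TensorProduct.lift (LinearMap.mul ℂ A) w) := by
  induction j generalizing w with
  | zero => simp
  | succ j ih =>
    rw [pow_succ, Module.End.mul_apply, ih, pow_succ, Module.End.mul_apply]
    congr 1
    induction w using TensorProduct.induction_on with
    | zero => simp
    | add x y hx hy => simp only [map_add, hx, hy]
    | tmul f g => simp [DiffAlg.leibniz]

theorem map_delta_pow_left (i : ℕ) (f g : A) :
    ((TensorProduct.map δ LinearMap.id : Module.End ℂ (A ⊗[ℂ] A)) ^ i) (f ⊗ₜ[ℂ] g) =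
      (((δ : A →ₗ[ℂ] A) ^ i) f) ⊗ₜ[ℂ] g := by
  induction i generalizing f with
  | zero => simp
  | succ i ih => simp [pow_succ, Module.End.mul_apply]

theorem map_delta_pow_right (i : ℕ) (f g : A) :
    ((TensorProduct.map LinearMap.id δ : Module.End ℂ (A ⊗[ℂ] A)) ^ i) (f ⊗ₜ[ℂ] g) =
      f ⊗ₜ[ℂ] (((δ : A →ₗ[ℂ] A) ^ i) g) := by
  induction i generalizing g with
  | zero => simp
  | succ i ih => simp [pow_succ, Module.End.mul_apply]

theorem commute_left_right :
    Commute (TensorProduct.map δ LinearMap.id : Module.End ℂ (A ⊗[ℂ] A))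
      (TensorProduct.map LinearMap.id δ) := by
  change _ * _ = _ * _
  ext f g
  simp [Module.End.mul_apply]

theorem leibniz_pow (l : ℕ) (f g : A) : ((δ : A →ₗ[ℂ] A) ^ l) (f * g) =
    ∑ p ∈ Finset.HasAntidiagonal.antidiagonal l, (l.choose p.1 : ℂ) •
      ((((δ : A →ₗ[ℂ] A) ^ p.1) f) * (((δ : A →ₗ[ℂ] A) ^ p.2) g)) := by
  have h := delta_pow_mul_tensor l (f ⊗ₜ[ℂ] g)
  rw [commute_left_right.add_pow'] at h
  simp only [TensorProduct.lift.tmul, LinearMap.mul_apply'] at h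
  rw [← h, LinearMap.sum_apply, map_sum]
  refine Finset.sum_congr rfl fun p _ => ?_
  rw [LinearMap.smul_apply, Module.End.mul_apply, map_delta_pow_right, map_delta_pow_left,
    map_nsmul, TensorProduct.lift.tmul, LinearMap.mul_apply', Nat.cast_smul_eq_nsmul]

theorem binom_identity (m : ℕ) (f g : A) :
    ∑ p ∈ Finset.HasAntidiagonal.antidiagonal m, ((-1 : ℂ) ^ p.1 * ((p.1.factorial : ℂ)⁻¹ * (p.2.factorial : ℂ)⁻¹)) •
      ((δ : A →ₗ[ℂ] A) ^ p.2) ((((δ : A →ₗ[ℂ] A) ^ p.1) f) * g) =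
    ((m.factorial : ℂ)⁻¹) • (f * ((δ : A →ₗ[ℂ] A) ^ m) g) := by
  set X : Module.End ℂ (A ⊗[ℂ] A) := TensorProduct.map δ LinearMap.id with hX
  set Y : Module.End ℂ (A ⊗[ℂ] A) := TensorProduct.map LinearMap.id δ with hY
  have hXY : Commute X Y := commute_left_right
  have hc : Commute (-X) (X + Y) := ((Commute.refl X).add_right hXY).neg_left
  have h := hc.add_pow' m
  rw [neg_add_cancel_left] at h
  have h2 := congrArg (fun E : Module.End ℂ (A ⊗[ℂ] A) =>
    ((m.factorial : ℂ)⁻¹) • TensorProduct.lift (LinearMap.mul ℂ A) (E (f ⊗ₜ[ℂ] g))) h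
  simp only [hY, map_delta_pow_right, TensorProduct.lift.tmul, LinearMap.mul_apply'] at h2
  rw [h2, LinearMap.sum_apply, map_sum, Finset.smul_sum]
  refine Finset.sum_congr rfl fun p hp => ?_
  rw [Finset.HasAntidiagonal.mem_antidiagonal] at hp
  have e1 : (-X) ^ p.1 * (X + Y) ^ p.2 = (X + Y) ^ p.2 * (-X) ^ p.1 :=
    (hc.pow_pow p.1 p.2).eq
  have e2 : ((-X) ^ p.1) (f ⊗ₜ[ℂ] g) = (-1 : ℂ) ^ p.1 • ((((δ : A →ₗ[ℂ] A) ^ p.1) f) ⊗ₜ[ℂ] g) := by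
    rw [← map_delta_pow_left, ← hX]
    have : -X = (-1 : ℂ) • X := (neg_one_smul ℂ X).symm
    rw [this, smul_pow, LinearMap.smul_apply]
  rw [← hY, LinearMap.smul_apply, e1, Module.End.mul_apply, e2, map_nsmul, hX, hY,
    delta_pow_mul_tensor, map_smul, map_smul, TensorProduct.lift.tmul, LinearMap.mul_apply',
    ← Nat.cast_smul_eq_nsmul ℂ, smul_smul, smul_smul]
  congr 1
  have hm : (m.factorial : ℂ) ≠ 0 := by exact_mod_cast m.factorial_ne_zero
  have h1 : (p.1.factorial : ℂ) ≠ 0 := by exact_mod_cast p.1.factorial_ne_zero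
  have h2 : (p.2.factorial : ℂ) ≠ 0 := by exact_mod_cast p.2.factorial_ne_zero
  have h3 : (m.choose p.1 : ℂ) * p.1.factorial * p.2.factorial = m.factorial := by
    rw [← hp, Nat.choose_symm_add]
    exact_mod_cast Nat.add_choose_mul_factorial_mul_factorial p.1 p.2
  field_simp
  rw [← h3]
  ring

theorem sum_square_antidiagonal {M : Type*} [AddCommMonoid M] (F : ℕ → ℕ → M) (N : ℕ)
    (h : ∀ k j, N ≤ k + j → F k j = 0) :
    ∑ m ∈ Finset.range N, ∑ p ∈ Finset.HasAntidiagonal.antidiagonal m, F p.1 p.2 =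
      ∑ k ∈ Finset.range N, ∑ j ∈ Finset.range N, F k j := by
  rw [← Finset.sum_product', Finset.sum_sigma']
  symm
  apply Finset.sum_bij_ne_zero (fun (p : ℕ × ℕ) _ _ => (⟨p.1 + p.2, p⟩ : Σ _ : ℕ, ℕ × ℕ))
  · rintro ⟨k, j⟩ _ hne
    simp only [Finset.mem_sigma, Finset.mem_range, Finset.HasAntidiagonal.mem_antidiagonal, and_true]
    by_contra hc
    exact hne (h k j (not_lt.1 hc))
  · rintro p _ _ q _ _ hpq
    simpa using congrArg (fun s : Σ _ : ℕ, ℕ × ℕ => s.2) hpq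
  · rintro ⟨m, k, j⟩ hm hne
    simp only [Finset.mem_sigma, Finset.mem_range, Finset.HasAntidiagonal.mem_antidiagonal] at hm
    obtain ⟨hm, rfl⟩ := hm
    exact ⟨(k, j), by simp only [Finset.mem_product, Finset.mem_range]; omega, hne, rfl⟩
  · rintro p _ _
    rfl

theorem rho_brT_skew (x y : V ⊗[ℂ] A) : rho (brT x y) = -rho (brT y x) := by
  induction x using TensorProduct.induction_on with
  | zero => simp
  | add x x' hx hx' => simp only [map_add, LinearMap.add_apply, hx, hx', neg_add]
  | tmul a f =>
    induction y using TensorProduct.induction_on with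
    | zero => simp
    | add x x' hx hx' => simp only [map_add, LinearMap.add_apply, hx, hx', neg_add]
    | tmul b g =>
      obtain ⟨N₁, h₁⟩ := VertexLieAlgebra.locality a b
      obtain ⟨N₂, h₂⟩ := VertexLieAlgebra.locality b a
      set N := max N₁ N₂ with hN
      have h₁' : ∀ n, N ≤ n → prod n a b = 0 := fun n hn => h₁ n (le_trans (le_max_left _ _) hn)
      have h₂' : ∀ n, N ≤ n → prod n b a = 0 := fun n hn => h₂ n (le_trans (le_max_right _ _) hn)
      rw [brT_tmul _ _ _ _ N h₁', brT_tmul _ _ _ _ N h₂', map_sum, map_sum,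
        ← Finset.sum_neg_distrib]
      have hs : ∀ n, prod n a b = -∑ k ∈ Finset.range N,
          ((-1 : ℂ) ^ (n + k) / (k.factorial : ℂ)) • (D ^ k) (prod (n + k) b a) := by
        intro n
        rw [VertexLieAlgebra.skew n a b, finsum_eq_sum_range _ N]
        intro k hk
        rw [h₂' (n + k) (by omega), map_zero, smul_zero]
      let F : ℕ → ℕ → LieOf V A := fun n k =>
        ((-1 : ℂ) ^ n * ((n.factorial : ℂ)⁻¹ * (k.factorial : ℂ)⁻¹)) •
          -rho (prod (n + k) b a ⊗ₜ[ℂ] ((δ : A →ₗ[ℂ] A) ^ k) ((((δ : A →ₗ[ℂ] A) ^ n) f) * g))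
      have hF : ∀ n k, N ≤ n + k → F n k = 0 := by
        intro n k h
        simp only [F]
        rw [h₂' _ h, TensorProduct.zero_tmul, map_zero, neg_zero, smul_zero]
      have hL : ∀ n, rho (((n.factorial : ℂ)⁻¹) •
          (prod n a b ⊗ₜ[ℂ] (((δ : A →ₗ[ℂ] A) ^ n) f * g))) = ∑ k ∈ Finset.range N, F n k := by
        intro n
        rw [hs n, TensorProduct.neg_tmul, TensorProduct.sum_tmul, smul_neg, map_neg, map_smul,
          map_sum, Finset.smul_sum, ← Finset.sum_neg_distrib]
        refine Finset.sum_congr rfl fun k _ => ?_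
        rw [← TensorProduct.smul_tmul', map_smul, rho_D_pow, smul_smul, smul_smul]
        simp only [F]
        rw [smul_neg]
        congr 2
        have : ((-1 : ℂ) ^ k) * (-1) ^ k = 1 := by rw [← mul_pow]; simp
        rw [pow_add, div_eq_mul_inv]
        linear_combination ((n.factorial : ℂ)⁻¹ * (-1) ^ n * (k.factorial : ℂ)⁻¹) * this
      rw [Finset.sum_congr rfl fun n _ => hL n, ← sum_square_antidiagonal F N hF]
      refine Finset.sum_congr rfl fun m _ => ?_
      have hR : ((m.factorial : ℂ)⁻¹) • (prod m b a ⊗ₜ[ℂ] (((δ : A →ₗ[ℂ] A) ^ m) g * f)) =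
          prod m b a ⊗ₜ[ℂ] (((m.factorial : ℂ)⁻¹) • (f * ((δ : A →ₗ[ℂ] A) ^ m) g)) := by
        rw [mul_comm f, TensorProduct.tmul_smul]
      rw [hR, ← binom_identity, TensorProduct.tmul_sum, map_sum, ← Finset.sum_neg_distrib]
      refine Finset.sum_congr rfl fun p hp => ?_
      rw [Finset.HasAntidiagonal.mem_antidiagonal] at hp
      simp only [F]
      rw [hp, TensorProduct.tmul_smul, map_smul, smul_neg]

theorem prod_prod_eventually (a b e : V) : ∃ N : ℕ, ∀ m n, (N ≤ m ∨ N ≤ n) →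
    prod m a (prod n b e) = 0 := by
  obtain ⟨N, hN⟩ := VertexLieAlgebra.locality b e
  choose K hK using fun n => VertexLieAlgebra.locality a (prod n b e)
  refine ⟨max N ((Finset.range N).sup K), fun m n h => ?_⟩
  by_cases hn : N ≤ n
  · rw [hN n hn, map_zero]
  · have hn' : n ∈ Finset.range N := by simpa using hn
    refine hK n m ?_
    have := Finset.le_sup (f := K) hn'
    rcases h with h | h
    · exact le_trans this (le_trans (le_max_right _ _) h)
    · exact absurd (le_trans (le_max_left _ _) h) hn

theorem prod_prod_eventually' (a b e : V) : ∃ N : ℕ, ∀ k l, (N ≤ k ∨ N ≤ l) →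
    prod l (prod k a b) e = 0 := by
  obtain ⟨N, hN⟩ := VertexLieAlgebra.locality a b
  choose K hK using fun n => VertexLieAlgebra.locality (prod n a b) e
  refine ⟨max N ((Finset.range N).sup K), fun n m h => ?_⟩
  by_cases hn : N ≤ n
  · rw [hN n hn, map_zero, LinearMap.zero_apply]
  · have hn' : n ∈ Finset.range N := by simpa using hn
    refine hK n m ?_
    have := Finset.le_sup (f := K) hn'
    rcases h with h | h
    · exact absurd (le_trans (le_max_left _ _) h) hn
    · exact le_trans this (le_trans (le_max_right _ _) h)

theorem brT_brT_tmul (a b e : V) (f g h : A) (N : ℕ) (h₀ : ∀ n, N ≤ n → prod n b e = 0)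
    (h₁ : ∀ m n, (N ≤ m ∨ N ≤ n) → prod m a (prod n b e) = 0) :
    brT (a ⊗ₜ[ℂ] f) (brT (b ⊗ₜ[ℂ] g) (e ⊗ₜ[ℂ] h)) =
      ∑ m ∈ Finset.range N, ∑ n ∈ Finset.range N,
        ((m.factorial : ℂ)⁻¹ * (n.factorial : ℂ)⁻¹) • (prod m a (prod n b e) ⊗ₜ[ℂ]
          ((((δ : A →ₗ[ℂ] A) ^ m) f) * (((δ : A →ₗ[ℂ] A) ^ n) g * h))) := by
  rw [brT_tmul b e g h N h₀, map_sum, Finset.sum_comm]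
  refine Finset.sum_congr rfl fun n _ => ?_
  rw [map_smul, brT_tmul _ _ _ _ N (fun m hm => h₁ m n (Or.inl hm)), Finset.smul_sum]
  refine Finset.sum_congr rfl fun m _ => ?_
  rw [smul_smul, mul_comm]

theorem brT_leibniz (x y z : V ⊗[ℂ] A) :
    brT x (brT y z) = brT (brT x y) z + brT y (brT x z) := by
  induction x using TensorProduct.induction_on with
  | zero => simp
  | add x x' hx hx' => simp only [map_add, LinearMap.add_apply, hx, hx']; abel
  | tmul a f =>
  induction y using TensorProduct.induction_on with
  | zero => simp
  | add x x' hx hx' => simp only [map_add, LinearMap.add_apply, hx, hx']; abel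
  | tmul b g =>
  induction z using TensorProduct.induction_on with
  | zero => simp
  | add x x' hx hx' => simp only [map_add, hx, hx']; abel
  | tmul e h =>
  obtain ⟨N₁, h₁⟩ := VertexLieAlgebra.locality b e
  obtain ⟨N₂, h₂⟩ := VertexLieAlgebra.locality a e
  obtain ⟨N₃, h₃⟩ := VertexLieAlgebra.locality a b
  obtain ⟨N₄, h₄⟩ := prod_prod_eventually a b e
  obtain ⟨N₅, h₅⟩ := prod_prod_eventually b a e
  obtain ⟨N₆, h₆⟩ := prod_prod_eventually' a b e
  let N := 2 * (N₁ + N₂ + N₃ + N₄ + N₅ + N₆)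
  have hN : N = 2 * (N₁ + N₂ + N₃ + N₄ + N₅ + N₆) := rfl
  let F : ℕ → ℕ → ℕ → V ⊗[ℂ] A := fun k j n =>
    ((k.factorial : ℂ)⁻¹ * (j.factorial : ℂ)⁻¹ * (n.factorial : ℂ)⁻¹) •
      (prod (j + n) (prod k a b) e ⊗ₜ[ℂ]
        ((((δ : A →ₗ[ℂ] A) ^ (k + j)) f) * (((δ : A →ₗ[ℂ] A) ^ n) g * h)))
  have hF : ∀ k j n, (N₆ ≤ k ∨ N₆ ≤ j + n) → F k j n = 0 := by
    intro k j n hh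
    simp only [F]
    rw [h₆ k (j + n) hh, TensorProduct.zero_tmul, smul_zero]
  have hmid : brT (brT (a ⊗ₜ[ℂ] f) (b ⊗ₜ[ℂ] g)) (e ⊗ₜ[ℂ] h) =
      ∑ k ∈ Finset.range N, ∑ j ∈ Finset.range N, ∑ n ∈ Finset.range N, F k j n := by
    rw [brT_tmul a b f g N (fun n hn => h₃ n (by omega)), map_sum, LinearMap.sum_apply]
    refine Finset.sum_congr rfl fun k _ => ?_
    rw [← sum_square_antidiagonal (F k) N (fun j n hh => hF k j n (Or.inr (by omega))),
      map_smul, LinearMap.smul_apply,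
      brT_tmul _ _ _ _ N (fun l hl => h₆ k l (Or.inr (by omega))), Finset.smul_sum]
    refine Finset.sum_congr rfl fun l _ => ?_
    rw [leibniz_pow, Finset.sum_mul, TensorProduct.tmul_sum, Finset.smul_sum, Finset.smul_sum]
    refine Finset.sum_congr rfl fun p hp => ?_
    rw [Finset.HasAntidiagonal.mem_antidiagonal] at hp
    simp only [F]
    rw [hp, smul_mul_assoc, TensorProduct.tmul_smul, smul_smul, smul_smul, mul_assoc,
      add_comm k, pow_add δ p.1 k, Module.End.mul_apply]
    congr 1
    have hm : (l.factorial : ℂ) ≠ 0 := by exact_mod_cast l.factorial_ne_zero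
    have hk : (k.factorial : ℂ) ≠ 0 := by exact_mod_cast k.factorial_ne_zero
    have h1 : (p.1.factorial : ℂ) ≠ 0 := by exact_mod_cast p.1.factorial_ne_zero
    have h2 : (p.2.factorial : ℂ) ≠ 0 := by exact_mod_cast p.2.factorial_ne_zero
    have h3 : (l.choose p.1 : ℂ) * p.1.factorial * p.2.factorial = l.factorial := by
      rw [← hp, Nat.choose_symm_add]
      exact_mod_cast Nat.add_choose_mul_factorial_mul_factorial p.1 p.2
    field_simp
    rw [← h3]
    rw [mul_assoc]
  rw [brT_brT_tmul a b e f g h N (fun n hn => h₁ n (by omega)) (fun m n hh => h₄ m n (by omega)),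
    brT_brT_tmul b a e g f h N (fun n hn => h₂ n (by omega)) (fun m n hh => h₅ m n (by omega)),
    ← sub_eq_iff_eq_add, hmid]
  rw [Finset.sum_comm (s := Finset.range N) (t := Finset.range N) (f := fun m n =>
    ((m.factorial : ℂ)⁻¹ * (n.factorial : ℂ)⁻¹) • (prod m b (prod n a e) ⊗ₜ[ℂ]
          ((((δ : A →ₗ[ℂ] A) ^ m) g) * (((δ : A →ₗ[ℂ] A) ^ n) f * h))))]
  rw [← Finset.sum_sub_distrib]
  have hstep : ∀ m n, ((m.factorial : ℂ)⁻¹ * (n.factorial : ℂ)⁻¹) • (prod m a (prod n b e) ⊗ₜ[ℂ]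
          ((((δ : A →ₗ[ℂ] A) ^ m) f) * (((δ : A →ₗ[ℂ] A) ^ n) g * h))) -
      ((n.factorial : ℂ)⁻¹ * (m.factorial : ℂ)⁻¹) • (prod n b (prod m a e) ⊗ₜ[ℂ]
          ((((δ : A →ₗ[ℂ] A) ^ n) g) * (((δ : A →ₗ[ℂ] A) ^ m) f * h))) =
      ∑ p ∈ Finset.HasAntidiagonal.antidiagonal m, F p.1 p.2 n := by
    intro m n
    rw [mul_left_comm (((δ : A →ₗ[ℂ] A) ^ n) g), mul_comm (n.factorial : ℂ)⁻¹, ← smul_sub,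
      ← TensorProduct.sub_tmul, VertexLieAlgebra.commutator, TensorProduct.sum_tmul,
      Finset.smul_sum, Finset.Nat.sum_antidiagonal_eq_sum_range_succ (fun i j => F i j n)]
    refine Finset.sum_congr rfl fun k hk => ?_
    have hkm : k ≤ m := by simpa [Nat.lt_succ_iff] using hk
    simp only [F]
    rw [← TensorProduct.smul_tmul', smul_smul, Nat.add_sub_cancel' hkm,
      show m + n - k = m - k + n by omega]
    congr 1
    have hm : (m.factorial : ℂ) ≠ 0 := by exact_mod_cast m.factorial_ne_zero
    have hk' : (k.factorial : ℂ) ≠ 0 := by exact_mod_cast k.factorial_ne_zero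
    have h2 : ((m - k).factorial : ℂ) ≠ 0 := by exact_mod_cast (m - k).factorial_ne_zero
    have h3 : (m.choose k : ℂ) * k.factorial * (m - k).factorial = m.factorial := by
      exact_mod_cast Nat.choose_mul_factorial_mul_factorial hkm
    field_simp
    rw [← h3]
  have hfin : ∀ n, ∑ m ∈ Finset.range N, ∑ p ∈ Finset.HasAntidiagonal.antidiagonal m, F p.1 p.2 n =
      ∑ k ∈ Finset.range N, ∑ j ∈ Finset.range N, F k j n := fun n =>
    sum_square_antidiagonal (fun k j => F k j n) N
      (fun k j hh => hF k j n (by omega))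
  calc _ = ∑ m ∈ Finset.range N, ∑ n ∈ Finset.range N,
        ∑ p ∈ Finset.HasAntidiagonal.antidiagonal m, F p.1 p.2 n := by
          refine Finset.sum_congr rfl fun m _ => ?_
          rw [← Finset.sum_sub_distrib]
          exact Finset.sum_congr rfl fun n _ => hstep m n
    _ = ∑ n ∈ Finset.range N, ∑ k ∈ Finset.range N, ∑ j ∈ Finset.range N, F k j n := by
          rw [Finset.sum_comm]
          exact Finset.sum_congr rfl fun n _ => hfin n
    _ = _ := by
          rw [Finset.sum_comm]
          refine Finset.sum_congr rfl fun k _ => ?_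
          rw [Finset.sum_comm]

/-- The Lie bracket as a bilinear map. -/
def brQ : LieOf V A →ₗ[ℂ] LieOf V A →ₗ[ℂ] LieOf V A :=
  (LinearMap.range (bdry V A)).liftQ
    (LinearMap.flip ((LinearMap.range (bdry V A)).liftQ
      (LinearMap.flip (brT.compr₂ rho))
      (by
        rintro _ ⟨y, rfl⟩
        refine LinearMap.ext fun x => ?_
        change rho (brT x (bdry V A y)) = 0
        rw [rho_brT_skew, brT_bdry_left, map_zero, neg_zero])))
    (by
      rintro _ ⟨x, rfl⟩
      refine LinearMap.ext fun y => ?_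
      obtain ⟨y, rfl⟩ := rho_surjective y
      change rho (brT (bdry V A x) y) = 0
      rw [brT_bdry_left, map_zero])

instance : Bracket (LieOf V A) (LieOf V A) := ⟨fun x y => brQ x y⟩

theorem lie_rho (x y : V ⊗[ℂ] A) : ⁅rho x, rho y⁆ = rho (brT x y) := rfl

instance : LieRing (LieOf V A) where
  add_lie x y z := by change brQ _ _ = _ ; rw [map_add]; rfl
  lie_add x y z := by change brQ _ _ = _ ; rw [map_add]; rfl
  lie_self x := by
    obtain ⟨x, rfl⟩ := rho_surjective x
    rw [lie_rho]
    have h := rho_brT_skew x x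
    rw [eq_neg_iff_add_eq_zero, ← two_smul ℂ] at h
    exact (smul_eq_zero.1 h).resolve_left two_ne_zero
  leibniz_lie x y z := by
    obtain ⟨x, rfl⟩ := rho_surjective x
    obtain ⟨y, rfl⟩ := rho_surjective y
    obtain ⟨z, rfl⟩ := rho_surjective z
    simp only [lie_rho]
    rw [brT_leibniz, map_add]

instance : LieAlgebra ℂ (LieOf V A) where
  lie_smul r x y := by change brQ _ _ = _ ; rw [map_smul]; rfl

end LieA
theorem theta_coeff (f : LaurentSeries ℂ) (n : ℤ) :
    (HahnSeries.single (1 : ℤ) (1 : ℂ) * LaurentSeries.derivative ℂ f).coeff n = n * f.coeff n := by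
  have := HahnSeries.coeff_single_mul_add (r := (1 : ℂ)) (x := LaurentSeries.derivative ℂ f)
    (a := n - 1) (b := (1 : ℤ))
  rw [sub_add_cancel] at this
  rw [this]
  simp

theorem laurent_leibniz (f g : LaurentSeries ℂ) : LaurentSeries.derivative ℂ (f * g) =
    LaurentSeries.derivative ℂ f * g + f * LaurentSeries.derivative ℂ g := by
  have h1 : (HahnSeries.single (1 : ℤ) (1 : ℂ)) ≠ 0 := by
    rw [Ne, HahnSeries.single_eq_zero_iff]; exact one_ne_zero
  apply mul_left_cancel₀ h1
  rw [mul_add, ← mul_assoc, mul_left_comm _ f]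
  set F := HahnSeries.single (1 : ℤ) (1 : ℂ) * LaurentSeries.derivative ℂ f with hF
  set G := HahnSeries.single (1 : ℤ) (1 : ℂ) * LaurentSeries.derivative ℂ g with hG
  have hFs : F.support ⊆ f.support := by
    intro n hn hc
    exact hn (by rw [hF, theta_coeff, hc, mul_zero])
  have hGs : G.support ⊆ g.support := by
    intro n hn hc
    exact hn (by rw [hG, theta_coeff, hc, mul_zero])
  ext n
  rw [theta_coeff, HahnSeries.coeff_add, HahnSeries.coeff_mul_left' f.isPWO_support hFs,
    HahnSeries.coeff_mul_right' g.isPWO_support hGs, HahnSeries.coeff_mul, Finset.mul_sum,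
    ← Finset.sum_add_distrib]
  refine Finset.sum_congr rfl fun p hp => ?_
  rw [Finset.mem_antidiagonal] at hp
  rw [hF, hG, theta_coeff, theta_coeff, ← hp.2.2]
  push_cast
  ring

/-- `ℂ((t))` with the derivation `d/dt`. -/
instance : DiffAlg (LaurentSeries ℂ) where
  δ := LaurentSeries.derivative ℂ
  leibniz := laurent_leibniz

/-- The derivative of a rational function, by the quotient rule. -/
def ratDeriv (f : RatFunc ℂ) : RatFunc ℂ :=
  algebraMap (Polynomial ℂ) (RatFunc ℂ)
      (Polynomial.derivative f.num * f.denom - f.num * Polynomial.derivative f.denom) /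
    algebraMap (Polynomial ℂ) (RatFunc ℂ) (f.denom ^ 2)

theorem ratDeriv_eq_of_eq_div (f : RatFunc ℂ) (p q : Polynomial ℂ) (hq : q ≠ 0)
    (hf : f = algebraMap _ (RatFunc ℂ) p / algebraMap _ (RatFunc ℂ) q) :
    ratDeriv f = algebraMap (Polynomial ℂ) (RatFunc ℂ)
        (Polynomial.derivative p * q - p * Polynomial.derivative q) /
      algebraMap (Polynomial ℂ) (RatFunc ℂ) (q ^ 2) := by
  have hd : f.denom ≠ 0 := f.denom_ne_zero
  have h1 : ∀ r : Polynomial ℂ, r ≠ 0 → algebraMap (Polynomial ℂ) (RatFunc ℂ) r ≠ 0 := fun r hr =>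
    RatFunc.algebraMap_ne_zero hr
  have h2 : f.num * q = p * f.denom := by
    apply RatFunc.algebraMap_injective ℂ
    have h := f.num_div_denom.trans hf
    rw [div_eq_div_iff (h1 _ hd) (h1 _ hq)] at h
    rw [map_mul, map_mul]
    exact h
  have h3 : Polynomial.derivative f.num * q + f.num * Polynomial.derivative q =
      Polynomial.derivative p * f.denom + p * Polynomial.derivative f.denom := by
    rw [← Polynomial.derivative_mul, ← Polynomial.derivative_mul, h2]
  rw [ratDeriv, div_eq_div_iff (h1 _ (pow_ne_zero 2 hd)) (h1 _ (pow_ne_zero 2 hq)), ← map_mul,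
    ← map_mul]
  refine congrArg _ ?_
  generalize f.num = n at *
  generalize f.denom = d at *
  linear_combination (d * q) * h3 -
    (d * Polynomial.derivative q + Polynomial.derivative d * q) * h2

theorem ratDeriv_div (p q : Polynomial ℂ) (hq : q ≠ 0) :
    ratDeriv (algebraMap _ (RatFunc ℂ) p / algebraMap _ (RatFunc ℂ) q) =
      algebraMap (Polynomial ℂ) (RatFunc ℂ)
        (Polynomial.derivative p * q - p * Polynomial.derivative q) /
      algebraMap (Polynomial ℂ) (RatFunc ℂ) (q ^ 2) :=
  ratDeriv_eq_of_eq_div _ p q hq rfl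

theorem ratFunc_exists (f : RatFunc ℂ) : ∃ p q : Polynomial ℂ, q ≠ 0 ∧
    f = algebraMap _ (RatFunc ℂ) p / algebraMap _ (RatFunc ℂ) q :=
  ⟨f.num, f.denom, f.denom_ne_zero, f.num_div_denom.symm⟩

theorem ratDeriv_add (f g : RatFunc ℂ) : ratDeriv (f + g) = ratDeriv f + ratDeriv g := by
  obtain ⟨p, q, hq, rfl⟩ := ratFunc_exists f
  obtain ⟨p', q', hq', rfl⟩ := ratFunc_exists g
  have h1 := RatFunc.algebraMap_ne_zero hq
  have h1' := RatFunc.algebraMap_ne_zero hq'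
  rw [div_add_div _ _ h1 h1', ← map_mul, ← map_mul, ← map_add, ← map_mul,
    ratDeriv_div _ _ (mul_ne_zero hq hq'), ratDeriv_div _ _ hq, ratDeriv_div _ _ hq']
  simp only [Polynomial.derivative_mul, map_add, map_sub, map_mul, map_pow]
  field_simp
  ring

theorem ratDeriv_mul (f g : RatFunc ℂ) : ratDeriv (f * g) = ratDeriv f * g + f * ratDeriv g := by
  obtain ⟨p, q, hq, rfl⟩ := ratFunc_exists f
  obtain ⟨p', q', hq', rfl⟩ := ratFunc_exists g
  have h1 := RatFunc.algebraMap_ne_zero hq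
  have h1' := RatFunc.algebraMap_ne_zero hq'
  rw [div_mul_div_comm, ← map_mul, ← map_mul,
    ratDeriv_div _ _ (mul_ne_zero hq hq'), ratDeriv_div _ _ hq, ratDeriv_div _ _ hq']
  simp only [Polynomial.derivative_mul, map_add, map_sub, map_mul, map_pow]
  field_simp
  ring

theorem ratDeriv_algebraMap (p : Polynomial ℂ) :
    ratDeriv (algebraMap _ (RatFunc ℂ) p) = algebraMap _ _ (Polynomial.derivative p) := by
  have := ratDeriv_div p 1 one_ne_zero
  simpa using this

theorem ratDeriv_smul (r : ℂ) (f : RatFunc ℂ) : ratDeriv (r • f) = r • ratDeriv f := by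
  have h : ∀ x : RatFunc ℂ, r • x = algebraMap (Polynomial ℂ) (RatFunc ℂ) (Polynomial.C r) * x := by
    intro x
    rw [RatFunc.algebraMap_C, RatFunc.smul_eq_C_mul]
  rw [h, ratDeriv_mul, ratDeriv_algebraMap, Polynomial.derivative_C, map_zero, zero_mul, zero_add,
    ← h]

/-- All poles of the rational function `f` in `ℂ` lie in the set `P`. -/
def PolesIn (P : Set ℂ) (f : RatFunc ℂ) : Prop := ∀ s, f.denom.IsRoot s → s ∈ P

/-- `f` vanishes at infinity: `f` is zero or has negative degree. -/
def VanishesAtInfty (f : RatFunc ℂ) : Prop := f = 0 ∨ f.intDegree < 0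

theorem PolesIn.div {P : Set ℂ} {p q : Polynomial ℂ}
    (h : ∀ s, q.IsRoot s → s ∈ P) :
    PolesIn P (algebraMap _ (RatFunc ℂ) p / algebraMap _ (RatFunc ℂ) q) := fun s hs =>
  h s (hs.dvd (RatFunc.denom_div_dvd p q))

theorem PolesIn.add {P : Set ℂ} {f g : RatFunc ℂ} (hf : PolesIn P f) (hg : PolesIn P g) :
    PolesIn P (f + g) := fun s hs => by
  have := hs.dvd (RatFunc.denom_add_dvd f g)
  rcases Polynomial.root_mul.1 this with h | h
  exacts [hf s h, hg s h]

theorem PolesIn.mul {P : Set ℂ} {f g : RatFunc ℂ} (hf : PolesIn P f) (hg : PolesIn P g) :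
    PolesIn P (f * g) := fun s hs => by
  have := hs.dvd (RatFunc.denom_mul_dvd f g)
  rcases Polynomial.root_mul.1 this with h | h
  exacts [hf s h, hg s h]

theorem PolesIn.algebraMap {P : Set ℂ} (p : Polynomial ℂ) : PolesIn P (algebraMap _ (RatFunc ℂ) p) :=
  fun s hs => by simp at hs

theorem PolesIn.ratDeriv {P : Set ℂ} {f : RatFunc ℂ} (hf : PolesIn P f) :
    PolesIn P (ratDeriv f) := by
  refine PolesIn.div fun s hs => hf s ?_
  simpa [Polynomial.IsRoot] using hs

theorem vanishes_div_iff (p q : Polynomial ℂ) (hq : q ≠ 0) :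
    VanishesAtInfty (algebraMap _ (RatFunc ℂ) p / algebraMap _ (RatFunc ℂ) q) ↔
      p.degree < q.degree := by
  by_cases hp : p = 0
  · subst hp
    simp [VanishesAtInfty, bot_lt_iff_ne_bot, hq]
  · have h1 := RatFunc.algebraMap_ne_zero hq
    have h2 := RatFunc.algebraMap_ne_zero hp
    rw [VanishesAtInfty, div_eq_mul_inv, RatFunc.intDegree_mul h2 (inv_ne_zero h1),
      RatFunc.intDegree_inv, RatFunc.intDegree_polynomial, RatFunc.intDegree_polynomial,
      Polynomial.degree_eq_natDegree hp, Polynomial.degree_eq_natDegree hq, Nat.cast_lt]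
    simp only [mul_eq_zero, h2, inv_eq_zero, h1, or_false, false_or]
    omega

theorem VanishesAtInfty.add {f g : RatFunc ℂ} (hf : VanishesAtInfty f) (hg : VanishesAtInfty g) :
    VanishesAtInfty (f + g) := by
  rcases hf with rfl | hf
  · rwa [zero_add]
  rcases hg with rfl | hg
  · rw [add_zero]; exact Or.inr hf
  by_cases h : f + g = 0
  · exact Or.inl h
  by_cases hg0 : g = 0
  · rw [hg0, add_zero]; exact Or.inr hf
  exact Or.inr (lt_of_le_of_lt (RatFunc.intDegree_add_le hg0 h) (max_lt hf hg))

theorem VanishesAtInfty.mul {f g : RatFunc ℂ} (hf : VanishesAtInfty f) (hg : VanishesAtInfty g) :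
    VanishesAtInfty (f * g) := by
  by_cases hf0 : f = 0
  · left; rw [hf0, zero_mul]
  by_cases hg0 : g = 0
  · left; rw [hg0, mul_zero]
  right
  rw [RatFunc.intDegree_mul hf0 hg0]
  have := hf.resolve_left hf0
  have := hg.resolve_left hg0
  omega

theorem VanishesAtInfty.ratDeriv {f : RatFunc ℂ} (hf : VanishesAtInfty f) :
    VanishesAtInfty (ratDeriv f) := by
  have hd := f.denom_ne_zero
  have h : f.num.degree < f.denom.degree := by
    rw [← vanishes_div_iff _ _ hd, f.num_div_denom]; exact hf
  refine (vanishes_div_iff _ _ (pow_ne_zero 2 hd)).2 ?_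
  rw [pow_two, Polynomial.degree_mul]
  refine lt_of_le_of_lt (Polynomial.degree_sub_le _ _) (max_lt ?_ ?_)
  · rw [Polynomial.degree_mul]
    have := lt_of_le_of_lt Polynomial.degree_derivative_le h
    exact WithBot.add_lt_add_right (Polynomial.degree_ne_bot.2 hd) this
  · rw [Polynomial.degree_mul]
    refine lt_of_le_of_lt (add_le_add_right Polynomial.degree_derivative_le _) ?_
    exact WithBot.add_lt_add_right (Polynomial.degree_ne_bot.2 hd) h

/-- The algebra `ℂ^∞_P(t)` of rational functions with poles at most in `P`, vanishing at infinity. -/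
def poleAlg (P : Set ℂ) : NonUnitalSubalgebra ℂ (RatFunc ℂ) where
  carrier := {f | PolesIn P f ∧ VanishesAtInfty f}
  add_mem' hf hg := ⟨hf.1.add hg.1, hf.2.add hg.2⟩
  mul_mem' hf hg := ⟨hf.1.mul hg.1, hf.2.mul hg.2⟩
  zero_mem' := ⟨by simpa using PolesIn.algebraMap 0, Or.inl rfl⟩
  smul_mem' r f hf := by
    refine ⟨?_, ?_⟩
    · rw [RatFunc.smul_eq_C_mul, ← RatFunc.algebraMap_C]
      exact (PolesIn.algebraMap _).mul hf.1
    · by_cases hr : r = 0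
      · left; rw [hr, zero_smul]
      by_cases hf0 : f = 0
      · left; rw [hf0, smul_zero]
      right
      have hC : RatFunc.C r ≠ 0 := by simpa using hr
      rw [RatFunc.smul_eq_C_mul, RatFunc.intDegree_mul hC hf0, RatFunc.intDegree_C, zero_add]
      exact hf.2.resolve_left hf0

/-- `ℂ^∞_P(t)` with the derivation `d/dt`. -/
instance (P : Set ℂ) : DiffAlg (poleAlg P) where
  δ :=
    { toFun := fun f => ⟨ratDeriv f, f.2.1.ratDeriv, f.2.2.ratDeriv⟩
      map_add' := fun f g => Subtype.ext (ratDeriv_add f g)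
      map_smul' := fun r f => Subtype.ext (ratDeriv_smul r f) }
  leibniz f g := Subtype.ext (ratDeriv_mul f g)

/-- The Laurent expansion `ι_{t-z}` of a rational function at `z`, in the coordinate `t - z`. -/
def laurentAt (z : ℂ) : RatFunc ℂ →+* LaurentSeries ℂ :=
  (algebraMap (RatFunc ℂ) (LaurentSeries ℂ)).comp (RatFunc.laurent z : RatFunc ℂ →+* RatFunc ℂ)

theorem laurentAt_algebraMap (z : ℂ) (p : Polynomial ℂ) :
    laurentAt z (algebraMap _ (RatFunc ℂ) p) =
      algebraMap (Polynomial ℂ) (LaurentSeries ℂ) (Polynomial.taylor z p) := by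
  simp only [laurentAt, RingHom.comp_apply, RingHom.coe_coe, RatFunc.laurent_algebraMap]
  rw [← IsScalarTower.algebraMap_apply]

theorem algebraMap_C_laurent (r : ℂ) :
    algebraMap (Polynomial ℂ) (LaurentSeries ℂ) (Polynomial.C r) = HahnSeries.C r := by
  rw [HahnSeries.algebraMap_apply', ← HahnSeries.ofPowerSeries_C]
  congr 1
  exact Polynomial.coe_C r

theorem algebraMap_X_laurent :
    algebraMap (Polynomial ℂ) (LaurentSeries ℂ) Polynomial.X = HahnSeries.single 1 1 := by
  rw [HahnSeries.algebraMap_apply', ← HahnSeries.ofPowerSeries_X]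
  congr 1
  exact Polynomial.coe_X

theorem laurentAt_smul (z r : ℂ) (f : RatFunc ℂ) : laurentAt z (r • f) = r • laurentAt z f := by
  rw [RatFunc.smul_eq_C_mul, map_mul, ← RatFunc.algebraMap_C, laurentAt_algebraMap,
    Polynomial.taylor_C, algebraMap_C_laurent, HahnSeries.C_mul_eq_smul]

theorem laurentAt_derivative_polynomial (z : ℂ) (p : Polynomial ℂ) :
    laurentAt z (algebraMap _ (RatFunc ℂ) (Polynomial.derivative p)) =
      LaurentSeries.derivative ℂ (laurentAt z (algebraMap _ (RatFunc ℂ) p)) := by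
  have hC : ∀ r : ℂ, LaurentSeries.derivative ℂ (HahnSeries.C r : LaurentSeries ℂ) = 0 := by
    intro r
    rw [HahnSeries.C_apply, LaurentSeries.derivative_apply, LaurentSeries.hasseDeriv_single]
    simp
  have hX : LaurentSeries.derivative ℂ (laurentAt z (algebraMap (Polynomial ℂ) (RatFunc ℂ) Polynomial.X)) = 1 := by
    rw [laurentAt_algebraMap, Polynomial.taylor_X, map_add, algebraMap_X_laurent,
      algebraMap_C_laurent, map_add, hC, LaurentSeries.derivative_apply,
      LaurentSeries.hasseDeriv_single]
    simp
  induction p using Polynomial.induction_on with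
  | C a => simp only [Polynomial.derivative_C, map_zero, laurentAt_algebraMap, Polynomial.taylor_C,
      algebraMap_C_laurent, hC]
  | add p q hp hq => simp only [map_add, hp, hq]
  | monomial n a ih =>
    rw [pow_succ, ← mul_assoc]
    generalize Polynomial.C a * Polynomial.X ^ n = w at ih ⊢
    rw [Polynomial.derivative_mul, Polynomial.derivative_X, mul_one]
    simp only [RingHom.map_add, RingHom.map_mul]
    rw [laurent_leibniz, hX, ih, mul_one]

theorem laurentAt_ratDeriv (z : ℂ) (f : RatFunc ℂ) :
    laurentAt z (ratDeriv f) = LaurentSeries.derivative ℂ (laurentAt z f) := by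
  obtain ⟨p, q, hq, hf⟩ := ratFunc_exists f
  have hq' := RatFunc.algebraMap_ne_zero hq
  have hq'' : laurentAt z (algebraMap _ (RatFunc ℂ) q) ≠ 0 := by
    rwa [Ne, map_eq_zero]
  have h1 : f * algebraMap _ (RatFunc ℂ) q = algebraMap _ (RatFunc ℂ) p := by
    rw [hf, div_mul_cancel₀ _ hq']
  have h2 := congrArg (fun x => laurentAt z (ratDeriv x)) h1
  have h3 := congrArg (fun x => LaurentSeries.derivative ℂ (laurentAt z x)) h1
  simp only [ratDeriv_mul, ratDeriv_algebraMap, map_add, map_mul, laurent_leibniz,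
    laurentAt_derivative_polynomial] at h2 h3
  apply mul_right_cancel₀ hq''
  exact add_right_cancel (h2.trans h3.symm)

/-- The substitution `p(t) ↦ p(s t)` on polynomials. -/
def scalePoly (s : ℂ) : Polynomial ℂ →ₐ[ℂ] Polynomial ℂ :=
  Polynomial.aeval (Polynomial.C s * Polynomial.X)

theorem scalePoly_scalePoly (s : ℂˣ) (p : Polynomial ℂ) :
    scalePoly ((s⁻¹ : ℂˣ) : ℂ) (scalePoly (s : ℂ) p) = p := by
  have : (scalePoly ((s⁻¹ : ℂˣ) : ℂ)).comp (scalePoly (s : ℂ)) = AlgHom.id ℂ _ := by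
    ext1
    simp [scalePoly, ← mul_assoc, ← Polynomial.C_mul]
  exact DFunLike.congr_fun this p

theorem scalePoly_injective (s : ℂˣ) : Function.Injective (scalePoly (s : ℂ)) :=
  Function.LeftInverse.injective (scalePoly_scalePoly s)

theorem eval_scalePoly (s r : ℂ) (p : Polynomial ℂ) :
    (scalePoly s p).eval r = p.eval (s * r) := by
  rw [scalePoly, ← Polynomial.comp_eq_aeval, Polynomial.eval_comp]
  simp

theorem degree_scalePoly (s : ℂˣ) (p : Polynomial ℂ) : (scalePoly (s : ℂ) p).degree = p.degree := by
  by_cases hp : p = 0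
  · rw [hp, map_zero]
  have h : scalePoly (s : ℂ) p ≠ 0 := by
    rw [Ne, map_eq_zero_iff _ (scalePoly_injective s)]; exact hp
  rw [Polynomial.degree_eq_natDegree h, Polynomial.degree_eq_natDegree hp, scalePoly,
    ← Polynomial.comp_eq_aeval, Polynomial.natDegree_comp,
    Polynomial.natDegree_C_mul_X _ s.ne_zero, mul_one]

theorem derivative_scalePoly (s : ℂ) (p : Polynomial ℂ) :
    Polynomial.derivative (scalePoly s p) = s • scalePoly s (Polynomial.derivative p) := by
  rw [scalePoly, ← Polynomial.comp_eq_aeval, ← Polynomial.comp_eq_aeval,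
    Polynomial.derivative_comp, Polynomial.derivative_C_mul, Polynomial.derivative_X, mul_one,
    Polynomial.smul_eq_C_mul]

/-- The substitution `f(t) ↦ f(s t)` on rational functions, for a nonzero `s`. -/
def scaleRat (s : ℂˣ) : RatFunc ℂ →ₐ[ℂ] RatFunc ℂ :=
  RatFunc.mapAlgHom (scalePoly (s : ℂ))
    (nonZeroDivisors_le_comap_nonZeroDivisors_of_injective _ (scalePoly_injective s))

theorem scaleRat_div (s : ℂˣ) (p q : Polynomial ℂ) :
    scaleRat s (algebraMap _ (RatFunc ℂ) p / algebraMap _ (RatFunc ℂ) q) =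
      algebraMap _ (RatFunc ℂ) (scalePoly (s : ℂ) p) /
        algebraMap _ (RatFunc ℂ) (scalePoly (s : ℂ) q) := by
  rw [scaleRat, RatFunc.coe_mapAlgHom_eq_coe_map, RatFunc.map_apply_div]

theorem ratDeriv_scaleRat (s : ℂˣ) (f : RatFunc ℂ) :
    ratDeriv (scaleRat s f) = (s : ℂ) • scaleRat s (ratDeriv f) := by
  obtain ⟨p, q, hq, rfl⟩ := ratFunc_exists f
  have hq' : scalePoly (s : ℂ) q ≠ 0 := by
    rw [Ne, map_eq_zero_iff _ (scalePoly_injective s)]; exact hq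
  rw [scaleRat_div, ratDeriv_div _ _ hq', ratDeriv_div _ _ hq, scaleRat_div, derivative_scalePoly,
    derivative_scalePoly, RatFunc.smul_eq_C_mul, ← RatFunc.algebraMap_C, ← mul_div_assoc,
    ← map_mul]
  simp only [map_sub, map_mul, map_pow, Polynomial.smul_eq_C_mul]
  congr 1
  ring

theorem PolesIn.scaleRat {P : Set ℂ} {f : RatFunc ℂ} (hf : PolesIn P f) (s : ℂˣ)
    (hs : ∀ r, (s : ℂ) * r ∈ P → r ∈ P) : PolesIn P (scaleRat s f) := by
  rw [← f.num_div_denom, scaleRat_div]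
  refine PolesIn.div fun r hr => hs r (hf _ ?_)
  rwa [Polynomial.IsRoot, eval_scalePoly] at hr

theorem VanishesAtInfty.scaleRat {f : RatFunc ℂ} (hf : VanishesAtInfty f) (s : ℂˣ) :
    VanishesAtInfty (scaleRat s f) := by
  have hd := f.denom_ne_zero
  have hq' : scalePoly (s : ℂ) f.denom ≠ 0 := by
    rw [Ne, map_eq_zero_iff _ (scalePoly_injective s)]; exact hd
  rw [← f.num_div_denom, vanishes_div_iff _ _ hd] at hf
  rw [← f.num_div_denom, scaleRat_div, vanishes_div_iff _ _ hq', degree_scalePoly, degree_scalePoly]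
  exact hf

instance laurentScalarTower : IsScalarTower ℂ (LaurentSeries ℂ) (LaurentSeries ℂ) :=
  ⟨fun r f g => by
    rw [smul_eq_mul, smul_eq_mul, ← HahnSeries.C_mul_eq_smul, ← HahnSeries.C_mul_eq_smul, mul_assoc]⟩

instance laurentSMulComm : SMulCommClass ℂ (LaurentSeries ℂ) (LaurentSeries ℂ) :=
  ⟨fun r f g => by
    rw [smul_eq_mul, smul_eq_mul, ← HahnSeries.C_mul_eq_smul, ← HahnSeries.C_mul_eq_smul,
      mul_left_comm]⟩

section Gamma

variable {V : Type*} [AddCommGroup V] [Module ℂ V] [VertexLieAlgebra V]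

variable (V) in
/-- The linear operator `s^{L(0)}`, acting as `sⁿ` on the homogeneous component of degree `n`. -/
def scaleDeg (s : ℂ) : V →ₗ[ℂ] V :=
  (DirectSum.toModule ℂ ℕ V fun n => s ^ n • (VertexLieAlgebra.gr (V := V) n).subtype) ∘ₗ
    (LinearEquiv.ofBijective (DirectSum.coeLinearMap (VertexLieAlgebra.gr (V := V)))
      (VertexLieAlgebra.isInternal_gr (V := V))).symm.toLinearMap

theorem scaleDeg_of_mem (s : ℂ) (n : ℕ) (a : V) (ha : a ∈ VertexLieAlgebra.gr (V := V) n) :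
    scaleDeg V s a = s ^ n • a := by
  have h : (LinearEquiv.ofBijective (DirectSum.coeLinearMap (VertexLieAlgebra.gr (V := V)))
      (VertexLieAlgebra.isInternal_gr (V := V))).symm a =
      DirectSum.lof ℂ ℕ (fun n => VertexLieAlgebra.gr (V := V) n) n ⟨a, ha⟩ := by
    rw [LinearEquiv.symm_apply_eq]
    exact (DirectSum.coeLinearMap_lof (VertexLieAlgebra.gr (V := V)) n ⟨a, ha⟩).symm
  simp only [scaleDeg, LinearMap.comp_apply, LinearEquiv.coe_coe, h, DirectSum.toModule_lof]
  rfl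

theorem hom_ext_gr {W : Type*} [AddCommGroup W] [Module ℂ W] (φ ψ : V →ₗ[ℂ] W)
    (h : ∀ n, ∀ a ∈ VertexLieAlgebra.gr (V := V) n, φ a = ψ a) : φ = ψ := by
  have htop := (VertexLieAlgebra.isInternal_gr (V := V)).submodule_iSup_eq_top
  have hle : (⨆ n, VertexLieAlgebra.gr (V := V) n) ≤ LinearMap.eqLocus φ ψ :=
    iSup_le fun n a ha => h n a ha
  rw [htop] at hle
  exact LinearMap.ext fun a => hle Submodule.mem_top

/-- `Lo = 𝓛ᵒ` is a graded subspace of `𝓛` with `𝓛 = 𝓛ᵒ ⊕ ℂ c ⊕ Im D`. -/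
structure IsGradedComplement (Lo : Submodule ℂ V) : Prop where
  isInternal : DirectSum.IsInternal
    ![Lo, Submodule.span ℂ {(VertexLieAlgebra.c : V)}, LinearMap.range (D : V →ₗ[ℂ] V)]
  isHomogeneous : Lo ≤ ⨆ n : ℕ, Lo ⊓ VertexLieAlgebra.gr n

variable (V) in
/-- An automorphism of the graded vertex Lie algebra, fixing the central element `c`. -/
structure VLAut extends V ≃ₗ[ℂ] V where
  map_D : ∀ a, toFun (D a) = D (toFun a)
  map_prod : ∀ (n : ℕ) (a b : V), toFun (prod n a b) = prod n (toFun a) (toFun b)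
  map_gr : ∀ (n : ℕ) (a : V), a ∈ VertexLieAlgebra.gr n → toFun a ∈ VertexLieAlgebra.gr n
  map_c : toFun VertexLieAlgebra.c = VertexLieAlgebra.c

/-- The underlying endomorphism. -/
def VLAut.lin (σ : VLAut V) : Module.End ℂ V := σ.toLinearEquiv.toLinearMap

theorem VLAut.pow_D (σ : VLAut V) (k : ℕ) (a : V) : (σ.lin ^ k) (D a) = D ((σ.lin ^ k) a) := by
  induction k generalizing a with
  | zero => rfl
  | succ k ih => rw [pow_succ, Module.End.mul_apply, Module.End.mul_apply, ← ih]
                 exact congrArg _ (σ.map_D a)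

theorem VLAut.pow_gr (σ : VLAut V) (k n : ℕ) (a : V) (ha : a ∈ VertexLieAlgebra.gr n) :
    (σ.lin ^ k) a ∈ VertexLieAlgebra.gr n := by
  induction k generalizing a with
  | zero => exact ha
  | succ k ih => rw [pow_succ, Module.End.mul_apply]; exact ih _ (σ.map_gr n a ha)

/-- For `α = ω^k ∈ Γ`, the operator `R_α = α^{L(0)} σ^k`. -/
def Rop (ω : ℂˣ) (σ : VLAut V) (k : ℕ) : V →ₗ[ℂ] V :=
  scaleDeg V ((ω ^ k : ℂˣ) : ℂ) ∘ₗ (σ.lin ^ k)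

theorem D_Rop (ω : ℂˣ) (σ : VLAut V) (k : ℕ) (a : V) :
    Rop ω σ k (D a) = ((ω ^ k : ℂˣ) : ℂ) • D (Rop ω σ k a) := by
  have : Rop ω σ k ∘ₗ D = ((ω ^ k : ℂˣ) : ℂ) • (D ∘ₗ Rop ω σ k) := by
    apply hom_ext_gr
    intro n a ha
    have h1 := σ.pow_gr k n a ha
    have h2 := VertexLieAlgebra.D_mem_gr n _ h1
    simp only [LinearMap.comp_apply, LinearMap.smul_apply, Rop]
    rw [VLAut.pow_D, scaleDeg_of_mem _ _ _ h1, scaleDeg_of_mem _ _ _ h2, map_smul, smul_smul,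
      pow_succ']
  exact LinearMap.congr_fun this a

/-- The union `Γ S` of the orbits of the points of `S` under `Γ = {1, ω, ω², …}`. -/
def orbit (ω : ℂˣ) (S : Set ℂ) : Set ℂ := {p | ∃ k : ℕ, ∃ s ∈ S, p = ((ω ^ k : ℂˣ) : ℂ) * s}

theorem orbit_stable (ω : ℂˣ) (S : Set ℂ) (k : ℕ) (r : ℂ)
    (h : (((ω ^ k)⁻¹ : ℂˣ) : ℂ) * r ∈ orbit ω S) : r ∈ orbit ω S := by
  obtain ⟨j, s, hs, hj⟩ := h
  refine ⟨k + j, s, hs, ?_⟩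
  rw [pow_add, Units.val_mul, mul_assoc, ← hj, ← mul_assoc, Units.mul_inv, one_mul]

/-- The substitution `f(t) ↦ f(α⁻¹ t)`, `α = ω^k`, on rational functions with poles in `Γ S`. -/
def rotate (ω : ℂˣ) (S : Set ℂ) (k : ℕ) : poleAlg (orbit ω S) →ₗ[ℂ] poleAlg (orbit ω S) where
  toFun f := ⟨scaleRat (ω ^ k)⁻¹ f, f.2.1.scaleRat _ (orbit_stable ω S k), f.2.2.scaleRat _⟩
  map_add' f g := Subtype.ext (map_add _ _ _)
  map_smul' r f := Subtype.ext ((scaleRat (ω ^ k)⁻¹).toLinearMap.map_smul r (f : RatFunc ℂ))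

/-- The action `α.(a ⊗ f(t)) = α⁻¹ R_α a ⊗ f(α⁻¹ t)`, `α = ω^k`. -/
def gammaTensor (ω : ℂˣ) (σ : VLAut V) (S : Set ℂ) (k : ℕ) :
    V ⊗[ℂ] poleAlg (orbit ω S) →ₗ[ℂ] V ⊗[ℂ] poleAlg (orbit ω S) :=
  TensorProduct.map ((((ω ^ k)⁻¹ : ℂˣ) : ℂ) • Rop ω σ k) (rotate ω S k)

theorem gammaTensor_bdry (ω : ℂˣ) (σ : VLAut V) (S : Set ℂ) (k : ℕ)
    (x : V ⊗[ℂ] poleAlg (orbit ω S)) : gammaTensor ω σ S k (bdry V _ x) =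
      bdry V _ (((ω ^ k : ℂˣ) : ℂ) • gammaTensor ω σ S k x) := by
  induction x using TensorProduct.induction_on with
  | zero => simp
  | add x y hx hy => simp only [map_add, smul_add, hx, hy]
  | tmul a f =>
    have h : rotate ω S k (δ f) = ((ω ^ k : ℂˣ) : ℂ) • δ (rotate ω S k f) := by
      apply Subtype.ext
      change scaleRat (ω ^ k)⁻¹ (ratDeriv f) = ((ω ^ k : ℂˣ) : ℂ) • ratDeriv (scaleRat (ω ^ k)⁻¹ f)
      rw [ratDeriv_scaleRat, smul_smul, Units.mul_inv, one_smul]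
    simp only [bdry, gammaTensor, LinearMap.add_apply, TensorProduct.map_tmul, LinearMap.id_apply,
      map_add, LinearMap.smul_apply, map_smul, smul_add, D_Rop, h]
    simp only [TensorProduct.tmul_smul, TensorProduct.smul_tmul', smul_smul]
    rw [mul_comm]

/-- The induced action of `α = ω^k` on `Lie_A 𝓛`, where `A = ℂ^∞_{Γ S}(t)`. -/
def gammaAct (ω : ℂˣ) (σ : VLAut V) (S : Set ℂ) (k : ℕ) :
    LieOf V (poleAlg (orbit ω S)) →ₗ[ℂ] LieOf V (poleAlg (orbit ω S)) :=
  Submodule.mapQ _ _ (gammaTensor ω σ S k) (by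
    rintro _ ⟨x, rfl⟩
    exact ⟨_, (gammaTensor_bdry ω σ S k x).symm⟩)

/-- The rational function `1 / (t - p)`, for `p ∈ P`. -/
def simplePole (P : Set ℂ) (p : ℂ) (hp : p ∈ P) : poleAlg P :=
  ⟨algebraMap _ (RatFunc ℂ) (1 : Polynomial ℂ) /
      algebraMap _ (RatFunc ℂ) (Polynomial.X - Polynomial.C p),
    PolesIn.div fun s hs => by
      rw [Polynomial.root_X_sub_C] at hs
      rwa [← hs],
    (vanishes_div_iff _ _ (Polynomial.X_sub_C_ne_zero p)).2 (by
      rw [Polynomial.degree_one, Polynomial.degree_X_sub_C]; exact zero_lt_one)⟩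

variable (V) in
/-- The central element `∑_{α ∈ Γ} c / (t - α s)` for `s ∈ S`, with `Γ = {ω^k : 0 ≤ k < T}`. -/
def centralSum (ω : ℂˣ) (T : ℕ) (S : Set ℂ) (s : S) : LieOf V (poleAlg (orbit ω S)) :=
  ∑ k ∈ Finset.range T, rho (VertexLieAlgebra.c ⊗ₜ[ℂ]
    simplePole (orbit ω S) (((ω ^ k : ℂˣ) : ℂ) * s) ⟨k, s, s.2, rfl⟩)

variable (V) in
/-- The span `I` of the differences of the central elements `∑_{α ∈ Γ} c / (t - α s)`, `s ∈ S`. -/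
def centralIdeal (ω : ℂˣ) (T : ℕ) (S : Set ℂ) : Submodule ℂ (LieOf V (poleAlg (orbit ω S))) :=
  Submodule.span ℂ {x | ∃ s s' : S, x = centralSum V ω T S s - centralSum V ω T S s'}

/-- The cyclotomic global Lie algebra `L^Γ_S(𝓛)`, or rather its preimage under the quotient map
`Lie_A 𝓛 → Lie_A 𝓛 / I`, where `A = ℂ^∞_{Γ S}(t)`. It consists of those elements of `Lie_A 𝓛` whose
class modulo `I` lies in the image of `𝓛ᵒ ⊗ A` and is invariant under `Γ`. As `I` acts by zero on
tensor products of modules of level one, it has the same coinvariants as the quotient. -/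
def cycloGlobal (ω : ℂˣ) (T : ℕ) (σ : VLAut V) (Lo : Submodule ℂ V) (S : Set ℂ) :
    Submodule ℂ (LieOf V (poleAlg (orbit ω S))) :=
  (LinearMap.range (rho ∘ₗ TensorProduct.map Lo.subtype
      (LinearMap.id : poleAlg (orbit ω S) →ₗ[ℂ] poleAlg (orbit ω S))) ⊔ centralIdeal V ω T S) ⊓
    ⨅ k : ℕ, (centralIdeal V ω T S).comap (gammaAct ω σ S k - LinearMap.id)

variable (V) in
/-- The Laurent expansion at `z`, `a ⊗ f ↦ a ⊗ ι_{t-z} f`, from `Lie_{ℂ^∞_P(t)} 𝓛` to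
`L(𝓛) = Lie_{ℂ((t))} 𝓛`. -/
def expandAt (P : Set ℂ) (z : ℂ) : LieOf V (poleAlg P) →ₗ[ℂ] LieOf V (LaurentSeries ℂ) :=
  Submodule.mapQ _ _ (TensorProduct.map LinearMap.id
      { toFun := fun f => laurentAt z f
        map_add' := fun f g => map_add _ _ _
        map_smul' := fun r f => laurentAt_smul z r f })
    (by
      rintro _ ⟨x, rfl⟩
      induction x using TensorProduct.induction_on with
      | zero => simp
      | add x y hx hy => rw [map_add]; exact Submodule.add_mem _ hx hy
      | tmul a f =>
        refine ⟨a ⊗ₜ[ℂ] laurentAt z f, ?_⟩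
        simp only [bdry, LinearMap.add_apply, TensorProduct.map_tmul, LinearMap.id_apply, map_add]
        congr 2
        exact (laurentAt_ratDeriv z f).symm)

end Gamma

section Modules

variable (V : Type*) [AddCommGroup V] [Module ℂ V] [VertexLieAlgebra V]

/-- The Lie algebra `L(𝓛) = Lie_{ℂ((t))} 𝓛`. -/
abbrev LL : Type _ := LieOf V (LaurentSeries ℂ)

/-- The central element `c(-1)` of `L(𝓛)`. -/
def cMinusOne : LL V :=
  rho (VertexLieAlgebra.c ⊗ₜ[ℂ] (HahnSeries.single (-1 : ℤ) (1 : ℂ) : LaurentSeries ℂ))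

/-- A module over `L(𝓛)` has level one if the central element `c(-1)` acts as the identity. -/
def IsLevelOne (M : Type*) [AddCommGroup M] [Module ℂ M] [LieRingModule (LL V) M] : Prop :=
  ∀ m : M, ⁅cMinusOne V, m⁆ = m

/-- A module over `L(𝓛)` is smooth if for all `m` and `a` there is an `N` such that every element
`∑_{n ≥ N} f_n a(n) = a ⊗ ∑_{n ≥ N} f_n tⁿ` of `L(𝓛)` annihilates `m`. -/
def IsSmooth (M : Type*) [AddCommGroup M] [Module ℂ M] [LieRingModule (LL V) M] : Prop :=
  ∀ (m : M) (a : V), ∃ N : ℕ, ∀ f : LaurentSeries ℂ, (∀ n : ℤ, n < N → f.coeff n = 0) →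
    ⁅(rho (a ⊗ₜ[ℂ] f) : LL V), m⁆ = 0

/-- The left ideal of `U(L(𝓛))` generated by `a ⊗ f`, for `a ∈ 𝓛` and `f ∈ ℂ[[t]]`, and by
`c(-1) - 1`. -/
def vacIdeal : Submodule (UniversalEnvelopingAlgebra ℂ (LL V))
    (UniversalEnvelopingAlgebra ℂ (LL V)) :=
  Submodule.span _
    ({x | ∃ (a : V) (f : LaurentSeries ℂ), (∀ n : ℤ, n < 0 → f.coeff n = 0) ∧
        x = UniversalEnvelopingAlgebra.ι ℂ (rho (a ⊗ₜ[ℂ] f) : LL V)} ∪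
      {UniversalEnvelopingAlgebra.ι ℂ (cMinusOne V) - 1})

/-- The vacuum Verma module `𝕍(𝓛)` of level one: the `L(𝓛)`-module generated by a vector `|0⟩` subject
to the relations `(a ⊗ f) |0⟩ = 0`, for `a ∈ 𝓛` and `f ∈ ℂ[[t]]`, and `c(-1) |0⟩ = |0⟩`. -/
def Vac : Type _ := UniversalEnvelopingAlgebra ℂ (LL V) ⧸ vacIdeal V

instance : AddCommGroup (Vac V) :=
  inferInstanceAs (AddCommGroup (UniversalEnvelopingAlgebra ℂ (LL V) ⧸ vacIdeal V))

instance : Module (UniversalEnvelopingAlgebra ℂ (LL V)) (Vac V) :=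
  inferInstanceAs (Module (UniversalEnvelopingAlgebra ℂ (LL V))
    (UniversalEnvelopingAlgebra ℂ (LL V) ⧸ vacIdeal V))

instance : Module ℂ (Vac V) :=
  inferInstanceAs (Module ℂ (UniversalEnvelopingAlgebra ℂ (LL V) ⧸ vacIdeal V))

instance : IsScalarTower ℂ (UniversalEnvelopingAlgebra ℂ (LL V)) (Vac V) :=
  inferInstanceAs (IsScalarTower ℂ (UniversalEnvelopingAlgebra ℂ (LL V))
    (UniversalEnvelopingAlgebra ℂ (LL V) ⧸ vacIdeal V))

instance : LieRingModule (LL V) (Vac V) where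
  bracket x v := UniversalEnvelopingAlgebra.ι ℂ x • v
  add_lie x y v := by
    change UniversalEnvelopingAlgebra.ι ℂ (x + y) • v = _
    rw [map_add, add_smul]
  lie_add x v w := smul_add _ _ _
  leibniz_lie x y v := by
    change UniversalEnvelopingAlgebra.ι ℂ x • UniversalEnvelopingAlgebra.ι ℂ y • v =
      UniversalEnvelopingAlgebra.ι ℂ ⁅x, y⁆ • v +
        UniversalEnvelopingAlgebra.ι ℂ y • UniversalEnvelopingAlgebra.ι ℂ x • v
    have h : UniversalEnvelopingAlgebra.ι ℂ ⁅x, y⁆ =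
        UniversalEnvelopingAlgebra.ι ℂ x * UniversalEnvelopingAlgebra.ι ℂ y -
          UniversalEnvelopingAlgebra.ι ℂ y * UniversalEnvelopingAlgebra.ι ℂ x :=
      @LieHom.map_lie ℂ (LL V) (UniversalEnvelopingAlgebra ℂ (LL V)) _ _ _ LieRing.ofAssociativeRing
        LieAlgebra.ofAssociativeAlgebra (UniversalEnvelopingAlgebra.ι ℂ) x y
    rw [h, smul_smul, smul_smul, ← add_smul, sub_add_cancel]

instance : LieModule ℂ (LL V) (Vac V) where
  smul_lie r x v := by
    change UniversalEnvelopingAlgebra.ι ℂ (r • x) • v = r • UniversalEnvelopingAlgebra.ι ℂ x • v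
    rw [map_smul, smul_assoc]
  lie_smul r x v := by
    change UniversalEnvelopingAlgebra.ι ℂ x • r • v = r • UniversalEnvelopingAlgebra.ι ℂ x • v
    exact smul_algebra_smul_comm r _ v

/-- The vacuum vector `|0⟩`. -/
def vac : Vac V := Submodule.Quotient.mk (p := vacIdeal V) 1

end Modules

section Coinvariants

variable {V : Type*} [AddCommGroup V] [Module ℂ V] [VertexLieAlgebra V]
variable {ι : Type*} [Fintype ι] [DecidableEq ι]
variable (M : ι → Type*) [∀ i, AddCommGroup (M i)] [∀ i, Module ℂ (M i)]
  [∀ i, LieRingModule (LL V) (M i)] [∀ i, LieModule ℂ (LL V) (M i)]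

open scoped TensorProduct

/-- The action of `x` on `⨂_i M_{z_i}`, through the Laurent expansion at `z_i` on the factor `M i`. -/
def tensorAct (P : Set ℂ) (z : ι → ℂ) (x : LieOf V (poleAlg P)) :
    (⨂[ℂ] i, M i) →ₗ[ℂ] (⨂[ℂ] i, M i) :=
  ∑ i, PiTensorProduct.map (Function.update (fun j => (LinearMap.id : M j →ₗ[ℂ] M j)) i
    (LieModule.toEnd ℂ (LL V) (M i) (expandAt V P (z i) x)))

/-- The subspace `L^Γ_z(𝓛) . ⨂_i M_{z_i}`. -/
def coinvRel (ω : ℂˣ) (T : ℕ) (σ : VLAut V) (Lo : Submodule ℂ V) (z : ι → ℂ) :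
    Submodule ℂ (⨂[ℂ] i, M i) :=
  Submodule.span ℂ {w | ∃ x ∈ cycloGlobal ω T σ Lo (Set.range z), ∃ m : ⨂[ℂ] i, M i,
    w = tensorAct M _ z x m}

/-- The space of coinvariants `⨂_i M_{z_i} / L^Γ_z(𝓛)`. -/
abbrev Coinv (ω : ℂˣ) (T : ℕ) (σ : VLAut V) (Lo : Submodule ℂ V) (z : ι → ℂ) : Type _ :=
  (⨂[ℂ] i, M i) ⧸ coinvRel M ω T σ Lo z

/-- The subspace `L^Γ_{u,z}(𝓛) . (𝕍(𝓛) ⊗ ⨂_i M_{z_i})`, with `𝕍(𝓛)` attached to the point `u`. -/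
def vacCoinvRel (ω : ℂˣ) (T : ℕ) (σ : VLAut V) (Lo : Submodule ℂ V) (z : ι → ℂ) (u : ℂ) :
    Submodule ℂ (Vac V ⊗[ℂ] (⨂[ℂ] i, M i)) :=
  Submodule.span ℂ {w | ∃ x ∈ cycloGlobal ω T σ Lo (insert u (Set.range z)),
    ∃ m : Vac V ⊗[ℂ] (⨂[ℂ] i, M i),
      w = LinearMap.rTensor _ (LieModule.toEnd ℂ (LL V) (Vac V) (expandAt V _ u x)) m +
        LinearMap.lTensor _ (tensorAct M _ z x) m}

/-- The space of coinvariants `𝕍(𝓛) ⊗ ⨂_i M_{z_i} / L^Γ_{u,z}(𝓛)`. -/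
abbrev VacCoinv (ω : ℂˣ) (T : ℕ) (σ : VLAut V) (Lo : Submodule ℂ V) (z : ι → ℂ) (u : ℂ) : Type _ :=
  (Vac V ⊗[ℂ] (⨂[ℂ] i, M i)) ⧸ vacCoinvRel M ω T σ Lo z u

end Coinvariants

/-- The function `g` on `ℂ \ S` with values in a vector space `Q` is rational with poles at most in `S`:
it is a finite sum of terms `r(u) • q`, with `q ∈ Q` and `r` a rational function with poles in `S`. -/
def IsRationalWithPolesIn (S : Set ℂ) {Q : Type*} [AddCommGroup Q] [Module ℂ Q]
    (g : {u : ℂ // u ∉ S} → Q) : Prop :=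
  ∃ (n : ℕ) (r : Fin n → RatFunc ℂ) (q : Fin n → Q), (∀ j, PolesIn S (r j)) ∧
    ∀ u, g u = ∑ j, (r j).eval (RingHom.id ℂ) (u : ℂ) • q j

section InverseLimits

variable (V : Type*) [AddCommGroup V] [Module ℂ V] [VertexLieAlgebra V]

/-- An inverse system of smooth modules of level one over `L(𝓛)`, indexed by `ℕ`. -/
structure SmoothInvSystem where
  M : ℕ → Type*
  [acg : ∀ k, AddCommGroup (M k)]
  [mod : ∀ k, Module ℂ (M k)]
  [lrm : ∀ k, LieRingModule (LL V) (M k)]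
  [lm : ∀ k, LieModule ℂ (LL V) (M k)]
  level_one : ∀ k, IsLevelOne V (M k)
  smooth : ∀ k, IsSmooth V (M k)
  π : ∀ k l : ℕ, l ≤ k → (M k →ₗ⁅ℂ, LL V⁆ M l)
  π_self : ∀ (k : ℕ) (x : M k), π k k le_rfl x = x
  π_comp : ∀ (k l m : ℕ) (h₁ : l ≤ k) (h₂ : k ≤ m) (x : M m),
    π k l h₁ (π m k h₂ x) = π m l (h₁.trans h₂) x

attribute [instance] SmoothInvSystem.acg SmoothInvSystem.mod SmoothInvSystem.lrm SmoothInvSystem.lm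

variable {V}

instance piLieRingModule (X : SmoothInvSystem V) : LieRingModule (LL V) (∀ k, X.M k) where
  bracket x m := fun k => ⁅x, m k⁆
  add_lie x y m := funext fun k => add_lie x y (m k)
  lie_add x m n := funext fun k => lie_add x (m k) (n k)
  leibniz_lie x y m := funext fun k => leibniz_lie x y (m k)

instance (X : SmoothInvSystem V) : LieModule ℂ (LL V) (∀ k, X.M k) where
  smul_lie r x m := funext fun k => smul_lie r x (m k)
  lie_smul r x m := funext fun k => lie_smul r x (m k)

/-- The inverse limit: the module of all sequences compatible with the maps of the system. -/
def SmoothInvSystem.lim (X : SmoothInvSystem V) : LieSubmodule ℂ (LL V) (∀ k, X.M k) where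
  carrier := {x | ∀ (k l : ℕ) (h : l ≤ k), X.π k l h (x k) = x l}
  add_mem' hx hy k l h := by
    simp only [Pi.add_apply, map_add, hx k l h, hy k l h]
  zero_mem' k l h := by simp
  smul_mem' r x hx k l h := by
    simp only [Pi.smul_apply, map_smul, hx k l h]
  lie_mem {x m} hm k l h := by
    change X.π k l h ⁅x, m k⁆ = ⁅x, m l⁆
    rw [LieModuleHom.map_lie, hm k l h]

/-- The projection of a submodule `N` of the inverse limit to the `k`-th module of the system. -/
def SmoothInvSystem.proj (X : SmoothInvSystem V) (N : LieSubmodule ℂ (LL V) X.lim) (k : ℕ) :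
    N →ₗ[ℂ] X.M k where
  toFun x := ((x : X.lim) : ∀ k, X.M k) k
  map_add' _ _ := rfl
  map_smul' _ _ := rfl

end InverseLimits

end CycloCoinv

end

universe uV uI uM

open scoped TensorProduct RatFunc

noncomputable section

namespace CycloCoinv

open VertexLieAlgebra (D prod)
open DiffAlg (δ)

/-! ### Maps out of `Lie_A 𝓛`, and the centrality of `c`. -/

section LieOfBasics

variable {V : Type*} [AddCommGroup V] [Module ℂ V] [VertexLieAlgebra V]
variable {A : Type*} [NonUnitalCommRing A] [Module ℂ A] [IsScalarTower ℂ A A] [SMulCommClass ℂ A A]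
  [DiffAlg A]
variable {B : Type*} [NonUnitalCommRing B] [Module ℂ B] [IsScalarTower ℂ B B] [SMulCommClass ℂ B B]
  [DiffAlg B]

/-! The vacuum module at `u` is induced from the elements regular at `u`, and the global elements
with poles in `Γu` are complementary to these. Let `L` be `L(𝓛)`, let `L₊` be its subalgebra of
elements with coefficients in `ℂ[[t]]`, and let `H` be the Lie algebra of `Γ`-invariants with poles
in `Γu`. Expansion at `u` embeds `H` in `L`; averaging the principal part over `Γ` retracts `L` onto
`H` with kernel `L₊`, because `αu ≠ u` for `α ≠ 1` (`principal_expandInv`, `sub_expand_principal`).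
So `𝕍 = U(H)|0⟩`, and taking coinvariants by `H` moves each factor across the tensor sign: `hv ⊗ m ~
-v ⊗ hm`. To obtain this rule as a well-defined map `reduce : 𝕍 ⊗ M → M`, with `M` the tensor
product of the modules at the points `z i`, no PBW basis is used. Instead `L` is made to act on
`U(H)` as it would on `U(L)/U(L)L₊` (`matchedOp_lie`), and the orbit map of `1` is followed by the
anti-representation of `U(H)` on `M` (`matchedMap`).

An invariant with poles in `Γu ∪ Γz` splits into one from `H` and one with poles in `Γz`; the latter
is regular at `u` and kills `|0⟩`. Induction along `U(H)|0⟩` then shows that `reduce` maps relations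
to relations (`reduce_star_tmul_mem`) and that `v ⊗ m` and `|0⟩ ⊗ reduce (v ⊗ m)` have the same
class (`tmul_sub_mem_vacCoinvRel`). Thus `reduce` and `m ↦ |0⟩ ⊗ m` are inverse to each other on
coinvariants. The isomorphism is unique because its inverse is prescribed on the class of every `m`.

The central element needs care: the global algebra is built from `𝓛ᵒ` modulo `I`. It is replaced by
all `Γ`-invariants with the given poles, whose action is corrected by a functional: the sum of the
residues of the component along `c`, as measured by `κ`. After the correction `c ⊗ A` acts by zero,
and the relations are the same (`span_cycloGlobal`). The correction is compatible with brackets by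
the residue theorem: a bracket involves only products of two functions vanishing at infinity, so
infinity contributes no residue (`sum_resAt_inv_lie`). All of this takes place in `Lie_{ℂ(t)} 𝓛`,
where elements with different pole sets can be added and bracketed.

For rationality, filter `𝕍` by the number of factors from `L`. To reduce `(a ⊗ t^{-n-1})w ⊗ m`,
replace `a ⊗ t^{-n-1}` by the expansion of an element of `H` minus terms regular at `u`. The element
of `H` moves to `m`, and its expansions at the `z i` have coefficients that are powers of `(z i -
αu)⁻¹`. The regular terms do not raise the filtration degree, and their coefficients are powers of
`((1 - α)u)⁻¹`; this is the source of the pole at `0`. Smoothness makes every expansion finite,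
uniformly in `u` (`isRational_expansion`). For inverse limits, `reduce` is natural in the modules
(`map_reduce`), so it can be projected to the smooth quotients and treated there. -/

theorem LieOf.induction {p : LieOf V A → Prop} (h0 : p 0)
    (h1 : ∀ (a : V) (f : A), p (rho (a ⊗ₜ[ℂ] f))) (h2 : ∀ x y, p x → p y → p (x + y))
    (x : LieOf V A) : p x := by
  obtain ⟨x, rfl⟩ := rho_surjective x
  induction x using TensorProduct.induction_on with
  | zero => simpa using h0
  | tmul a f => exact h1 a f
  | add x y hx hy => rw [map_add]; exact h2 _ _ hx hy

theorem LieOf.hom_ext {W : Type*} [AddCommGroup W] [Module ℂ W] {φ ψ : LieOf V A →ₗ[ℂ] W}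
    (h : ∀ (a : V) (f : A), φ (rho (a ⊗ₜ[ℂ] f)) = ψ (rho (a ⊗ₜ[ℂ] f))) : φ = ψ :=
  LinearMap.ext fun x => LieOf.induction (p := fun x => φ x = ψ x) (by simp) h
    (fun x y hx hy => by rw [map_add, map_add, hx, hy]) x

theorem lie_rho_tmul (a b : V) (f g : A) (N : ℕ) (h : ∀ n, N ≤ n → prod n a b = 0) :
    ⁅(rho (a ⊗ₜ[ℂ] f) : LieOf V A), rho (b ⊗ₜ[ℂ] g)⁆ = ∑ n ∈ Finset.range N,
      ((n.factorial : ℂ)⁻¹) • rho (prod n a b ⊗ₜ[ℂ] (((δ : A →ₗ[ℂ] A) ^ n) f * g)) := by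
  rw [lie_rho, brT_tmul a b f g N h, map_sum]
  simp only [map_smul]

/-- The linear map `Lie_A 𝓛 → W` induced by a bilinear map `𝓛 × A → W` that kills `Im ∂`. -/
def LieOf.lift {W : Type*} [AddCommGroup W] [Module ℂ W] (φ : V →ₗ[ℂ] A →ₗ[ℂ] W)
    (h : ∀ a f, φ (D a) f + φ a (δ f) = 0) : LieOf V A →ₗ[ℂ] W :=
  (LinearMap.range (bdry V A)).liftQ (TensorProduct.lift φ) (by
    rintro _ ⟨x, rfl⟩
    rw [LinearMap.mem_ker]
    induction x using TensorProduct.induction_on with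
    | zero => simp
    | add x y hx hy => rw [map_add, map_add, hx, hy, add_zero]
    | tmul a f => simpa [bdry] using h a f)

theorem LieOf.lift_rho {W : Type*} [AddCommGroup W] [Module ℂ W] (φ : V →ₗ[ℂ] A →ₗ[ℂ] W)
    (h : ∀ a f, φ (D a) f + φ a (δ f) = 0) (a : V) (f : A) :
    LieOf.lift φ h (rho (a ⊗ₜ[ℂ] f)) = φ a f := by
  change TensorProduct.lift φ (a ⊗ₜ[ℂ] f) = _
  rw [TensorProduct.lift.tmul]

/-- The map `Lie_A 𝓛 → Lie_B 𝓛` induced by maps `ψ : 𝓛 → 𝓛`, `φ : A → B` which commute with the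
derivations up to a common scalar. -/
def LieOf.map (ψ : V →ₗ[ℂ] V) (φ : A →ₗ[ℂ] B) (s : ℂ) (h1 : ∀ a, ψ (D a) = s • D (ψ a))
    (h2 : ∀ f, φ (δ f) = s • δ (φ f)) : LieOf V A →ₗ[ℂ] LieOf V B :=
  LieOf.lift ((LinearMap.compr₂ (TensorProduct.mk ℂ V B) rho).compl₁₂ ψ φ) (by
    intro a f
    change rho (ψ (D a) ⊗ₜ[ℂ] φ f) + rho (ψ a ⊗ₜ[ℂ] φ (δ f)) = 0
    rw [h1, h2, TensorProduct.tmul_smul, ← TensorProduct.smul_tmul', map_smul, map_smul, rho_D,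
      smul_neg, neg_add_cancel])

theorem LieOf.map_rho (ψ : V →ₗ[ℂ] V) (φ : A →ₗ[ℂ] B) (s : ℂ) (h1 : ∀ a, ψ (D a) = s • D (ψ a))
    (h2 : ∀ f, φ (δ f) = s • δ (φ f)) (a : V) (f : A) :
    LieOf.map ψ φ s h1 h2 (rho (a ⊗ₜ[ℂ] f)) = rho (ψ a ⊗ₜ[ℂ] φ f) :=
  LieOf.lift_rho _ _ _ _

theorem delta_pow_comm (φ : A →ₗ[ℂ] B) (s : ℂ) (h2 : ∀ f, φ (δ f) = s • δ (φ f)) (n : ℕ) (f : A) :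
    φ (((δ : A →ₗ[ℂ] A) ^ n) f) = s ^ n • ((δ : B →ₗ[ℂ] B) ^ n) (φ f) := by
  induction n generalizing f with
  | zero => simp
  | succ n ih =>
    rw [pow_succ, Module.End.mul_apply, ih, h2, map_smul, smul_smul, pow_succ δ,
      Module.End.mul_apply, pow_succ]

/-- A linear map given by `a ⊗ f ↦ ψ a ⊗ φ f` is a Lie algebra homomorphism if `φ` is multiplicative
and `ψ` is multiplicative up to the appropriate powers of a scalar. -/
theorem LieOf.map_lie (Φ : LieOf V A →ₗ[ℂ] LieOf V B) (ψ : V →ₗ[ℂ] V) (φ : A →ₗ[ℂ] B) (s : ℂ)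
    (hΦ : ∀ a f, Φ (rho (a ⊗ₜ[ℂ] f)) = rho (ψ a ⊗ₜ[ℂ] φ f))
    (h2 : ∀ f, φ (δ f) = s • δ (φ f)) (hmul : ∀ f g, φ (f * g) = φ f * φ g)
    (hprod : ∀ n a b, s ^ n • ψ (prod n a b) = prod n (ψ a) (ψ b)) (x y : LieOf V A) :
    Φ ⁅x, y⁆ = ⁅Φ x, Φ y⁆ := by
  induction x using LieOf.induction with
  | h0 => simp
  | h2 x x' hx hx' => simp only [add_lie, map_add, hx, hx']
  | h1 a f =>
  induction y using LieOf.induction with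
  | h0 => simp
  | h2 x x' hx hx' => simp only [lie_add, map_add, hx, hx']
  | h1 b g =>
  obtain ⟨N, hN⟩ := VertexLieAlgebra.locality a b
  rw [hΦ, hΦ, lie_rho_tmul a b f g N hN, lie_rho_tmul _ _ _ _ N (fun n hn => by
    rw [← hprod, hN n hn, map_zero, smul_zero]), map_sum]
  refine Finset.sum_congr rfl fun n _ => ?_
  rw [map_smul, hΦ, hmul, delta_pow_comm φ s h2, ← hprod, smul_mul_assoc, TensorProduct.tmul_smul,
    TensorProduct.smul_tmul']

theorem D_c : D (VertexLieAlgebra.c : V) = 0 := by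
  have : (VertexLieAlgebra.c : V) ∈ LinearMap.ker (D : V →ₗ[ℂ] V) := by
    rw [VertexLieAlgebra.ker_D]; exact Submodule.mem_span_singleton_self _
  exact this

/-- Translation at index `n + 1` with `D c = 0` leaves `(n + 1) c_(n) b = 0`, so the vanishing of
these products need not be an axiom. -/
theorem prod_c_left (n : ℕ) (b : V) : prod n (VertexLieAlgebra.c : V) b = 0 := by
  have h := VertexLieAlgebra.translation_succ n VertexLieAlgebra.c b
  rw [D_c, map_zero, LinearMap.zero_apply] at h
  have h1 : ((n : ℂ) + 1) ≠ 0 := by exact_mod_cast Nat.succ_ne_zero n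
  exact (smul_eq_zero.1 h.symm).resolve_left (neg_ne_zero.2 h1)

theorem rho_c_lie (f : A) (y : LieOf V A) :
    ⁅(rho (VertexLieAlgebra.c ⊗ₜ[ℂ] f) : LieOf V A), y⁆ = 0 := by
  induction y using LieOf.induction with
  | h0 => simp
  | h2 x x' hx hx' => simp only [lie_add, hx, hx', add_zero]
  | h1 b g => rw [lie_rho_tmul _ _ _ _ 0 (fun n _ => prod_c_left n b)]; simp

theorem rho_c_delta (f : A) : (rho (VertexLieAlgebra.c ⊗ₜ[ℂ] δ f) : LieOf V A) = 0 := by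
  rw [← neg_eq_zero, ← rho_D, D_c, TensorProduct.zero_tmul, map_zero]

end LieOfBasics

/-! ### Enveloping algebras: the action of `L` on `U(H)` when `L = e(H) ⊕ ker p`. -/

section MatchedPair

open UniversalEnvelopingAlgebra (ι)

variable {L : Type*} [LieRing L] [LieAlgebra ℂ L]

/-- The universal enveloping algebra over `ℂ`. -/
abbrev Uc (L : Type*) [LieRing L] [LieAlgebra ℂ L] : Type _ := UniversalEnvelopingAlgebra ℂ L

attribute [local instance] LieRing.ofAssociativeRing

/-- By the universal property, the identity of `U(L)` factors through the subalgebra generated by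
`L`. -/
theorem UEA.adjoin_range_iota : Algebra.adjoin ℂ (Set.range (ι ℂ : L → Uc L)) = ⊤ := by
  set S := Algebra.adjoin ℂ (Set.range (ι ℂ : L → Uc L)) with hS
  let f : L →ₗ⁅ℂ⁆ S :=
    { toFun := fun x => ⟨ι ℂ x, Algebra.subset_adjoin ⟨x, rfl⟩⟩
      map_add' := fun x y => Subtype.ext (map_add _ _ _)
      map_smul' := fun r x => Subtype.ext (map_smul _ _ _)
      map_lie' := fun {x y} => Subtype.ext (LieHom.map_lie _ _ _) }
  have h : S.val.comp (UniversalEnvelopingAlgebra.lift ℂ f) = AlgHom.id ℂ _ := by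
    apply UniversalEnvelopingAlgebra.hom_ext
    ext x
    simp [f, -UniversalEnvelopingAlgebra.ι_apply, UniversalEnvelopingAlgebra.lift_ι_apply]
  rw [eq_top_iff]
  intro w _
  have := DFunLike.congr_fun h w
  simp only [AlgHom.comp_apply, AlgHom.id_apply] at this
  rw [← this]
  exact (UniversalEnvelopingAlgebra.lift ℂ f w).2

/-- A subspace of a module over the enveloping algebra that is stable under the Lie algebra is stable
under the enveloping algebra. -/
theorem UEA.smul_mem {W : Type*} [AddCommGroup W] [Module ℂ W] [Module (Uc L) W]
    [IsScalarTower ℂ (Uc L) W] (N : Submodule ℂ W) (h : ∀ (x : L), ∀ w ∈ N, ι ℂ x • w ∈ N)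
    (u : Uc L) (w : W) (hw : w ∈ N) : u • w ∈ N := by
  have hu : u ∈ Algebra.adjoin ℂ (Set.range (ι ℂ : L → Uc L)) := by
    rw [UEA.adjoin_range_iota]; trivial
  induction hu using Algebra.adjoin_induction generalizing w with
  | mem x hx => obtain ⟨x, rfl⟩ := hx; exact h x w hw
  | algebraMap r => rw [algebraMap_smul]; exact N.smul_mem r hw
  | add x y _ _ hx hy => rw [add_smul]; exact N.add_mem (hx w hw) (hy w hw)
  | mul x y _ _ hx hy => rw [mul_smul]; exact hx _ (hy w hw)

theorem UEA.induction {p : Uc L → Prop} (h0 : p 0) (h1 : p 1) (hadd : ∀ x y, p x → p y → p (x + y))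
    (hsmul : ∀ (r : ℂ) x, p x → p (r • x)) (hι : ∀ x w, p w → p (ι ℂ x * w)) (w : Uc L) : p w := by
  let N : Submodule ℂ (Uc L) :=
    { carrier := {w | p w}
      add_mem' := fun {x y} hx hy => hadd x y hx hy
      zero_mem' := h0
      smul_mem' := fun r x hx => hsmul r x hx }
  have := UEA.smul_mem (L := L) N (fun x w hw => hι x w hw) w 1 h1
  rwa [smul_eq_mul, mul_one] at this

variable {H : Type*} [LieRing H] [LieAlgebra ℂ H] (e : H →ₗ⁅ℂ⁆ L) (p : L →ₗ[ℂ] H)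

/-- The representation of `H` on `Hom(L, U(H))`. -/
def homRep : H →ₗ⁅ℂ⁆ Module.End ℂ (L →ₗ[ℂ] Uc H) where
  toFun h :=
    { toFun := fun φ => (LinearMap.mulLeft ℂ (ι ℂ h)) ∘ₗ φ -
        φ ∘ₗ (LieAlgebra.ad ℂ L (e h) : L →ₗ[ℂ] L)
      map_add' := fun φ ψ => by
        ext y; simp [mul_add]; abel
      map_smul' := fun r φ => by
        ext y; simp [smul_sub] }
  map_add' h h' := by
    ext φ y; simp [add_mul]; abel
  map_smul' r h := by
    ext φ y; simp [smul_sub]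
  map_lie' {h h'} := by
    ext φ y
    simp only [LieHom.map_lie, LinearMap.coe_mk, AddHom.coe_mk, LinearMap.sub_apply,
      LinearMap.comp_apply, LinearMap.mulLeft_apply, LieAlgebra.ad_apply, LieRing.of_associative_ring_bracket,
      Module.End.mul_apply, sub_mul, map_sub, mul_assoc]
    abel

theorem homRep_apply (h : H) (φ : L →ₗ[ℂ] Uc H) (y : L) :
    homRep e h φ y = ι ℂ h * φ y - φ ⁅e h, y⁆ := rfl

/-- The operator on `U(H)` by which `y ∈ L` acts. -/
def matchedOp : L →ₗ[ℂ] Uc H →ₗ[ℂ] Uc H :=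
  -- The element `w` of `U(H)` is applied to the vector `ι ∘ p` of `Hom(L, U(H))`, and the result is
  -- evaluated at `y`.
  LinearMap.flip
    ((LinearMap.applyₗ ((ι ℂ : H →ₗ⁅ℂ⁆ Uc H).toLinearMap ∘ₗ p)) ∘ₗ
      (UniversalEnvelopingAlgebra.lift ℂ (homRep e)).toLinearMap)

theorem matchedOp_one (y : L) : matchedOp e p y 1 = ι ℂ (p y) := by
  simp [-UniversalEnvelopingAlgebra.ι_apply, matchedOp]

/-- Together with the value at `1`, this recursion determines the operator. It is the rule `y h w =
h y w - [h, y] w` in `U(L)/U(L) ker p`. That `homRep` is a representation of `H` is what makes the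
recursion consistent with the relations of `U(H)`. -/
theorem matchedOp_mul (y : L) (h : H) (w : Uc H) : matchedOp e p y (ι ℂ h * w) =
    ι ℂ h * matchedOp e p y w - matchedOp e p ⁅e h, y⁆ w := by
  simp [-UniversalEnvelopingAlgebra.ι_apply, UniversalEnvelopingAlgebra.lift_ι_apply, matchedOp, homRep_apply]

variable (hpe : ∀ h, p (e h) = h)

include hpe in
-- By induction on `w`: moving `e h` past a factor `x` produces `x h w - [x, h] w = h x w`.
theorem matchedOp_e (h : H) (w : Uc H) : matchedOp e p (e h) w = ι ℂ h * w := by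
  induction w using UEA.induction generalizing h with
  | h0 => simp
  | h1 => rw [matchedOp_one, hpe, mul_one]
  | hadd x y hx hy => rw [map_add, mul_add, hx, hy]
  | hsmul r x hx => rw [map_smul, hx, mul_smul_comm]
  | hι x w hw =>
    rw [matchedOp_mul, hw, ← LieHom.map_lie, hw, LieHom.map_lie,
      LieRing.of_associative_ring_bracket]
    noncomm_ring

variable (hker : ∀ x y, p x = 0 → p y = 0 → p ⁅x, y⁆ = 0)

include hpe hker in
-- Induction on `w`. The inductive step is the Jacobi identity; only the value at `1` uses that `ker
-- p` is a subalgebra.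
theorem matchedOp_lie (x y : L) (w : Uc H) : matchedOp e p ⁅x, y⁆ w =
    matchedOp e p x (matchedOp e p y w) - matchedOp e p y (matchedOp e p x w) := by
  induction w using UEA.induction generalizing x y with
  | h0 => simp
  | h1 =>
    simp only [matchedOp_one]
    have key : ∀ x h, matchedOp e p x (ι ℂ h) = ι ℂ h * ι ℂ (p x) - ι ℂ (p ⁅e h, x⁆) := by
      intro x h
      have := matchedOp_mul e p x h 1
      rwa [mul_one, matchedOp_one, matchedOp_one] at this
    rw [key, key]
    -- The components of `x` and `y` in `ker p` have their bracket in `ker p`; expanding it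
    -- expresses `p ⁅x, y⁆` through brackets with elements of `e(H)`.
    have h1 := hker (x - e (p x)) (y - e (p y)) (by rw [map_sub, hpe, sub_self])
      (by rw [map_sub, hpe, sub_self])
    rw [sub_lie, lie_sub, lie_sub, ← LieHom.map_lie, map_sub, map_sub, map_sub, hpe] at h1
    have h2 : p ⁅x, y⁆ = p ⁅x, e (p y)⁆ + p ⁅e (p x), y⁆ - ⁅p x, p y⁆ := by
      rw [← sub_eq_zero, ← h1]; abel
    rw [h2, ← lie_skew x, map_neg, map_sub, map_add, LieHom.map_lie,
      LieRing.of_associative_ring_bracket, map_neg]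
    abel
  | hadd z z' hz hz' => simp only [map_add, hz, hz']; abel
  | hsmul r z hz => simp only [map_smul, hz, smul_sub]
  | hι h w hw =>
    have hj : ⁅e h, ⁅x, y⁆⁆ = ⁅⁅e h, x⁆, y⁆ + ⁅x, ⁅e h, y⁆⁆ := leibniz_lie _ _ _
    simp only [matchedOp_mul, map_sub, hw, hj, map_add, LinearMap.add_apply, mul_sub]
    abel

/-- The action of `L` on `U(H)` for a matched pair. -/
def matchedRep : L →ₗ⁅ℂ⁆ Module.End ℂ (Uc H) :=
  { matchedOp e p with
    map_lie' := fun {x y} => by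
      ext w
      exact matchedOp_lie e p hpe hker x y w }

theorem matchedRep_apply (x : L) (w : Uc H) : matchedRep e p hpe hker x w = matchedOp e p x w := rfl

variable {N : Type*} [AddCommGroup N] [Module ℂ N] (τ : H →ₗ⁅ℂ⁆ Module.End ℂ N)

/-- The anti-representation of `U(H)` with `h ↦ -τ h`. -/
def antiRep : Uc H →ₐ[ℂ] (Module.End ℂ N)ᵐᵒᵖ :=
  UniversalEnvelopingAlgebra.lift ℂ
    { toFun := fun h => MulOpposite.op (-τ h)
      map_add' := fun x y => by rw [map_add, neg_add, MulOpposite.op_add]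
      map_smul' := fun r x => by rw [map_smul, ← smul_neg, MulOpposite.op_smul]; rfl
      map_lie' := fun {x y} => by
        rw [LieHom.map_lie, LieRing.of_associative_ring_bracket,
          LieRing.of_associative_ring_bracket, ← MulOpposite.op_mul, ← MulOpposite.op_mul,
          ← MulOpposite.op_sub]
        congr 1
        noncomm_ring }

theorem antiRep_iota (h : H) : antiRep τ (ι ℂ h) = MulOpposite.op (-τ h) := by
  simp [-UniversalEnvelopingAlgebra.ι_apply, UniversalEnvelopingAlgebra.lift_ι_apply, antiRep]

/-- The map `U(L) → End N` that sends `h₁ ⋯ hₙ r` to `(-1)ⁿ τ(hₙ) ⋯ τ(h₁)` times the value on `r`. -/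
def matchedMap : Uc L →ₗ[ℂ] Module.End ℂ N :=
  (MulOpposite.opLinearEquiv ℂ).symm.toLinearMap ∘ₗ (antiRep τ).toLinearMap ∘ₗ
    (LinearMap.applyₗ (1 : Uc H)) ∘ₗ
      (UniversalEnvelopingAlgebra.lift ℂ (matchedRep e p hpe hker)).toLinearMap

theorem matchedMap_apply (w : Uc L) : matchedMap e p hpe hker τ w =
    (antiRep τ (UniversalEnvelopingAlgebra.lift ℂ (matchedRep e p hpe hker) w 1)).unop := rfl

theorem matchedMap_one : matchedMap e p hpe hker τ 1 = 1 := by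
  simp [-UniversalEnvelopingAlgebra.ι_apply, matchedMap_apply]

/-- On `U(H)` the element `e h` acts by left multiplication, which the anti-representation turns
into composition with `-τ h` on the right. -/
theorem matchedMap_e_mul (h : H) (w : Uc L) : matchedMap e p hpe hker τ (ι ℂ (e h) * w) =
    -(matchedMap e p hpe hker τ w * τ h) := by
  simp [-UniversalEnvelopingAlgebra.ι_apply, UniversalEnvelopingAlgebra.lift_ι_apply, matchedMap_apply, matchedRep_apply, matchedOp_e e p hpe, antiRep_iota]

theorem matchedMap_mul_ker (r : L) (hr : p r = 0) (w : Uc L) :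
    matchedMap e p hpe hker τ (w * ι ℂ r) = 0 := by
  simp [-UniversalEnvelopingAlgebra.ι_apply, UniversalEnvelopingAlgebra.lift_ι_apply, matchedMap_apply, matchedRep_apply, matchedOp_one, hr]

/-- A central `s` acts on `U(H)` by right multiplication by `p s` and commutes with the action of
`U(L)`. The anti-representation sends that factor to `-τ (p s) = 1`. With `s = c(-1)` this gives the
level-one relation. -/
theorem matchedMap_mul_central (s : L) (hs : ∀ y : L, ⁅s, y⁆ = 0) (hτ : τ (p s) = -1) (w : Uc L) :
    matchedMap e p hpe hker τ (w * ι ℂ s) = matchedMap e p hpe hker τ w := by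
  have h1 : ∀ v : Uc H, matchedOp e p s v = v * ι ℂ (p s) := by
    intro v
    induction v using UEA.induction with
    | h0 => simp
    | h1 => rw [matchedOp_one, one_mul]
    | hadd x y hx hy => rw [map_add, add_mul, hx, hy]
    | hsmul r x hx => rw [map_smul, hx, smul_mul_assoc]
    | hι x w hw => rw [matchedOp_mul, hw, ← lie_skew, hs, neg_zero, map_zero, LinearMap.zero_apply,
        sub_zero, mul_assoc]
  have h2 : ∀ (u : Uc L) (v : Uc H), UniversalEnvelopingAlgebra.lift ℂ (matchedRep e p hpe hker) u
      (matchedOp e p s v) =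
      matchedOp e p s (UniversalEnvelopingAlgebra.lift ℂ (matchedRep e p hpe hker) u v) := by
    intro u
    induction u using UEA.induction with
    | h0 => simp
    | h1 => simp
    | hadd x y hx hy => intro v; rw [map_add, LinearMap.add_apply, hx, hy]; simp
    | hsmul r x hx => intro v; rw [map_smul, LinearMap.smul_apply, hx]; simp
    | hι x w hw =>
      intro v
      have h3 := matchedOp_lie e p hpe hker s x
        (UniversalEnvelopingAlgebra.lift ℂ (matchedRep e p hpe hker) w v)
      rw [hs, map_zero, LinearMap.zero_apply] at h3
      simp only [map_mul, UniversalEnvelopingAlgebra.lift_ι_apply, Module.End.mul_apply, hw,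
        matchedRep_apply]
      exact (sub_eq_zero.1 h3.symm).symm
  rw [matchedMap_apply, matchedMap_apply, map_mul, UniversalEnvelopingAlgebra.lift_ι_apply,
    Module.End.mul_apply, matchedRep_apply, h2, h1, map_mul, MulOpposite.unop_mul, antiRep_iota,
    hτ]
  simp

end MatchedPair

/-! ### Rational functions: partial fractions and Laurent expansions. -/

section Rational

/-- The field of rational functions with the derivation `d/dt`. -/
instance ratFuncDiffAlg : DiffAlg (RatFunc ℂ) where
  δ :=
    { toFun := ratDeriv
      map_add' := ratDeriv_add
      map_smul' := ratDeriv_smul }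
  leibniz := ratDeriv_mul

theorem delta_ratFunc (f : RatFunc ℂ) : (δ f : RatFunc ℂ) = ratDeriv f := rfl

theorem delta_laurent (f : LaurentSeries ℂ) : (δ f : LaurentSeries ℂ) = LaurentSeries.derivative ℂ f :=
  rfl

theorem delta_laurent_coeff (f : LaurentSeries ℂ) (n : ℤ) :
    (δ f : LaurentSeries ℂ).coeff n = (n + 1) * f.coeff (n + 1) := by
  rw [delta_laurent]
  simp

/-- The Laurent expansion at `z` as a linear map. -/
def laurentLin (z : ℂ) : RatFunc ℂ →ₗ[ℂ] LaurentSeries ℂ where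
  toFun f := laurentAt z f
  map_add' _ _ := map_add _ _ _
  map_smul' r f := laurentAt_smul z r f

/-- The rational function `(t - p)^{-(n+1)}`. -/
def polePow (p : ℂ) (n : ℕ) : RatFunc ℂ :=
  ((algebraMap (Polynomial ℂ) (RatFunc ℂ) (Polynomial.X - Polynomial.C p)) ^ (n + 1))⁻¹

theorem polePow_eq_div (p : ℂ) (n : ℕ) : polePow p n =
    algebraMap (Polynomial ℂ) (RatFunc ℂ) 1 /
      algebraMap (Polynomial ℂ) (RatFunc ℂ) ((Polynomial.X - Polynomial.C p) ^ (n + 1)) := by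
  rw [polePow, map_one, map_pow, one_div]

theorem polePow_mem (P : Set ℂ) (p : ℂ) (hp : p ∈ P) (n : ℕ) : polePow p n ∈ poleAlg P := by
  rw [polePow_eq_div]
  refine ⟨PolesIn.div fun s hs => ?_, (vanishes_div_iff _ _ ?_).2 ?_⟩
  · rw [Polynomial.IsRoot, Polynomial.eval_pow] at hs
    have := pow_eq_zero_iff (n := n + 1) (by omega) |>.1 hs
    rw [← Polynomial.IsRoot, Polynomial.root_X_sub_C] at this
    rwa [← this]
  · exact pow_ne_zero _ (Polynomial.X_sub_C_ne_zero p)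
  · rw [Polynomial.degree_pow, Polynomial.degree_X_sub_C, Polynomial.degree_one]
    simp only [nsmul_eq_mul, mul_one]
    exact_mod_cast Nat.succ_pos n

theorem simplePole_coe (P : Set ℂ) (p : ℂ) (hp : p ∈ P) :
    ((simplePole P p hp : poleAlg P) : RatFunc ℂ) = polePow p 0 := by
  rw [polePow_eq_div, zero_add, pow_one]; rfl

theorem delta_polePow (p : ℂ) (n : ℕ) :
    (δ (polePow p n) : RatFunc ℂ) = -((n : ℂ) + 1) • polePow p (n + 1) := by
  have h0 := Polynomial.X_sub_C_ne_zero p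
  rw [delta_ratFunc, polePow_eq_div, ratDeriv_div _ _ (pow_ne_zero _ h0), polePow_eq_div,
    RatFunc.smul_eq_C_mul, ← RatFunc.algebraMap_C, ← mul_div_assoc, ← map_mul, div_eq_div_iff
    (RatFunc.algebraMap_ne_zero (pow_ne_zero _ (pow_ne_zero _ h0)))
    (RatFunc.algebraMap_ne_zero (pow_ne_zero _ h0)), ← map_mul, ← map_mul]
  congr 1
  rw [Polynomial.derivative_pow, Polynomial.derivative_sub, Polynomial.derivative_X,
    Polynomial.derivative_C, Polynomial.derivative_one]
  simp only [map_neg, map_add, map_one, Nat.cast_add, Nat.cast_one,     Nat.add_sub_cancel, map_natCast]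
  ring

theorem laurentAt_polePow (p q : ℂ) (n : ℕ) : laurentAt q (polePow p n) =
    ((HahnSeries.single (1 : ℤ) (1 : ℂ) + HahnSeries.C (q - p) : LaurentSeries ℂ) ^ (n + 1))⁻¹ := by
  rw [polePow, map_inv₀, map_pow, laurentAt_algebraMap, map_sub, Polynomial.taylor_X,
    Polynomial.taylor_C, map_sub, map_add, algebraMap_X_laurent, algebraMap_C_laurent,
    algebraMap_C_laurent, add_sub_assoc, ← map_sub]

theorem laurentAt_polePow_self (p : ℂ) (n : ℕ) :
    laurentAt p (polePow p n) = HahnSeries.single (-((n : ℤ) + 1)) (1 : ℂ) := by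
  rw [laurentAt_polePow, sub_self, map_zero, add_zero, HahnSeries.single_pow]
  rw [HahnSeries.inv_single]
  simp

/-- Partial fractions: the rational functions vanishing at infinity, with poles in `P`, are spanned
by the negative powers of `t - p`, `p ∈ P`. -/
theorem mem_span_polePow {P : Set ℂ} {f : RatFunc ℂ} (hf : f ∈ poleAlg P) :
    f ∈ Submodule.span ℂ {g | ∃ p ∈ P, ∃ n, g = polePow p n} := by
  have key : ∀ (d : ℕ) (a b : Polynomial ℂ), b ≠ 0 → b.natDegree = d → (∀ s, b.IsRoot s → s ∈ P) →
      a.degree < b.degree → algebraMap _ (RatFunc ℂ) a / algebraMap _ (RatFunc ℂ) b ∈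
        Submodule.span ℂ {g | ∃ p ∈ P, ∃ n, g = polePow p n} := by
    intro d
    induction d with
    | zero =>
      intro a b hb hd _ hab
      have : a = 0 := by
        rw [Polynomial.degree_eq_natDegree hb, hd] at hab
        exact Polynomial.degree_lt_iff_coeff_zero a 0 |>.1 hab |> fun h =>
          Polynomial.ext fun n => by simpa using h n (Nat.zero_le n)
      rw [this, map_zero, zero_div]
      exact Submodule.zero_mem _
    | succ d ih =>
      intro a b hb hd hP hab
      obtain ⟨s, hs⟩ := IsAlgClosed.exists_root b (by
        rw [Polynomial.degree_eq_natDegree hb, hd]; exact_mod_cast Nat.succ_ne_zero d)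
      obtain ⟨m, q, hbq, hqs⟩ : ∃ (m : ℕ) (q : Polynomial ℂ),
          b = (Polynomial.X - Polynomial.C s) ^ (m + 1) * q ∧ ¬ q.IsRoot s := by
        obtain ⟨q, hq, hnd⟩ := Polynomial.exists_eq_pow_rootMultiplicity_mul_and_not_dvd b hb s
        have hpos : 0 < b.rootMultiplicity s := (Polynomial.rootMultiplicity_pos hb).2 hs
        refine ⟨b.rootMultiplicity s - 1, q, ?_, fun h => hnd (Polynomial.dvd_iff_isRoot.2 h)⟩
        rw [Nat.sub_add_cancel hpos]
        exact hq
      have hX := Polynomial.X_sub_C_ne_zero s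
      have hq0 : q ≠ 0 := by rintro rfl; simp at hqs
      -- With this value `a - c q` vanishes at `s`, so that subtracting `c (t - s)^{-(m+1)}` lowers
      -- the multiplicity of the root `s` in the denominator.
      set c := a.eval s / q.eval s with hc
      have hroot : (a - Polynomial.C c * q).IsRoot s := by
        rw [Polynomial.IsRoot, Polynomial.eval_sub, Polynomial.eval_mul, Polynomial.eval_C, hc,
          div_mul_cancel₀ _ hqs, sub_self]
      obtain ⟨a', ha'⟩ := Polynomial.dvd_iff_isRoot.2 hroot
      have hdegq : q.degree < b.degree := by
        rw [hbq, Polynomial.degree_mul, Polynomial.degree_pow, Polynomial.degree_X_sub_C,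
          Polynomial.degree_eq_natDegree hq0]
        simp only [nsmul_eq_mul, mul_one]
        norm_cast
        omega
      have hlt : (a - Polynomial.C c * q).degree < b.degree :=
        lt_of_le_of_lt (Polynomial.degree_sub_le _ _) (max_lt hab
          (lt_of_le_of_lt (by
            rw [← Polynomial.smul_eq_C_mul]; exact Polynomial.degree_smul_le c q) hdegq))
      have hb'0 : (Polynomial.X - Polynomial.C s) ^ m * q ≠ 0 := mul_ne_zero (pow_ne_zero _ hX) hq0
      have hbb : b = (Polynomial.X - Polynomial.C s) * ((Polynomial.X - Polynomial.C s) ^ m * q) := by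
        rw [hbq, pow_succ]; ring
      have hdecomp : algebraMap _ (RatFunc ℂ) a / algebraMap _ (RatFunc ℂ) b =
          algebraMap _ (RatFunc ℂ) a' /
            algebraMap _ (RatFunc ℂ) ((Polynomial.X - Polynomial.C s) ^ m * q) +
          c • polePow s m := by
        have e1 : a = (Polynomial.X - Polynomial.C s) * a' + Polynomial.C c * q := by
          rw [← ha']; ring
        have h1 := RatFunc.algebraMap_ne_zero hX
        have h2 := RatFunc.algebraMap_ne_zero hq0
        rw [hbq, polePow, e1, RatFunc.smul_eq_C_mul, ← RatFunc.algebraMap_C]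
        simp only [map_mul, map_add, map_pow]
        field_simp
        ring
      rw [hdecomp]
      refine Submodule.add_mem _ (ih a' _ hb'0 ?_ ?_ ?_) (Submodule.smul_mem _ _
        (Submodule.subset_span ⟨s, hP s hs, m, rfl⟩))
      · have := congrArg Polynomial.natDegree hbb
        rw [Polynomial.natDegree_mul hX hb'0, Polynomial.natDegree_X_sub_C, hd] at this
        omega
      · intro r hr
        exact hP r (by rw [hbb]; exact Polynomial.root_mul_left_of_isRoot _ hr)
      · rw [ha', hbb, Polynomial.degree_mul, Polynomial.degree_mul,
          Polynomial.degree_X_sub_C] at hlt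
        exact lt_of_add_lt_add_left hlt
  have h := key _ f.num f.denom f.denom_ne_zero rfl hf.1 (by
    rw [← vanishes_div_iff _ _ f.denom_ne_zero, f.num_div_denom]; exact hf.2)
  rwa [f.num_div_denom] at h

theorem poleAlg_induction {P : Set ℂ} {p : RatFunc ℂ → Prop} (h0 : p 0)
    (hadd : ∀ f g, p f → p g → p (f + g)) (hsmul : ∀ (r : ℂ) f, p f → p (r • f))
    (hpole : ∀ s ∈ P, ∀ n, p (polePow s n)) {f : RatFunc ℂ} (hf : f ∈ poleAlg P) : p f := by
  have h := mem_span_polePow hf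
  clear hf
  induction h using Submodule.span_induction with
  | mem x hx => obtain ⟨s, hs, n, rfl⟩ := hx; exact hpole s hs n
  | zero => exact h0
  | add x y _ _ hx hy => exact hadd x y hx hy
  | smul r x _ hx => exact hsmul r x hx

/-- The coefficients of the expansion of `(t - p)^{-(n+1)}` at `q ≠ p`, up to the power of `q - p`. -/
theorem exists_coeff_polePow : ∃ C : ℕ → ℕ → ℂ, ∀ (n : ℕ) (p q : ℂ), p ≠ q →
    (∀ j : ℕ, (laurentAt q (polePow p n)).coeff j = C n j * ((q - p) ^ (n + 1 + j))⁻¹) ∧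
    ∀ j : ℤ, j < 0 → (laurentAt q (polePow p n)).coeff j = 0 := by
  -- The geometric series for `1 / (X + d)`, with `d = q - p` in the application.
  have hinv : ∀ d : ℂ, d ≠ 0 →
      (PowerSeries.X + PowerSeries.C d) * PowerSeries.mk (fun j => (-1) ^ j * (d ^ (j + 1))⁻¹) = 1 := by
    intro d hd
    rw [add_mul]
    ext j
    rw [map_add, PowerSeries.coeff_C_mul, PowerSeries.coeff_mk, PowerSeries.coeff_one]
    cases j with
    | zero => rw [PowerSeries.coeff_zero_X_mul]; simp [hd]
    | succ j =>
      rw [PowerSeries.coeff_succ_X_mul, PowerSeries.coeff_mk, if_neg (Nat.succ_ne_zero j)]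
      field_simp
      ring
  -- By homogeneity the coefficient of `X^j` in `(X + d)^{-(n+1)}` is a constant times
  -- `d^{-(n+1+j)}`. The constants do not depend on `d`; hence expansions at or around moving points
  -- have rational coefficients.
  have hpow : ∃ C : ℕ → ℕ → ℂ, ∀ (n : ℕ) (d : ℂ), ∀ j : ℕ,
      PowerSeries.coeff j ((PowerSeries.mk (fun j => (-1) ^ j * (d ^ (j + 1))⁻¹)) ^ (n + 1)) =
        C n j * (d ^ (n + 1 + j))⁻¹ := by
    have : ∀ n : ℕ, ∃ C : ℕ → ℂ, ∀ (d : ℂ), ∀ j : ℕ,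
      PowerSeries.coeff j ((PowerSeries.mk (fun j => (-1) ^ j * (d ^ (j + 1))⁻¹)) ^ (n + 1)) =
        C j * (d ^ (n + 1 + j))⁻¹ := by
      intro n
      induction n with
      | zero =>
        refine ⟨fun j => (-1) ^ j, fun d j => ?_⟩
        rw [zero_add, pow_one, PowerSeries.coeff_mk, add_comm 1 j]
      | succ n ih =>
        obtain ⟨C, hC⟩ := ih
        refine ⟨fun j => ∑ x ∈ Finset.HasAntidiagonal.antidiagonal j, C x.1 * (-1) ^ x.2,
          fun d j => ?_⟩
        rw [pow_succ _ (n + 1), PowerSeries.coeff_mul, Finset.sum_mul]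
        refine Finset.sum_congr rfl fun x hx => ?_
        rw [Finset.HasAntidiagonal.mem_antidiagonal] at hx
        rw [hC, PowerSeries.coeff_mk, ← hx,
          show n + 1 + 1 + (x.1 + x.2) = (n + 1 + x.1) + (x.2 + 1) by ring, pow_add d (n + 1 + x.1),
          mul_inv]
        ring
    choose C hC using this
    exact ⟨C, hC⟩
  obtain ⟨C, hC⟩ := hpow
  refine ⟨C, fun n p q hpq => ?_⟩
  have hd : q - p ≠ 0 := sub_ne_zero.2 hpq.symm
  have hps : laurentAt q (polePow p n) = HahnSeries.ofPowerSeries ℤ ℂ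
      ((PowerSeries.mk (fun j => (-1) ^ j * ((q - p) ^ (j + 1))⁻¹)) ^ (n + 1)) := by
    rw [laurentAt_polePow, map_pow, ← inv_pow]
    congr 1
    have := congrArg (HahnSeries.ofPowerSeries ℤ ℂ) (hinv (q - p) hd)
    rw [map_mul, map_one, map_add, HahnSeries.ofPowerSeries_X, HahnSeries.ofPowerSeries_C] at this
    exact (eq_inv_of_mul_eq_one_right this).symm
  rw [hps]
  refine ⟨fun j => ?_, fun j hj => ?_⟩
  · rw [← hC n (q - p) j]
    exact HahnSeries.ofPowerSeries_apply_coeff _ _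
  · refine HahnSeries.embDomain_of_notMem_range ?_
    rintro ⟨k, hk⟩
    simp at hk
    omega

/-- A rational function in `poleAlg P` is regular outside `P`. -/
theorem laurentAt_coeff_of_notMem {P : Set ℂ} {f : RatFunc ℂ} (hf : f ∈ poleAlg P) {q : ℂ}
    (hq : q ∉ P) (j : ℤ) (hj : j < 0) : (laurentAt q f).coeff j = 0 := by
  refine poleAlg_induction (p := fun f => (laurentAt q f).coeff j = 0) ?_ ?_ ?_ ?_ hf
  · simp
  · intro f g hf hg
    rw [map_add, HahnSeries.coeff_add, hf, hg, add_zero]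
  · intro r f hf
    rw [laurentAt_smul, HahnSeries.coeff_smul, hf, smul_zero]
  · intro s hs n
    obtain ⟨C, hC⟩ := exists_coeff_polePow
    exact (hC n s q (fun h => hq (h ▸ hs))).2 j hj

theorem scaleRat_algebraMap (s : ℂˣ) (p : Polynomial ℂ) : scaleRat s (algebraMap _ (RatFunc ℂ) p) =
    algebraMap _ (RatFunc ℂ) (scalePoly (s : ℂ) p) := by
  have := scaleRat_div s p 1
  simpa using this

theorem scaleRat_polePow (s : ℂˣ) (p : ℂ) (n : ℕ) : scaleRat s (polePow p n) =
    (((s⁻¹ : ℂˣ) : ℂ) ^ (n + 1)) • polePow (((s⁻¹ : ℂˣ) : ℂ) * p) n := by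
  rw [polePow, polePow, map_inv₀, map_pow, scaleRat_algebraMap]
  have : scalePoly (s : ℂ) (Polynomial.X - Polynomial.C p) =
      Polynomial.C (s : ℂ) * (Polynomial.X - Polynomial.C (((s⁻¹ : ℂˣ) : ℂ) * p)) := by
    rw [mul_sub, ← Polynomial.C_mul, Units.mul_inv_cancel_left]
    simp [scalePoly]
  rw [this, map_mul, mul_pow, mul_inv, RatFunc.algebraMap_C, RatFunc.smul_eq_C_mul, map_pow,
    Units.val_inv_eq_inv_val, map_inv₀, inv_pow]

theorem scaleRat_scaleRat (s s' : ℂˣ) (f : RatFunc ℂ) :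
    scaleRat s (scaleRat s' f) = scaleRat (s * s') f := by
  obtain ⟨p, q, hq, rfl⟩ := ratFunc_exists f
  have h : ∀ p : Polynomial ℂ, scalePoly (s : ℂ) (scalePoly (s' : ℂ) p) =
      scalePoly ((s * s' : ℂˣ) : ℂ) p := by
    intro p
    have : (scalePoly (s : ℂ)).comp (scalePoly (s' : ℂ)) = scalePoly ((s * s' : ℂˣ) : ℂ) := by
      ext1
      simp only [scalePoly, AlgHom.comp_apply, Polynomial.aeval_X, map_mul, Units.val_mul]
      rw [← Polynomial.algebraMap_eq, AlgHom.commutes]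
      ring
    exact DFunLike.congr_fun this p
  rw [scaleRat_div, scaleRat_div, scaleRat_div, h, h]

theorem scaleRat_one (f : RatFunc ℂ) : scaleRat 1 f = f := by
  obtain ⟨p, q, hq, rfl⟩ := ratFunc_exists f
  have h : ∀ p : Polynomial ℂ, scalePoly ((1 : ℂˣ) : ℂ) p = p := by
    intro p
    rw [scalePoly, Units.val_one, Polynomial.C_1, one_mul, Polynomial.aeval_X_left_apply]
  rw [scaleRat_div, h, h]

/-! ### Principal parts of Laurent series. -/

section Principal

theorem laurent_coeff_eventually (f : LaurentSeries ℂ) :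
    ∃ N : ℕ, ∀ n : ℤ, n < -(N : ℤ) → f.coeff n = 0 := by
  refine ⟨f.order.natAbs, fun n hn => HahnSeries.coeff_eq_zero_of_lt_order (by omega)⟩

theorem prin_support (u : ℂ) (f : LaurentSeries ℂ) :
    ∃ N : ℕ, ∀ n : ℕ, N ≤ n → f.coeff (-((n : ℤ) + 1)) • polePow u n = 0 := by
  obtain ⟨N, hN⟩ := laurent_coeff_eventually f
  exact ⟨N, fun n hn => by rw [hN _ (by omega), zero_smul]⟩

theorem prin_support_finite (u : ℂ) (f : LaurentSeries ℂ) :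
    (Function.support fun n : ℕ => f.coeff (-((n : ℤ) + 1)) • polePow u n).Finite := by
  obtain ⟨N, hN⟩ := prin_support u f
  refine (Finset.range N).finite_toSet.subset fun n hn => ?_
  simp only [Finset.coe_range, Set.mem_Iio]
  by_contra hc
  exact hn (hN n (not_lt.1 hc))

/-- The principal part of a Laurent series, as a rational function with a pole at `u`. -/
def prin (u : ℂ) : LaurentSeries ℂ →ₗ[ℂ] RatFunc ℂ where
  toFun f := ∑ᶠ n : ℕ, f.coeff (-((n : ℤ) + 1)) • polePow u n
  map_add' f g := by
    simp only [HahnSeries.coeff_add, add_smul]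
    exact finsum_add_distrib (prin_support_finite u f) (prin_support_finite u g)
  map_smul' r f := by
    simp only [HahnSeries.coeff_smul, smul_assoc, RingHom.id_apply]
    exact (smul_finsum' r (prin_support_finite u f)).symm

theorem prin_eq_sum (u : ℂ) (f : LaurentSeries ℂ) (N : ℕ)
    (h : ∀ n : ℕ, N ≤ n → f.coeff (-((n : ℤ) + 1)) = 0) :
    prin u f = ∑ n ∈ Finset.range N, f.coeff (-((n : ℤ) + 1)) • polePow u n :=
  finsum_eq_sum_range _ N fun n hn => by rw [h n hn, zero_smul]

theorem prin_eq_zero (u : ℂ) (f : LaurentSeries ℂ) (h : ∀ n : ℤ, n < 0 → f.coeff n = 0) :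
    prin u f = 0 := by
  rw [prin_eq_sum u f 0 fun n _ => h _ (by omega), Finset.sum_range_zero]

theorem prin_single (u : ℂ) (n : ℕ) :
    prin u (HahnSeries.single (-((n : ℤ) + 1)) (1 : ℂ)) = polePow u n := by
  rw [prin_eq_sum u _ (n + 1) fun m hm => HahnSeries.coeff_single_of_ne (by omega),
    Finset.sum_eq_single n]
  · rw [HahnSeries.coeff_single_same, one_smul]
  · intro m _ hm
    rw [HahnSeries.coeff_single_of_ne (by omega), zero_smul]
  · intro h; simp at h

theorem prin_mem (u : ℂ) (f : LaurentSeries ℂ) : prin u f ∈ poleAlg {u} := by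
  obtain ⟨N, hN⟩ := laurent_coeff_eventually f
  rw [prin_eq_sum u f N fun n hn => hN _ (by omega)]
  exact sum_mem fun n _ => SMulMemClass.smul_mem _ (polePow_mem {u} u (Set.mem_singleton u) n)

theorem laurentAt_prin_coeff (u : ℂ) (f : LaurentSeries ℂ) (j : ℤ) (hj : j < 0) :
    (laurentAt u (prin u f)).coeff j = f.coeff j := by
  obtain ⟨N, hN⟩ := laurent_coeff_eventually f
  rw [prin_eq_sum u f N fun n hn => hN _ (by omega), map_sum, HahnSeries.coeff_sum]
  obtain ⟨k, rfl⟩ : ∃ k : ℕ, j = -((k : ℤ) + 1) := ⟨(-j - 1).toNat, by omega⟩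
  simp only [laurentAt_smul, laurentAt_polePow_self, HahnSeries.coeff_smul]
  by_cases hk : k < N
  · rw [Finset.sum_eq_single k]
    · rw [HahnSeries.coeff_single_same, smul_eq_mul, mul_one]
    · intro m _ hm
      rw [HahnSeries.coeff_single_of_ne (by omega), smul_zero]
    · intro h; simp at h; omega
  · rw [hN _ (by omega)]
    refine Finset.sum_eq_zero fun m hm => ?_
    rw [Finset.mem_range] at hm
    rw [HahnSeries.coeff_single_of_ne (by omega), smul_zero]

/-- A derivative of a Laurent series has no term `t^{-1}`, so the regular part of `f` does not
contribute and the sum for `δ f` is a shift of the sum for `f`. This lets principal parts descend to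
`Lie_A 𝓛`. -/
theorem prin_delta (u : ℂ) (f : LaurentSeries ℂ) : prin u (δ f) = δ (prin u f) := by
  obtain ⟨N, hN⟩ := laurent_coeff_eventually f
  rw [prin_eq_sum u f N fun n hn => hN _ (by omega), prin_eq_sum u (δ f) (N + 1) fun n hn => by
    rw [delta_laurent_coeff, hN _ (by omega), mul_zero], Finset.sum_range_succ', map_sum,
    delta_laurent_coeff]
  simp only [Nat.cast_zero, zero_add, Int.reduceNeg, neg_add_cancel, Int.cast_neg, Int.cast_one,
    zero_mul, zero_smul, add_zero]
  refine Finset.sum_congr rfl fun n _ => ?_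
  rw [map_smul, delta_polePow, smul_smul, delta_laurent_coeff]
  congr 1
  push_cast
  rw [show (-((n : ℤ) + 1 + 1) + 1) = -((n : ℤ) + 1) by ring]
  ring

end Principal

/-! ### The residue theorem for functions vanishing at infinity. -/

section Residue

/-- The rational functions that vanish at infinity to order at least two. -/
def doubleZeroAtInfty : Submodule ℂ (RatFunc ℂ) where
  carrier := {f | f = 0 ∨ f.intDegree < -1}
  zero_mem' := Or.inl rfl
  add_mem' {f g} hf hg := by
    rcases hf with rfl | hf
    · rwa [zero_add]
    rcases hg with rfl | hg
    · rw [add_zero]; exact Or.inr hf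
    by_cases h : f + g = 0
    · exact Or.inl h
    by_cases hg0 : g = 0
    · rw [hg0, add_zero]; exact Or.inr hf
    exact Or.inr (lt_of_le_of_lt (RatFunc.intDegree_add_le hg0 h) (max_lt hf hg))
  smul_mem' r f hf := by
    by_cases hr : r = 0
    · left; rw [hr, zero_smul]
    by_cases hf0 : f = 0
    · left; rw [hf0, smul_zero]
    right
    have hC : RatFunc.C r ≠ 0 := by simpa using hr
    rw [RatFunc.smul_eq_C_mul, RatFunc.intDegree_mul hC hf0, RatFunc.intDegree_C, zero_add]
    exact hf.resolve_left hf0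

theorem polePow_ne_zero (p : ℂ) (n : ℕ) : polePow p n ≠ 0 :=
  inv_ne_zero (pow_ne_zero _ (RatFunc.algebraMap_ne_zero (Polynomial.X_sub_C_ne_zero p)))

theorem intDegree_polePow (p : ℂ) (n : ℕ) : (polePow p n).intDegree = -((n : ℤ) + 1) := by
  rw [polePow, RatFunc.intDegree_inv, ← map_pow, RatFunc.intDegree_polynomial,
    Polynomial.natDegree_pow, Polynomial.natDegree_X_sub_C]
  push_cast
  ring

theorem polePow_zero_mul (p q : ℂ) : polePow p 0 - polePow q 0 = (p - q) • (polePow p 0 * polePow q 0) := by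
  have h1 := RatFunc.algebraMap_ne_zero (Polynomial.X_sub_C_ne_zero p)
  have h2 := RatFunc.algebraMap_ne_zero (Polynomial.X_sub_C_ne_zero q)
  rw [polePow, polePow, RatFunc.smul_eq_C_mul, ← RatFunc.algebraMap_C, zero_add, pow_one, pow_one]
  have : Polynomial.C (p - q) = (Polynomial.X - Polynomial.C q) - (Polynomial.X - Polynomial.C p) := by
    rw [Polynomial.C_sub]; ring
  rw [this]
  generalize Polynomial.X - Polynomial.C p = a at *
  generalize Polynomial.X - Polynomial.C q = b at *
  rw [map_sub]
  field_simp

theorem mul_mem_doubleZero {f g : RatFunc ℂ} (hf : VanishesAtInfty f) (hg : VanishesAtInfty g) :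
    f * g ∈ doubleZeroAtInfty := by
  by_cases hf0 : f = 0
  · left; rw [hf0, zero_mul]
  by_cases hg0 : g = 0
  · left; rw [hg0, mul_zero]
  right
  rw [RatFunc.intDegree_mul hf0 hg0]
  have := hf.resolve_left hf0
  have := hg.resolve_left hg0
  omega

variable {J : Type*} [Fintype J] (q : J → ℂ) (hq : Function.Injective q)

include hq in
-- The coefficient of `1/t` at infinity is the sum of the residues. By partial fractions it suffices
-- to treat one pole: `1/(t - p) - 1/t` and all higher powers of `1/(t - p)` vanish doubly at
-- infinity.
theorem sub_residues_mem {f : RatFunc ℂ} (hf : f ∈ poleAlg (Set.range q)) :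
    f - (∑ j, (laurentAt (q j) f).coeff (-1)) • polePow 0 0 ∈ doubleZeroAtInfty := by
  refine poleAlg_induction (p := fun f => f - (∑ j, (laurentAt (q j) f).coeff (-1)) • polePow 0 0 ∈
    doubleZeroAtInfty) ?_ ?_ ?_ ?_ hf
  · simp
  · intro f g hf hg
    simp only [map_add, HahnSeries.coeff_add, Finset.sum_add_distrib, add_smul]
    convert Submodule.add_mem _ hf hg using 1
    abel
  · intro r f hf
    simp only [laurentAt_smul, HahnSeries.coeff_smul, ← Finset.smul_sum, smul_assoc, ← smul_sub]
    exact Submodule.smul_mem _ r hf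
  · intro s hs n
    obtain ⟨j, rfl⟩ := hs
    obtain ⟨C, hC⟩ := exists_coeff_polePow
    classical
    rw [Finset.sum_eq_single j (fun i _ hi => (hC n (q j) (q i) (fun h => hi (hq h).symm)).2 _
      (by omega)) (by simp), laurentAt_polePow_self]
    cases n with
    | zero =>
      rw [Nat.cast_zero, zero_add, HahnSeries.coeff_single_same, one_smul, polePow_zero_mul]
      exact Submodule.smul_mem _ _ (mul_mem_doubleZero (polePow_mem Set.univ _ trivial 0).2
        (polePow_mem Set.univ _ trivial 0).2)
    | succ n =>
      rw [HahnSeries.coeff_single_of_ne (by push_cast; omega), zero_smul, sub_zero]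
      right
      rw [intDegree_polePow]
      push_cast
      omega

include hq in
/-- The residue theorem for products of functions vanishing at infinity. -/
theorem sum_residues_mul {f g : RatFunc ℂ} (hf : f ∈ poleAlg (Set.range q))
    (hg : g ∈ poleAlg (Set.range q)) : ∑ j, (laurentAt (q j) (f * g)).coeff (-1) = 0 := by
  have h1 := sub_residues_mem q hq (mul_mem hf hg)
  have h2 := mul_mem_doubleZero hf.2 hg.2
  -- A product of two functions vanishing at infinity vanishes there doubly, so the multiple of
  -- `1/t` left over must be zero.
  have h3 := Submodule.sub_mem _ h2 h1
  rw [sub_sub_cancel] at h3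
  by_contra hc
  have h4 := Submodule.smul_mem _ (∑ j, (laurentAt (q j) (f * g)).coeff (-1))⁻¹ h3
  rw [smul_smul, inv_mul_cancel₀ hc, one_smul] at h4
  rcases h4 with h | h
  · exact polePow_ne_zero 0 0 h
  · rw [intDegree_polePow] at h
    simp at h

end Residue

/-! ### Orders of Laurent series under differentiation and multiplication. -/

section Truncation

theorem delta_pow_coeff_eq_zero (f : LaurentSeries ℂ) (N : ℤ) (hf : ∀ n, n < N → f.coeff n = 0)
    (k : ℕ) (n : ℤ) (hn : n < N - k) : (((δ : LaurentSeries ℂ →ₗ[ℂ] _) ^ k) f).coeff n = 0 := by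
  induction k generalizing n with
  | zero => exact hf n (by simpa using hn)
  | succ k ih =>
    rw [pow_succ', Module.End.mul_apply, delta_laurent_coeff, ih _ (by push_cast at hn; omega),
      mul_zero]

theorem mul_coeff_eq_zero (f g : LaurentSeries ℂ) (N M : ℤ) (hf : ∀ n, n < N → f.coeff n = 0)
    (hg : ∀ n, n < M → g.coeff n = 0) (n : ℤ) (hn : n < N + M) : (f * g).coeff n = 0 := by
  rw [HahnSeries.coeff_mul]
  refine Finset.sum_eq_zero fun p hp => ?_
  rw [Finset.mem_antidiagonal] at hp
  by_cases h : p.1 < N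
  · rw [hf _ h, zero_mul]
  · rw [hg p.2 (by omega), mul_zero]

/-- The antiderivative of a Laurent series without residue. -/
theorem exists_antiderivative (f : LaurentSeries ℂ) (h : f.coeff (-1) = 0) :
    ∃ g : LaurentSeries ℂ, (δ g : LaurentSeries ℂ) = f := by
  obtain ⟨N, hN⟩ := laurent_coeff_eventually f
  refine ⟨HahnSeries.ofSuppBddBelow (fun n : ℤ => f.coeff (n - 1) / n) ⟨-(N : ℤ), fun n hn => ?_⟩, ?_⟩
  · by_contra hc
    exact hn (by change f.coeff (n - 1) / n = 0; rw [hN _ (by omega), zero_div])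
  · ext n
    rw [delta_laurent_coeff]
    change ((n : ℂ) + 1) * (f.coeff (n + 1 - 1) / ((n + 1 : ℤ) : ℂ)) = f.coeff n
    rw [add_sub_cancel_right]
    -- The constant term of the antiderivative is a division by zero; it is multiplied by `0`, and
    -- the coefficient it should match vanishes by hypothesis.
    by_cases hn : n = -1
    · subst hn; rw [h]; simp
    · have : ((n : ℂ) + 1) ≠ 0 := by
        intro h'
        apply hn
        have : ((n + 1 : ℤ) : ℂ) = 0 := by push_cast; exact h'
        have := Int.cast_eq_zero.1 this
        omega
      push_cast
      field_simp

end Truncation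

end Rational

/-! ### The grading, the complement `𝓛ᵒ`, and the coordinate along `c`. -/

section Grading

variable {V : Type*} [AddCommGroup V] [Module ℂ V] [VertexLieAlgebra V]

variable (V) in
/-- The projection to the homogeneous component of degree `n`. -/
def grProj (n : ℕ) : V →ₗ[ℂ] V :=
  (VertexLieAlgebra.gr (V := V) n).subtype ∘ₗ
    DirectSum.component ℂ ℕ (fun n => VertexLieAlgebra.gr (V := V) n) n ∘ₗ
    (LinearEquiv.ofBijective (DirectSum.coeLinearMap (VertexLieAlgebra.gr (V := V)))
      (VertexLieAlgebra.isInternal_gr (V := V))).symm.toLinearMap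

theorem grProj_of_mem (m n : ℕ) (a : V) (ha : a ∈ VertexLieAlgebra.gr (V := V) m) :
    grProj V n a = if m = n then a else 0 := by
  have h : (LinearEquiv.ofBijective (DirectSum.coeLinearMap (VertexLieAlgebra.gr (V := V)))
      (VertexLieAlgebra.isInternal_gr (V := V))).symm a =
      DirectSum.lof ℂ ℕ (fun n => VertexLieAlgebra.gr (V := V) n) m ⟨a, ha⟩ := by
    rw [LinearEquiv.symm_apply_eq]
    exact (DirectSum.coeLinearMap_lof (VertexLieAlgebra.gr (V := V)) m ⟨a, ha⟩).symm
  simp only [grProj, LinearMap.comp_apply, LinearEquiv.coe_coe, h]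
  split_ifs with hmn
  · subst hmn
    rw [DirectSum.component.lof_self]
    rfl
  · rw [DirectSum.component.of, dif_neg hmn, map_zero]

theorem gr_le_eq_top (W : Submodule ℂ V) (h : ∀ n, VertexLieAlgebra.gr (V := V) n ≤ W) : W = ⊤ := by
  rw [eq_top_iff, ← (VertexLieAlgebra.isInternal_gr (V := V)).submodule_iSup_eq_top]
  exact iSup_le h

theorem grProj_mem (n : ℕ) (a : V) : grProj V n a ∈ VertexLieAlgebra.gr (V := V) n :=
  Subtype.mem _

theorem grProj_succ_D (n : ℕ) (a : V) : grProj V (n + 1) (D a) = D (grProj V n a) := by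
  have : grProj V (n + 1) ∘ₗ D = D ∘ₗ grProj V n := by
    apply hom_ext_gr
    intro m a ha
    rw [LinearMap.comp_apply, LinearMap.comp_apply,
      grProj_of_mem _ _ _ (VertexLieAlgebra.D_mem_gr m a ha), grProj_of_mem _ _ _ ha]
    split_ifs with h1 h2 h2
    · rfl
    · omega
    · omega
    · rw [map_zero]
  exact LinearMap.congr_fun this a

theorem grProj_zero_D (a : V) : grProj V 0 (D a) = 0 := by
  have : grProj V 0 ∘ₗ D = 0 := by
    apply hom_ext_gr
    intro m a ha
    rw [LinearMap.comp_apply, grProj_of_mem _ _ _ (VertexLieAlgebra.D_mem_gr m a ha),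
      if_neg (by omega), LinearMap.zero_apply]
  exact LinearMap.congr_fun this a

variable {Lo : Submodule ℂ V} (hLo : IsGradedComplement Lo)

include hLo

theorem grProj_Lo (n : ℕ) (a : V) (ha : a ∈ Lo) : grProj V n a ∈ Lo := by
  have h : (⨆ m : ℕ, Lo ⊓ VertexLieAlgebra.gr m) ≤ Lo.comap (grProj V n) := by
    refine iSup_le fun m b hb => ?_
    rw [Submodule.mem_comap, grProj_of_mem _ _ _ hb.2]
    split_ifs
    · exact hb.1
    · exact Lo.zero_mem
  exact h (hLo.isHomogeneous ha)

theorem scaleDeg_Lo (s : ℂ) (a : V) (ha : a ∈ Lo) : scaleDeg V s a ∈ Lo := by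
  have h : (⨆ m : ℕ, Lo ⊓ VertexLieAlgebra.gr m) ≤ Lo.comap (scaleDeg V s) := by
    refine iSup_le fun m b hb => ?_
    rw [Submodule.mem_comap, scaleDeg_of_mem _ _ _ hb.2]
    exact Lo.smul_mem _ hb.1
  exact h (hLo.isHomogeneous ha)

theorem exists_decomp (a : V) : ∃ a₀ ∈ Lo, ∃ (r : ℂ) (b : V),
    a = a₀ + r • VertexLieAlgebra.c + D b := by
  have h := hLo.isInternal.submodule_iSup_eq_top
  have ha : a ∈ (⊤ : Submodule ℂ V) := trivial
  have hle : (⊤ : Submodule ℂ V) ≤ Lo ⊔ Submodule.span ℂ {(VertexLieAlgebra.c : V)} ⊔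
      LinearMap.range (D : V →ₗ[ℂ] V) := by
    rw [← h]
    refine iSup_le fun i => ?_
    fin_cases i
    · exact le_sup_left.trans le_sup_left
    · exact le_sup_right.trans le_sup_left
    · exact le_sup_right
  obtain ⟨x, hx, y, ⟨b, rfl⟩, hxy⟩ := Submodule.mem_sup.1 (hle ha)
  obtain ⟨a₀, ha₀, w, hw, rfl⟩ := Submodule.mem_sup.1 hx
  obtain ⟨r, rfl⟩ := Submodule.mem_span_singleton.1 hw
  exact ⟨a₀, ha₀, r, b, hxy.symm⟩

/-- `𝓛` is generated by `𝓛ᵒ` and `c` as a module over `ℂ[D]`. -/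
theorem eq_top_of_D_stable (W : Submodule ℂ V) (h1 : Lo ≤ W) (h2 : VertexLieAlgebra.c ∈ W)
    (h3 : ∀ w ∈ W, D w ∈ W) : W = ⊤ := by
  apply gr_le_eq_top
  intro n
  -- Induction on the degree: `D` raises degrees by one, so the component of `D b` in degree `n + 1`
  -- is `D` of an element of degree `n`, and in degree `0` it vanishes.
  induction n with
  | zero =>
    intro a ha
    obtain ⟨a₀, ha₀, r, b, hab⟩ := exists_decomp hLo a
    have h := congrArg (grProj V 0) hab
    rw [grProj_of_mem _ _ _ ha, if_pos rfl, map_add, map_add, grProj_zero_D, map_smul,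
      grProj_of_mem _ _ _ VertexLieAlgebra.c_mem_gr, if_pos rfl, add_zero] at h
    rw [h]
    exact W.add_mem (h1 (grProj_Lo hLo 0 a₀ ha₀)) (W.smul_mem _ h2)
  | succ n ih =>
    intro a ha
    obtain ⟨a₀, ha₀, r, b, hab⟩ := exists_decomp hLo a
    have h := congrArg (grProj V (n + 1)) hab
    rw [grProj_of_mem _ _ _ ha, if_pos rfl, map_add, map_add, grProj_succ_D, map_smul,
      grProj_of_mem _ _ _ VertexLieAlgebra.c_mem_gr, if_neg (by omega), smul_zero, add_zero] at h
    rw [h]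
    exact W.add_mem (h1 (grProj_Lo hLo _ a₀ ha₀)) (h3 _ (ih (grProj_mem n b)))

/-- Directness of the sum keeps `c` out of `𝓛ᵒ + Im D`. The functional measures the component along
`c` and defines the correction of the actions. -/
theorem exists_kappa : ∃ κ : V →ₗ[ℂ] ℂ, (∀ a ∈ Lo, κ a = 0) ∧ (∀ a, κ (D a) = 0) ∧
    κ VertexLieAlgebra.c = 1 := by
  have hind := hLo.isInternal.submodule_iSupIndep
  have hnot : (VertexLieAlgebra.c : V) ∉ Lo ⊔ LinearMap.range (D : V →ₗ[ℂ] V) := by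
    intro hc
    have hdis := hind 1
    have hle : Lo ⊔ LinearMap.range (D : V →ₗ[ℂ] V) ≤
        ⨆ j, ⨆ (_ : j ≠ (1 : Fin 3)), (![Lo, Submodule.span ℂ {(VertexLieAlgebra.c : V)},
          LinearMap.range (D : V →ₗ[ℂ] V)]) j := by
      refine sup_le ?_ ?_
      · exact le_iSup₂_of_le (0 : Fin 3) (by decide) le_rfl
      · exact le_iSup₂_of_le (2 : Fin 3) (by decide) le_rfl
    have h0 := (Submodule.disjoint_def.1 hdis) VertexLieAlgebra.c
      (Submodule.mem_span_singleton_self _) (hle hc)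
    apply VertexLieAlgebra.c_notMem_range (V := V)
    rw [h0]
    exact Submodule.zero_mem _
  obtain ⟨f, hf, hle⟩ := Submodule.exists_le_ker_of_notMem hnot
  refine ⟨(f VertexLieAlgebra.c)⁻¹ • f, fun a ha => ?_, fun a => ?_, ?_⟩
  · have : f a = 0 := hle (Submodule.mem_sup_left ha)
    rw [LinearMap.smul_apply, this, smul_zero]
  · have : f (D a) = 0 := hle (Submodule.mem_sup_right ⟨a, rfl⟩)
    rw [LinearMap.smul_apply, this, smul_zero]
  · rw [LinearMap.smul_apply, smul_eq_mul, inv_mul_cancel₀ hf]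

end Grading

/-! ### The operators `R_α` and their compatibility with the products. -/

section Rotation

variable {V : Type*} [AddCommGroup V] [Module ℂ V] [VertexLieAlgebra V]

theorem VLAut.pow_prod (σ : VLAut V) (k n : ℕ) (a b : V) :
    (σ.lin ^ k) (prod n a b) = prod n ((σ.lin ^ k) a) ((σ.lin ^ k) b) := by
  induction k generalizing a b with
  | zero => rfl
  | succ k ih =>
    rw [pow_succ, Module.End.mul_apply, Module.End.mul_apply, Module.End.mul_apply, ← ih]
    exact congrArg _ (σ.map_prod n a b)

theorem VLAut.pow_c (σ : VLAut V) (k : ℕ) :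
    (σ.lin ^ k) VertexLieAlgebra.c = VertexLieAlgebra.c := by
  induction k with
  | zero => rfl
  | succ k ih =>
    rw [pow_succ, Module.End.mul_apply]
    exact (congrArg _ σ.map_c).trans ih

/-- The product lowers the total degree by `n + 1`. When the total degree is smaller than that, both
sides vanish. -/
theorem scaleDeg_prod (s : ℂ) (n : ℕ) (a b : V) :
    s ^ (n + 1) • scaleDeg V s (prod n a b) = prod n (scaleDeg V s a) (scaleDeg V s b) := by
  have h1 : s ^ (n + 1) • (prod n).compr₂ (scaleDeg V s) =
      (prod n).compl₁₂ (scaleDeg V s) (scaleDeg V s) := by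
    apply hom_ext_gr
    intro p a ha
    apply hom_ext_gr
    intro q b hb
    simp only [LinearMap.smul_apply, LinearMap.compr₂_apply, LinearMap.compl₁₂_apply]
    rw [scaleDeg_of_mem _ _ _ ha, scaleDeg_of_mem _ _ _ hb, map_smul, map_smul,
      LinearMap.smul_apply, smul_smul]
    by_cases h : p + q < n + 1
    · rw [VertexLieAlgebra.prod_eq_zero_of_gr p q n a b ha hb h, map_zero, smul_zero, smul_zero]
    · have hr : (p + q - (n + 1)) + n + 1 = p + q := by omega
      rw [scaleDeg_of_mem _ _ _ (VertexLieAlgebra.prod_mem_gr p q _ n a b ha hb hr), smul_smul,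
        ← pow_add, ← pow_add]
      congr 2
      omega
  exact LinearMap.congr_fun (LinearMap.congr_fun h1 a) b

theorem Rop_prod (ω : ℂˣ) (σ : VLAut V) (k n : ℕ) (a b : V) :
    (((ω ^ k : ℂˣ) : ℂ)) ^ (n + 1) • Rop ω σ k (prod n a b) =
      prod n (Rop ω σ k a) (Rop ω σ k b) := by
  simp only [Rop, LinearMap.comp_apply]
  rw [VLAut.pow_prod, scaleDeg_prod]

theorem scaleDeg_pow_comm (s : ℂ) (σ : VLAut V) (k : ℕ) (a : V) :
    scaleDeg V s ((σ.lin ^ k) a) = (σ.lin ^ k) (scaleDeg V s a) := by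
  have : scaleDeg V s ∘ₗ (σ.lin ^ k) = (σ.lin ^ k) ∘ₗ scaleDeg V s := by
    apply hom_ext_gr
    intro n a ha
    rw [LinearMap.comp_apply, LinearMap.comp_apply, scaleDeg_of_mem _ _ _ ha,
      scaleDeg_of_mem _ _ _ (σ.pow_gr k n a ha), map_smul]
  exact LinearMap.congr_fun this a

theorem scaleDeg_scaleDeg (s s' : ℂ) (a : V) :
    scaleDeg V s (scaleDeg V s' a) = scaleDeg V (s * s') a := by
  have : scaleDeg V s ∘ₗ scaleDeg V s' = scaleDeg V (s * s') := by
    apply hom_ext_gr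
    intro n a ha
    rw [LinearMap.comp_apply, scaleDeg_of_mem s' _ _ ha, map_smul, scaleDeg_of_mem _ _ _ ha,
      scaleDeg_of_mem _ _ _ ha, smul_smul, mul_pow, mul_comm]
  exact LinearMap.congr_fun this a

theorem scaleDeg_one (a : V) : scaleDeg V 1 a = a := by
  have : scaleDeg V 1 = LinearMap.id := by
    apply hom_ext_gr
    intro n a ha
    rw [scaleDeg_of_mem _ _ _ ha, one_pow, one_smul, LinearMap.id_apply]
  exact LinearMap.congr_fun this a

theorem Rop_Rop (ω : ℂˣ) (σ : VLAut V) (j k : ℕ) (a : V) :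
    Rop ω σ j (Rop ω σ k a) = Rop ω σ (j + k) a := by
  simp only [Rop, LinearMap.comp_apply]
  rw [← scaleDeg_pow_comm, scaleDeg_scaleDeg, pow_add σ.lin, pow_add ω, Units.val_mul,
    Module.End.mul_apply]

theorem Rop_of_pow_eq_one (ω : ℂˣ) (σ : VLAut V) (k : ℕ) (h1 : ω ^ k = 1) (h2 : σ.lin ^ k = 1)
    (a : V) : Rop ω σ k a = a := by
  simp only [Rop, LinearMap.comp_apply]
  rw [h1, h2, Units.val_one, Module.End.one_apply, scaleDeg_one]

theorem Rop_c (ω : ℂˣ) (σ : VLAut V) (k : ℕ) :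
    Rop ω σ k (VertexLieAlgebra.c : V) = VertexLieAlgebra.c := by
  rw [Rop, LinearMap.comp_apply, VLAut.pow_c, scaleDeg_of_mem _ _ _ VertexLieAlgebra.c_mem_gr,
    pow_zero, one_smul]

theorem scaleDeg_range_D (s : ℂ) (a : V) :
    scaleDeg V s (D a) ∈ LinearMap.range (D : V →ₗ[ℂ] V) := by
  have : scaleDeg V s ∘ₗ D = s • (D ∘ₗ scaleDeg V s) := by
    apply hom_ext_gr
    intro n a ha
    rw [LinearMap.comp_apply, scaleDeg_of_mem _ _ _ (VertexLieAlgebra.D_mem_gr n a ha),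
      LinearMap.smul_apply, LinearMap.comp_apply, scaleDeg_of_mem _ _ _ ha, map_smul, smul_smul,
      pow_succ']
  have h := LinearMap.congr_fun this a
  rw [LinearMap.comp_apply] at h
  rw [h]
  exact ⟨s • scaleDeg V s a, by rw [map_smul]; rfl⟩

variable {Lo : Submodule ℂ V} (hLo : IsGradedComplement Lo) (σ : VLAut V)
  (hLoσ : ∀ a ∈ Lo, σ.lin a ∈ Lo ⊔ LinearMap.range (D : V →ₗ[ℂ] V))

include hLo hLoσ

theorem Rop_Lo (ω : ℂˣ) (k : ℕ) (a : V) (ha : a ∈ Lo) :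
    Rop ω σ k a ∈ Lo ⊔ LinearMap.range (D : V →ₗ[ℂ] V) := by
  have h1 : ∀ a ∈ Lo ⊔ LinearMap.range (D : V →ₗ[ℂ] V),
      σ.lin a ∈ Lo ⊔ LinearMap.range (D : V →ₗ[ℂ] V) := by
    intro a ha
    obtain ⟨x, hx, _, ⟨y, rfl⟩, rfl⟩ := Submodule.mem_sup.1 ha
    rw [map_add]
    refine Submodule.add_mem _ (hLoσ x hx) (Submodule.mem_sup_right ⟨σ.lin y, ?_⟩)
    exact (σ.map_D y).symm
  have h2 : (σ.lin ^ k) a ∈ Lo ⊔ LinearMap.range (D : V →ₗ[ℂ] V) := by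
    induction k with
    | zero => exact Submodule.mem_sup_left ha
    | succ k ih => rw [pow_succ', Module.End.mul_apply]; exact h1 _ ih
  obtain ⟨x, hx, _, ⟨y, rfl⟩, hxy⟩ := Submodule.mem_sup.1 h2
  rw [Rop, LinearMap.comp_apply, ← hxy, map_add]
  exact Submodule.add_mem _ (Submodule.mem_sup_left (scaleDeg_Lo hLo _ x hx))
    (Submodule.mem_sup_right (scaleDeg_range_D _ y))

/-- `R_α` fixes `c` and maps `𝓛ᵒ` and `Im D` into `𝓛ᵒ + Im D`, on which `κ` vanishes. -/
theorem kappa_Rop (κ : V →ₗ[ℂ] ℂ) (h0 : ∀ a ∈ Lo, κ a = 0) (hD : ∀ a, κ (D a) = 0) (ω : ℂˣ) (k : ℕ)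
    (a : V) : κ (Rop ω σ k a) = κ a := by
  obtain ⟨a₀, ha₀, r, b, rfl⟩ := exists_decomp hLo a
  simp only [map_add, map_smul, D_Rop, Rop_c, hD, h0 a₀ ha₀, smul_zero, add_zero]
  obtain ⟨x, hx, _, ⟨y, rfl⟩, hxy⟩ := Submodule.mem_sup.1 (Rop_Lo hLo σ hLoσ ω k a₀ ha₀)
  rw [← hxy, map_add, h0 x hx, hD, add_zero]

end Rotation

/-! ### The ambient algebra `Lie_{ℂ(t)} 𝓛`, elements with prescribed poles, and the positive part of
`L(𝓛)`. -/

section Ambient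

variable (V : Type*) [AddCommGroup V] [Module ℂ V] [VertexLieAlgebra V]

/-- The Lie algebra `Lie_{ℂ(t)} 𝓛`, which contains all the global Lie algebras. -/
abbrev RatLie : Type _ := LieOf V (RatFunc ℂ)

/-- The data on which the cyclotomic Lie algebras depend: the group `Γ`, the automorphism `σ`, the
complement `𝓛ᵒ`, and the functional that vanishes on `𝓛ᵒ + Im D` and takes the value `1` at `c`. -/
structure CycloData where
  ω : ℂˣ
  T : ℕ
  T_pos : 0 < T
  prim : IsPrimitiveRoot ω T
  σ : VLAut V
  σ_pow : σ.lin ^ T = 1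
  Lo : Submodule ℂ V
  complement : IsGradedComplement Lo
  σ_Lo : ∀ a ∈ Lo, σ.lin a ∈ Lo ⊔ LinearMap.range (D : V →ₗ[ℂ] V)
  κ : V →ₗ[ℂ] ℂ
  κ_Lo : ∀ a ∈ Lo, κ a = 0
  κ_D : ∀ a, κ (D a) = 0
  κ_c : κ VertexLieAlgebra.c = 1

variable {V}

theorem laurentLin_delta (z : ℂ) (f : RatFunc ℂ) :
    laurentLin z (δ f) = (1 : ℂ) • δ (laurentLin z f) := by
  rw [one_smul]; exact laurentAt_ratDeriv z f

/-- The Laurent expansion at `z` of the coefficients. -/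
def expandRat (z : ℂ) : RatLie V →ₗ⁅ℂ⁆ LL V :=
  { LieOf.map LinearMap.id (laurentLin z) 1 (fun a => by simp) (laurentLin_delta z) with
    map_lie' := fun {x y} => LieOf.map_lie _ LinearMap.id (laurentLin z) 1
      (fun a f => LieOf.map_rho _ _ _ _ _ a f) (laurentLin_delta z)
      (fun f g => map_mul (laurentAt z) f g) (fun n a b => by simp) x y }

theorem expandRat_rho (z : ℂ) (a : V) (f : RatFunc ℂ) :
    expandRat z (rho (a ⊗ₜ[ℂ] f) : RatLie V) = rho (a ⊗ₜ[ℂ] laurentAt z f) :=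
  LieOf.map_rho LinearMap.id (laurentLin z) 1 (fun a => by simp) (laurentLin_delta z) a f

/-- The map induced by the inclusion of `poleAlg P` into the rational functions. -/
def toRat (P : Set ℂ) : LieOf V (poleAlg P) →ₗ[ℂ] RatLie V :=
  LieOf.map LinearMap.id (poleAlg P).subtype 1 (fun a => by simp) (fun f => by
    rw [one_smul]; rfl)

theorem toRat_rho (P : Set ℂ) (a : V) (f : poleAlg P) :
    toRat P (rho (a ⊗ₜ[ℂ] f)) = (rho (a ⊗ₜ[ℂ] (f : RatFunc ℂ)) : RatLie V) :=
  LieOf.map_rho _ _ _ _ _ a f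

theorem expandAt_eq (P : Set ℂ) (z : ℂ) (x : LieOf V (poleAlg P)) :
    expandAt V P z x = expandRat z (toRat P x) := by
  have : expandAt V P z = (expandRat z).toLinearMap ∘ₗ toRat P := by
    apply LieOf.hom_ext
    intro a f
    rw [LinearMap.comp_apply, toRat_rho]
    exact (expandRat_rho z a f).symm
  exact LinearMap.congr_fun this x

/-- The elements of `Lie_{ℂ(t)} 𝓛` with coefficients in `poleAlg P`. -/
def withPoles (V : Type*) [AddCommGroup V] [Module ℂ V] [VertexLieAlgebra V] (P : Set ℂ) :
    Submodule ℂ (RatLie V) :=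
  Submodule.span ℂ {x | ∃ (a : V) (f : RatFunc ℂ), f ∈ poleAlg P ∧ x = rho (a ⊗ₜ[ℂ] f)}

theorem rho_mem_withPoles {P : Set ℂ} (a : V) {f : RatFunc ℂ} (hf : f ∈ poleAlg P) :
    rho (a ⊗ₜ[ℂ] f) ∈ withPoles V P :=
  Submodule.subset_span ⟨a, f, hf, rfl⟩

/-- Partial fractions reduce any linear condition on elements with poles in `P` to the generators `a
⊗ (t - p)^{-(n+1)}`. -/
theorem withPoles_le {P : Set ℂ} {W : Submodule ℂ (RatLie V)}
    (h : ∀ (a : V), ∀ p ∈ P, ∀ n, rho (a ⊗ₜ[ℂ] polePow p n) ∈ W) : withPoles V P ≤ W := by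
  refine Submodule.span_le.2 ?_
  rintro _ ⟨a, f, hf, rfl⟩
  refine poleAlg_induction (p := fun f => (rho (a ⊗ₜ[ℂ] f) : RatLie V) ∈ W) ?_ ?_ ?_ (h a) hf
  · simp
  · intro f g hf hg
    rw [TensorProduct.tmul_add, map_add]
    exact W.add_mem hf hg
  · intro r f hf
    rw [TensorProduct.tmul_smul, map_smul]
    exact W.smul_mem r hf

theorem delta_pow_mem {P : Set ℂ} {f : RatFunc ℂ} (hf : f ∈ poleAlg P) (n : ℕ) :
    ((δ : RatFunc ℂ →ₗ[ℂ] RatFunc ℂ) ^ n) f ∈ poleAlg P := by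
  induction n with
  | zero => exact hf
  | succ n ih =>
    rw [pow_succ', Module.End.mul_apply]
    exact ⟨ih.1.ratDeriv, ih.2.ratDeriv⟩

theorem withPoles_lie {P : Set ℂ} {x y : RatLie V} (hx : x ∈ withPoles V P)
    (hy : y ∈ withPoles V P) : ⁅x, y⁆ ∈ withPoles V P := by
  induction hx using Submodule.span_induction with
  | zero => simp
  | add x x' _ _ hx hx' => rw [add_lie]; exact Submodule.add_mem _ hx hx'
  | smul r x _ hx => rw [smul_lie]; exact Submodule.smul_mem _ r hx
  | mem x hx =>
  obtain ⟨a, f, hf, rfl⟩ := hx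
  induction hy using Submodule.span_induction with
  | zero => simp
  | add x x' _ _ hx hx' => rw [lie_add]; exact Submodule.add_mem _ hx hx'
  | smul r x _ hx => rw [lie_smul]; exact Submodule.smul_mem _ r hx
  | mem y hy =>
  obtain ⟨b, g, hg, rfl⟩ := hy
  obtain ⟨N, hN⟩ := VertexLieAlgebra.locality a b
  rw [lie_rho_tmul a b f g N hN]
  exact Submodule.sum_mem _ fun n _ => Submodule.smul_mem _ _
    (rho_mem_withPoles _ (mul_mem (delta_pow_mem hf n) hg))

theorem poleAlg_mono {P Q : Set ℂ} (h : P ⊆ Q) {f : RatFunc ℂ} (hf : f ∈ poleAlg P) :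
    f ∈ poleAlg Q :=
  ⟨fun s hs => h (hf.1 s hs), hf.2⟩

theorem withPoles_mono {P Q : Set ℂ} (h : P ⊆ Q) : withPoles V P ≤ withPoles V Q :=
  Submodule.span_mono (by
    rintro _ ⟨a, f, hf, rfl⟩
    exact ⟨a, f, poleAlg_mono h hf, rfl⟩)

/-- The subalgebra of `L(𝓛)` of the elements with coefficients in `ℂ[[t]]`. -/
def positivePart (V : Type*) [AddCommGroup V] [Module ℂ V] [VertexLieAlgebra V] :
    Submodule ℂ (LL V) :=
  Submodule.span ℂ {x | ∃ (a : V) (f : LaurentSeries ℂ), (∀ n : ℤ, n < 0 → f.coeff n = 0) ∧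
    x = rho (a ⊗ₜ[ℂ] f)}

theorem rho_mem_positivePart (a : V) {f : LaurentSeries ℂ} (hf : ∀ n : ℤ, n < 0 → f.coeff n = 0) :
    (rho (a ⊗ₜ[ℂ] f) : LL V) ∈ positivePart V :=
  Submodule.subset_span ⟨a, f, hf, rfl⟩

theorem delta_coeff_nonneg {f : LaurentSeries ℂ} (hf : ∀ n : ℤ, n < 0 → f.coeff n = 0) (n : ℤ)
    (hn : n < 0) : (δ f : LaurentSeries ℂ).coeff n = 0 := by
  rw [delta_laurent_coeff]
  by_cases h : n = -1
  · subst h; simp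
  · rw [hf _ (by omega), mul_zero]

theorem delta_pow_coeff_nonneg {f : LaurentSeries ℂ} (hf : ∀ n : ℤ, n < 0 → f.coeff n = 0) (k : ℕ)
    (n : ℤ) (hn : n < 0) : (((δ : LaurentSeries ℂ →ₗ[ℂ] _) ^ k) f).coeff n = 0 := by
  induction k generalizing n with
  | zero => exact hf n hn
  | succ k ih => rw [pow_succ', Module.End.mul_apply]; exact delta_coeff_nonneg ih n hn

theorem positivePart_lie {x y : LL V} (hx : x ∈ positivePart V)
    (hy : y ∈ positivePart V) : ⁅x, y⁆ ∈ positivePart V := by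
  induction hx using Submodule.span_induction with
  | zero => simp
  | add x x' _ _ hx hx' => rw [add_lie]; exact Submodule.add_mem _ hx hx'
  | smul r x _ hx => rw [smul_lie]; exact Submodule.smul_mem _ r hx
  | mem x hx =>
  obtain ⟨a, f, hf, rfl⟩ := hx
  induction hy using Submodule.span_induction with
  | zero => simp
  | add x x' _ _ hx hx' => rw [lie_add]; exact Submodule.add_mem _ hx hx'
  | smul r x _ hx => rw [lie_smul]; exact Submodule.smul_mem _ r hx
  | mem y hy =>
  obtain ⟨b, g, hg, rfl⟩ := hy
  obtain ⟨N, hN⟩ := VertexLieAlgebra.locality a b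
  rw [lie_rho_tmul a b f g N hN]
  exact Submodule.sum_mem _ fun n _ => Submodule.smul_mem _ _ (rho_mem_positivePart _ fun k hk =>
    mul_coeff_eq_zero _ _ 0 0 (delta_pow_coeff_nonneg hf n) hg k (by simpa using hk))

theorem expandRat_mem_positivePart {P : Set ℂ} {q : ℂ} (hq : q ∉ P) {x : RatLie V}
    (hx : x ∈ withPoles V P) : expandRat q x ∈ positivePart V := by
  have : withPoles V P ≤ (positivePart V).comap (expandRat q).toLinearMap := by
    refine Submodule.span_le.2 ?_
    rintro _ ⟨a, f, hf, rfl⟩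
    change expandRat q (rho (a ⊗ₜ[ℂ] f)) ∈ positivePart V
    rw [expandRat_rho]
    exact rho_mem_positivePart a fun n hn => laurentAt_coeff_of_notMem hf hq n hn
  exact this hx

/-- As `D c = 0`, the elements `c ⊗ g'` vanish, and a Laurent series without residue is a
derivative. -/
theorem rho_c_laurent (f : LaurentSeries ℂ) :
    (rho (VertexLieAlgebra.c ⊗ₜ[ℂ] f) : LL V) = f.coeff (-1) • cMinusOne V := by
  have h0 : (f - HahnSeries.single (-1 : ℤ) (f.coeff (-1))).coeff (-1) = 0 := by
    rw [HahnSeries.coeff_sub, HahnSeries.coeff_single_same, sub_self]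
  obtain ⟨g, hg⟩ := exists_antiderivative _ h0
  have h1 : HahnSeries.single (-1 : ℤ) (f.coeff (-1)) =
      f.coeff (-1) • (HahnSeries.single (-1 : ℤ) (1 : ℂ) : LaurentSeries ℂ) := by
    ext n
    rw [HahnSeries.coeff_smul, HahnSeries.coeff_single, HahnSeries.coeff_single]
    split_ifs <;> simp
  have h := rho_c_delta (V := V) g
  rw [hg, TensorProduct.tmul_sub, map_sub, sub_eq_zero, h1, TensorProduct.tmul_smul, map_smul] at h
  exact h

theorem cMinusOne_lie (y : LL V) : ⁅cMinusOne V, y⁆ = 0 := rho_c_lie _ _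

end Ambient

/-! ### The action of `Γ` and the Lie algebra of invariants. -/

namespace CycloData

variable {V : Type*} [AddCommGroup V] [Module ℂ V] [VertexLieAlgebra V] (𝒟 : CycloData V)

/-- The operator `α⁻¹ R_α` on `𝓛`, for `α = ω^k`. -/
def gamV (k : ℕ) : V →ₗ[ℂ] V := (((𝒟.ω ^ k)⁻¹ : ℂˣ) : ℂ) • Rop 𝒟.ω 𝒟.σ k

theorem gamV_apply (k : ℕ) (a : V) :
    𝒟.gamV k a = (((𝒟.ω ^ k)⁻¹ : ℂˣ) : ℂ) • Rop 𝒟.ω 𝒟.σ k a := rfl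

theorem gamV_D (k : ℕ) (a : V) : 𝒟.gamV k (D a) = ((𝒟.ω ^ k : ℂˣ) : ℂ) • D (𝒟.gamV k a) := by
  rw [gamV_apply, gamV_apply, D_Rop, map_smul, smul_comm]

/-- The factor `α⁻¹` in front of `R_α` turns `α^{n+1}` into `α^n`, which is what `∂ⁿ` produces under
`t ↦ α⁻¹ t`. Hence `Γ` acts by Lie algebra automorphisms. -/
theorem gamV_prod (k n : ℕ) (a b : V) : ((𝒟.ω ^ k : ℂˣ) : ℂ) ^ n • 𝒟.gamV k (prod n a b) =
    prod n (𝒟.gamV k a) (𝒟.gamV k b) := by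
  rw [gamV_apply, gamV_apply, gamV_apply, map_smul, map_smul, LinearMap.smul_apply, ← Rop_prod,
    smul_smul, smul_smul, smul_smul, Units.val_inv_eq_inv_val]
  congr 1
  have := (𝒟.ω ^ k).ne_zero
  field_simp
  rw [pow_succ]

theorem scaleRat_delta (k : ℕ) (f : RatFunc ℂ) : (scaleRat (𝒟.ω ^ k)⁻¹).toLinearMap (δ f) =
    ((𝒟.ω ^ k : ℂˣ) : ℂ) • δ ((scaleRat (𝒟.ω ^ k)⁻¹).toLinearMap f) := by
  change scaleRat _ (ratDeriv f) = _ • ratDeriv (scaleRat _ f)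
  rw [ratDeriv_scaleRat, smul_smul, Units.mul_inv, one_smul]

/-- The action of `ω^k` on `Lie_{ℂ(t)} 𝓛`. -/
def gam (k : ℕ) : RatLie V →ₗ⁅ℂ⁆ RatLie V :=
  { LieOf.map (𝒟.gamV k) (scaleRat (𝒟.ω ^ k)⁻¹).toLinearMap _ (𝒟.gamV_D k) (𝒟.scaleRat_delta k) with
    map_lie' := fun {x y} => LieOf.map_lie _ (𝒟.gamV k) (scaleRat (𝒟.ω ^ k)⁻¹).toLinearMap _
      (fun a f => LieOf.map_rho _ _ _ _ _ a f) (𝒟.scaleRat_delta k)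
      (fun f g => map_mul (scaleRat (𝒟.ω ^ k)⁻¹) f g) (𝒟.gamV_prod k) x y }

theorem gam_rho (k : ℕ) (a : V) (f : RatFunc ℂ) : 𝒟.gam k (rho (a ⊗ₜ[ℂ] f)) =
    rho (((((𝒟.ω ^ k)⁻¹ : ℂˣ) : ℂ) • Rop 𝒟.ω 𝒟.σ k a) ⊗ₜ[ℂ] scaleRat (𝒟.ω ^ k)⁻¹ f) :=
  LieOf.map_rho (𝒟.gamV k) (scaleRat (𝒟.ω ^ k)⁻¹).toLinearMap _ (𝒟.gamV_D k)
    (𝒟.scaleRat_delta k) a f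

theorem gam_polePow (k : ℕ) (a : V) (p : ℂ) (n : ℕ) : 𝒟.gam k (rho (a ⊗ₜ[ℂ] polePow p n)) =
    ((𝒟.ω ^ k : ℂˣ) : ℂ) ^ n •
      rho (Rop 𝒟.ω 𝒟.σ k a ⊗ₜ[ℂ] polePow (((𝒟.ω ^ k : ℂˣ) : ℂ) * p) n) := by
  rw [gam_rho, scaleRat_polePow, inv_inv, TensorProduct.tmul_smul, ← TensorProduct.smul_tmul',
    map_smul, map_smul, smul_smul, pow_succ, mul_assoc, Units.mul_inv, mul_one]

theorem gam_gam (j k : ℕ) (x : RatLie V) : 𝒟.gam j (𝒟.gam k x) = 𝒟.gam (j + k) x := by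
  have : (𝒟.gam j).toLinearMap ∘ₗ (𝒟.gam k).toLinearMap = (𝒟.gam (j + k)).toLinearMap := by
    apply LieOf.hom_ext
    intro a f
    change 𝒟.gam j (𝒟.gam k (rho (a ⊗ₜ[ℂ] f))) = 𝒟.gam (j + k) (rho (a ⊗ₜ[ℂ] f))
    rw [gam_rho, gam_rho, gam_rho, scaleRat_scaleRat, map_smul, Rop_Rop, smul_smul, pow_add,
      mul_inv, Units.val_mul]
  exact LinearMap.congr_fun this x

theorem gam_of_dvd (k : ℕ) (hk : 𝒟.T ∣ k) (x : RatLie V) : 𝒟.gam k x = x := by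
  obtain ⟨m, rfl⟩ := hk
  have h1 : 𝒟.ω ^ (𝒟.T * m) = 1 := by rw [pow_mul, 𝒟.prim.pow_eq_one, one_pow]
  have h2 : 𝒟.σ.lin ^ (𝒟.T * m) = 1 := by rw [pow_mul, 𝒟.σ_pow, one_pow]
  have : (𝒟.gam (𝒟.T * m)).toLinearMap = LinearMap.id := by
    apply LieOf.hom_ext
    intro a f
    change 𝒟.gam _ (rho (a ⊗ₜ[ℂ] f)) = _
    rw [gam_rho, Rop_of_pow_eq_one _ _ _ h1 h2, h1, inv_one, Units.val_one, one_smul, scaleRat_one]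
    rfl
  exact LinearMap.congr_fun this x

theorem sum_shift {W : Type*} [AddCommGroup W] (g : ℕ → W) (T : ℕ) (hg : ∀ k, g (k + T) = g k)
    (j : ℕ) : ∑ k ∈ Finset.range T, g (j + k) = ∑ k ∈ Finset.range T, g k := by
  induction j with
  | zero => simp
  | succ j ih =>
    rw [← ih]
    have h1 := Finset.sum_range_succ (fun k => g (j + k)) T
    have h2 := Finset.sum_range_succ' (fun k => g (j + k)) T
    rw [h1, hg, add_zero] at h2
    rw [add_right_cancel h2]
    exact Finset.sum_congr rfl fun k _ => by congr 1; omega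

/-- The sum over the group `Γ`. -/
def avg : RatLie V →ₗ[ℂ] RatLie V := ∑ k ∈ Finset.range 𝒟.T, (𝒟.gam k).toLinearMap

theorem avg_apply (x : RatLie V) : 𝒟.avg x = ∑ k ∈ Finset.range 𝒟.T, 𝒟.gam k x := by
  rw [avg, LinearMap.sum_apply]; rfl

theorem gam_avg (j : ℕ) (x : RatLie V) : 𝒟.gam j (𝒟.avg x) = 𝒟.avg x := by
  rw [avg_apply, map_sum]
  simp only [gam_gam]
  refine sum_shift (fun k => 𝒟.gam k x) 𝒟.T (fun k => ?_) j
  rw [← gam_gam, 𝒟.gam_of_dvd 𝒟.T dvd_rfl]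

theorem avg_gam (j : ℕ) (x : RatLie V) : 𝒟.avg (𝒟.gam j x) = 𝒟.avg x := by
  rw [← 𝒟.gam_avg j x, avg_apply, avg_apply, map_sum]
  simp only [gam_gam, add_comm]

/-- Bracketing with the invariant `𝒟.avg y` commutes with `Γ`; this makes the averages a Lie
subalgebra. -/
theorem lie_avg (x y : RatLie V) : ⁅𝒟.avg x, 𝒟.avg y⁆ = 𝒟.avg ⁅x, 𝒟.avg y⁆ := by
  rw [avg_apply _ x, avg_apply _ ⁅x, 𝒟.avg y⁆, sum_lie]
  refine Finset.sum_congr rfl fun k _ => ?_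
  rw [LieHom.map_lie, gam_avg]

theorem gam_mem_withPoles (k : ℕ) {S : Set ℂ} {x : RatLie V} (hx : x ∈ withPoles V (orbit 𝒟.ω S)) :
    𝒟.gam k x ∈ withPoles V (orbit 𝒟.ω S) := by
  have : withPoles V (orbit 𝒟.ω S) ≤ (withPoles V (orbit 𝒟.ω S)).comap (𝒟.gam k).toLinearMap := by
    apply withPoles_le
    rintro a _ ⟨j, s, hs, rfl⟩ n
    change 𝒟.gam k (rho (a ⊗ₜ[ℂ] polePow _ n)) ∈ withPoles V (orbit 𝒟.ω S)
    rw [gam_polePow]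
    refine Submodule.smul_mem _ _ (rho_mem_withPoles _ (polePow_mem _ _ ?_ n))
    exact ⟨k + j, s, hs, by rw [pow_add, Units.val_mul, mul_assoc]⟩
  exact this hx

theorem avg_mem_withPoles {S : Set ℂ} {x : RatLie V} (hx : x ∈ withPoles V (orbit 𝒟.ω S)) :
    𝒟.avg x ∈ withPoles V (orbit 𝒟.ω S) := by
  rw [avg_apply]
  exact Submodule.sum_mem _ fun k _ => 𝒟.gam_mem_withPoles k hx

/-- The Lie algebra of `Γ`-invariants with poles in `Γ S`. -/
def inv (S : Set ℂ) : LieSubalgebra ℂ (RatLie V) :=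
  { Submodule.map 𝒟.avg (withPoles V (orbit 𝒟.ω S)) with
    lie_mem' := fun {x y} hx hy => by
      obtain ⟨x, hx, rfl⟩ := hx
      obtain ⟨y, hy, rfl⟩ := hy
      exact ⟨⁅x, 𝒟.avg y⁆, withPoles_lie hx (𝒟.avg_mem_withPoles hy), (𝒟.lie_avg x y).symm⟩ }

theorem avg_mem_inv {S : Set ℂ} {x : RatLie V} (hx : x ∈ withPoles V (orbit 𝒟.ω S)) :
    𝒟.avg x ∈ 𝒟.inv S := ⟨x, hx, rfl⟩

theorem mem_withPoles_of_mem_inv {S : Set ℂ} {x : RatLie V} (hx : x ∈ 𝒟.inv S) :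
    x ∈ withPoles V (orbit 𝒟.ω S) := by
  obtain ⟨x, hx, rfl⟩ := hx
  exact 𝒟.avg_mem_withPoles hx

theorem gam_of_mem_inv {S : Set ℂ} {x : RatLie V} (hx : x ∈ 𝒟.inv S) (k : ℕ) : 𝒟.gam k x = x := by
  obtain ⟨x, hx, rfl⟩ := hx
  exact 𝒟.gam_avg k x

theorem mem_orbit {S : Set ℂ} {s : ℂ} (hs : s ∈ S) : s ∈ orbit 𝒟.ω S := ⟨0, s, hs, by simp⟩

theorem orbit_mono {S S' : Set ℂ} (h : S ⊆ S') : orbit 𝒟.ω S ⊆ orbit 𝒟.ω S' := by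
  rintro _ ⟨k, s, hs, rfl⟩
  exact ⟨k, s, h hs, rfl⟩

theorem inv_mono {S S' : Set ℂ} (h : S ⊆ S') {x : RatLie V} (hx : x ∈ 𝒟.inv S) : x ∈ 𝒟.inv S' := by
  obtain ⟨x, hx, rfl⟩ := hx
  exact ⟨x, withPoles_mono (𝒟.orbit_mono h) hx, rfl⟩

/-- The invariants are spanned by the averages of elements with poles in `S`. -/
theorem inv_le {S : Set ℂ} {W : Submodule ℂ (RatLie V)}
    (h : ∀ (a : V), ∀ p ∈ S, ∀ n, 𝒟.avg (rho (a ⊗ₜ[ℂ] polePow p n)) ∈ W) {x : RatLie V}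
    (hx : x ∈ 𝒟.inv S) : x ∈ W := by
  obtain ⟨x, hx, rfl⟩ := hx
  have : withPoles V (orbit 𝒟.ω S) ≤ W.comap 𝒟.avg := by
    apply withPoles_le
    rintro a _ ⟨k, s, hs, rfl⟩ n
    change 𝒟.avg _ ∈ W
    -- The natural number `k (T - 1)` is `-k` modulo `T`. Rotating by it brings the pole `ω^k s`
    -- back to `s` without changing the average.
    have hk : 𝒟.ω ^ (k * (𝒟.T - 1)) * 𝒟.ω ^ k = 1 := by
      have : k * (𝒟.T - 1) + k = 𝒟.T * k := by
        obtain ⟨t, ht⟩ : ∃ t, 𝒟.T = t + 1 := ⟨𝒟.T - 1, by have := 𝒟.T_pos; omega⟩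
        rw [ht]; simp; ring
      rw [← pow_add, this, pow_mul, 𝒟.prim.pow_eq_one, one_pow]
    rw [← 𝒟.avg_gam (k * (𝒟.T - 1)), gam_polePow, ← mul_assoc, ← Units.val_mul, hk, Units.val_one,
      one_mul, map_smul]
    exact W.smul_mem _ (h _ s hs n)
  exact this hx

/-- The splitting of a function by the location of its poles, made equivariant by averaging. -/
theorem exists_add_of_mem_inv_union {S S' : Set ℂ} {x : RatLie V} (hx : x ∈ 𝒟.inv (S ∪ S')) :
    ∃ y ∈ 𝒟.inv S, ∃ z ∈ 𝒟.inv S', x = y + z := by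
  have : x ∈ (𝒟.inv S).toSubmodule ⊔ (𝒟.inv S').toSubmodule := by
    refine 𝒟.inv_le (fun a p hp n => ?_) hx
    rcases hp with hp | hp
    · exact Submodule.mem_sup_left
        (𝒟.avg_mem_inv (rho_mem_withPoles _ (polePow_mem _ _ (𝒟.mem_orbit hp) n)))
    · exact Submodule.mem_sup_right
        (𝒟.avg_mem_inv (rho_mem_withPoles _ (polePow_mem _ _ (𝒟.mem_orbit hp) n)))
  obtain ⟨y, hy, z, hz, h⟩ := Submodule.mem_sup.1 this
  exact ⟨y, hy, z, hz, h.symm⟩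

/-! ### Residues of the component along `c`, and points in distinct orbits. -/

/-- The functional `ρ(a ⊗ f) ↦ κ(a) Res f` on `L(𝓛)`. -/
def kres : LL V →ₗ[ℂ] ℂ :=
  LieOf.lift
    (LinearMap.mk₂ ℂ (fun a f => 𝒟.κ a * f.coeff (-1))
      (fun a b f => by rw [map_add, add_mul]) (fun r a f => by simp [mul_assoc])
      (fun a f g => by rw [HahnSeries.coeff_add, mul_add])
      (fun r a f => by rw [HahnSeries.coeff_smul, smul_eq_mul, smul_eq_mul, mul_left_comm]))
    (fun a f => by
      simp only [LinearMap.mk₂_apply]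
      rw [𝒟.κ_D, delta_laurent_coeff]
      simp)

theorem kres_rho (a : V) (f : LaurentSeries ℂ) :
    𝒟.kres (rho (a ⊗ₜ[ℂ] f)) = 𝒟.κ a * f.coeff (-1) := LieOf.lift_rho _ _ _ _

/-- The residue at `p` of the component of an element along `c`. -/
def resAt (p : ℂ) : RatLie V →ₗ[ℂ] ℂ := 𝒟.kres ∘ₗ (expandRat p).toLinearMap

theorem resAt_apply (p : ℂ) (x : RatLie V) : 𝒟.resAt p x = 𝒟.kres (expandRat p x) := rfl

theorem resAt_rho (p : ℂ) (a : V) (f : RatFunc ℂ) :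
    𝒟.resAt p (rho (a ⊗ₜ[ℂ] f)) = 𝒟.κ a * (laurentAt p f).coeff (-1) := by
  rw [resAt_apply, expandRat_rho, kres_rho]

theorem coeff_polePow (p q : ℂ) (n : ℕ) :
    (laurentAt q (polePow p n)).coeff (-1) = if p = q ∧ n = 0 then 1 else 0 := by
  by_cases h : p = q
  · subst h
    rw [laurentAt_polePow_self]
    by_cases hn : n = 0
    · subst hn; simp
    · rw [HahnSeries.coeff_single_of_ne (by omega), if_neg (by tauto)]
  · obtain ⟨C, hC⟩ := exists_coeff_polePow
    rw [(hC n p q h).2 _ (by omega), if_neg (by tauto)]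

/-- It suffices to treat `a ⊗ (t - s)^{-(n+1)}`. There only `n = 0` has a residue, for which the
scalar `α^n` is `1`, and `κ` is invariant under `R_α`. -/
theorem resAt_gam (p : ℂ) (k : ℕ) {P : Set ℂ} {x : RatLie V} (hx : x ∈ withPoles V P) :
    𝒟.resAt (((𝒟.ω ^ k : ℂˣ) : ℂ) * p) (𝒟.gam k x) = 𝒟.resAt p x := by
  have : withPoles V P ≤ LinearMap.eqLocus
      (𝒟.resAt (((𝒟.ω ^ k : ℂˣ) : ℂ) * p) ∘ₗ (𝒟.gam k).toLinearMap) (𝒟.resAt p) := by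
    apply withPoles_le
    intro a s _ n
    change 𝒟.resAt _ (𝒟.gam k (rho (a ⊗ₜ[ℂ] polePow s n))) = 𝒟.resAt p (rho (a ⊗ₜ[ℂ] polePow s n))
    rw [gam_polePow, map_smul, resAt_rho, resAt_rho, coeff_polePow, coeff_polePow,
      kappa_Rop 𝒟.complement 𝒟.σ 𝒟.σ_Lo 𝒟.κ 𝒟.κ_Lo 𝒟.κ_D]
    have h1 : (((𝒟.ω ^ k : ℂˣ) : ℂ) * s = ((𝒟.ω ^ k : ℂˣ) : ℂ) * p) ↔ s = p :=
      mul_right_inj' (Units.ne_zero _)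
    simp only [h1]
    split_ifs with h
    · rw [h.2]; simp
    · simp
  exact this hx

/-- The points are nonzero and lie in distinct `Γ`-orbits. -/
def Distinct {ι : Type*} (z : ι → ℂ) : Prop :=
  (∀ i, z i ≠ 0) ∧ ∀ i j, i ≠ j → ∀ k : ℕ, z i ≠ ((𝒟.ω ^ k : ℂˣ) : ℂ) * z j

variable {ι : Type*} {z : ι → ℂ}

theorem omega_pow_mod (k : ℕ) : 𝒟.ω ^ k = 𝒟.ω ^ (k % 𝒟.T) := by
  conv_lhs => rw [← Nat.mod_add_div k 𝒟.T, pow_add, pow_mul, 𝒟.prim.pow_eq_one, one_pow, mul_one]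

theorem orbit_eq_range : orbit 𝒟.ω (Set.range z) =
    Set.range fun p : Fin 𝒟.T × ι => ((𝒟.ω ^ (p.1 : ℕ) : ℂˣ) : ℂ) * z p.2 := by
  ext x
  constructor
  · rintro ⟨k, _, ⟨i, rfl⟩, rfl⟩
    exact ⟨(⟨k % 𝒟.T, Nat.mod_lt _ 𝒟.T_pos⟩, i), by rw [𝒟.omega_pow_mod k]⟩
  · rintro ⟨⟨k, i⟩, rfl⟩
    exact ⟨k, z i, ⟨i, rfl⟩, rfl⟩

theorem Distinct.eq_of_mul_eq (hz : 𝒟.Distinct z) {k l : ℕ} {i j : ι}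
    (h : ((𝒟.ω ^ k : ℂˣ) : ℂ) * z i = ((𝒟.ω ^ l : ℂˣ) : ℂ) * z j) : i = j := by
  by_contra hij
  have hk : 𝒟.ω ^ (k * (𝒟.T - 1)) * 𝒟.ω ^ k = 1 := by
    have : k * (𝒟.T - 1) + k = 𝒟.T * k := by
      obtain ⟨t, ht⟩ : ∃ t, 𝒟.T = t + 1 := ⟨𝒟.T - 1, by have := 𝒟.T_pos; omega⟩
      rw [ht]; simp; ring
    rw [← pow_add, this, pow_mul, 𝒟.prim.pow_eq_one, one_pow]
  apply hz.2 i j hij (k * (𝒟.T - 1) + l)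
  have h' := congrArg (fun x => ((𝒟.ω ^ (k * (𝒟.T - 1)) : ℂˣ) : ℂ) * x) h
  rwa [← mul_assoc, ← Units.val_mul, hk, Units.val_one, one_mul, ← mul_assoc, ← Units.val_mul,
    ← pow_add] at h'

theorem mul_eq_self {u : ℂ} (hu : u ≠ 0) {k : ℕ} (hk : k < 𝒟.T)
    (h : ((𝒟.ω ^ k : ℂˣ) : ℂ) * u = u) : k = 0 := by
  have h1 : ((𝒟.ω ^ k : ℂˣ) : ℂ) = 1 := by
    apply mul_right_cancel₀ hu; rw [h, one_mul]
  have h2 : 𝒟.ω ^ k = 1 := Units.ext h1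
  have h3 := (𝒟.prim.pow_eq_one_iff_dvd k).1 h2
  exact Nat.eq_zero_of_dvd_of_lt h3 hk

theorem Distinct.injective (hz : 𝒟.Distinct z) :
    Function.Injective fun p : Fin 𝒟.T × ι => ((𝒟.ω ^ (p.1 : ℕ) : ℂˣ) : ℂ) * z p.2 := by
  rintro ⟨k, i⟩ ⟨l, j⟩ h
  simp only at h
  have hij := hz.eq_of_mul_eq 𝒟 h
  subst hij
  have h1 : ((𝒟.ω ^ (k : ℕ) : ℂˣ) : ℂ) = ((𝒟.ω ^ (l : ℕ) : ℂˣ) : ℂ) :=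
    mul_right_cancel₀ (hz.1 i) h
  have h2 := 𝒟.prim.pow_inj k.2 l.2 (Units.ext h1)
  rw [Fin.ext h2]

variable [Fintype ι]

/-- Every term of the bracket is `a_(n) b` tensored with a product of two functions vanishing at
infinity, so infinity contributes nothing. A single element such as `c ⊗ 1/(t - p)` would not
satisfy this. -/
theorem sum_resAt_lie {J : Type*} [Fintype J] {q : J → ℂ} (hq : Function.Injective q)
    {x y : RatLie V} (hx : x ∈ withPoles V (Set.range q)) (hy : y ∈ withPoles V (Set.range q)) :
    ∑ j, 𝒟.resAt (q j) ⁅x, y⁆ = 0 := by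
  induction hx using Submodule.span_induction with
  | zero => simp
  | add x x' _ _ hx hx' => simp only [add_lie, map_add, Finset.sum_add_distrib, hx, hx', add_zero]
  | smul r x _ hx => simp only [smul_lie, map_smul, ← Finset.smul_sum, hx, smul_zero]
  | mem x hx =>
  obtain ⟨a, f, hf, rfl⟩ := hx
  induction hy using Submodule.span_induction with
  | zero => simp
  | add x x' _ _ hx hx' => simp only [lie_add, map_add, Finset.sum_add_distrib, hx, hx', add_zero]
  | smul r x _ hx => simp only [lie_smul, map_smul, ← Finset.smul_sum, hx, smul_zero]
  | mem y hy =>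
  obtain ⟨b, g, hg, rfl⟩ := hy
  obtain ⟨N, hN⟩ := VertexLieAlgebra.locality a b
  rw [lie_rho_tmul a b f g N hN]
  simp only [map_sum, map_smul, resAt_rho]
  rw [Finset.sum_comm]
  refine Finset.sum_eq_zero fun n _ => ?_
  rw [← Finset.smul_sum, ← Finset.mul_sum, sum_residues_mul q hq (delta_pow_mem hf n) hg, mul_zero,
    smul_zero]

/-- The residue theorem: the sum of the `c`-residues of the bracket of two invariants vanishes. -/
theorem sum_resAt_inv_lie (hz : 𝒟.Distinct z) {x y : RatLie V} (hx : x ∈ 𝒟.inv (Set.range z))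
    (hy : y ∈ 𝒟.inv (Set.range z)) : ∑ i, 𝒟.resAt (z i) ⁅x, y⁆ = 0 := by
  have hxy : ⁅x, y⁆ ∈ 𝒟.inv (Set.range z) := (𝒟.inv (Set.range z)).lie_mem hx hy
  have h1 := 𝒟.mem_withPoles_of_mem_inv hx
  have h2 := 𝒟.mem_withPoles_of_mem_inv hy
  rw [orbit_eq_range] at h1 h2
  have h := 𝒟.sum_resAt_lie (hz.injective 𝒟) h1 h2
  rw [Fintype.sum_prod_type] at h
  -- Invariants have equal residues along an orbit, so the sum over all poles is `T` times the sum
  -- over the chosen representatives.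
  have h3 : ∀ (k : Fin 𝒟.T) (i : ι), 𝒟.resAt (((𝒟.ω ^ (k : ℕ) : ℂˣ) : ℂ) * z i) ⁅x, y⁆ =
      𝒟.resAt (z i) ⁅x, y⁆ := by
    intro k i
    conv_lhs => rw [← 𝒟.gam_of_mem_inv hxy k]
    exact 𝒟.resAt_gam _ _ (𝒟.mem_withPoles_of_mem_inv hxy)
  simp only [h3, Finset.sum_const, Finset.card_univ, Fintype.card_fin] at h
  rw [nsmul_eq_mul] at h
  refine (mul_eq_zero.1 h).resolve_left ?_
  exact_mod_cast 𝒟.T_pos.ne'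

end CycloData

/-! ### The decomposition of `L(𝓛)` into the invariants with poles in `Γu` and the positive part. -/

namespace CycloData

variable {V : Type*} [AddCommGroup V] [Module ℂ V] [VertexLieAlgebra V] (𝒟 : CycloData V)

section Principal

theorem prin_delta_smul (u : ℂ) (f : LaurentSeries ℂ) : prin u (δ f) = (1 : ℂ) • δ (prin u f) := by
  rw [one_smul, prin_delta]

/-- The map `a ⊗ f ↦ a ⊗ f₋(t - u)`, with `f₋` the principal part of the Laurent series `f`. -/
def prinMap (V : Type*) [AddCommGroup V] [Module ℂ V] [VertexLieAlgebra V] (u : ℂ) :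
    LL V →ₗ[ℂ] RatLie V :=
  LieOf.map LinearMap.id (prin u) 1 (fun a => by simp) (prin_delta_smul u)

theorem prinMap_rho (u : ℂ) (a : V) (f : LaurentSeries ℂ) :
    prinMap V u (rho (a ⊗ₜ[ℂ] f)) = rho (a ⊗ₜ[ℂ] prin u f) :=
  LieOf.map_rho LinearMap.id (prin u) 1 (fun a => by simp) (prin_delta_smul u) a f

theorem prinMap_of_mem_positivePart (u : ℂ) {y : LL V} (hy : y ∈ positivePart V) :
    prinMap V u y = 0 := by
  have : positivePart V ≤ LinearMap.ker (prinMap V u) := by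
    refine Submodule.span_le.2 ?_
    rintro _ ⟨a, f, hf, rfl⟩
    change prinMap V u (rho (a ⊗ₜ[ℂ] f)) = 0
    rw [prinMap_rho, prin_eq_zero u f hf, TensorProduct.tmul_zero, map_zero]
  exact this hy

theorem prinMap_mem (u : ℂ) (y : LL V) : prinMap V u y ∈ withPoles V {u} := by
  induction y using LieOf.induction with
  | h0 => simp
  | h1 a f => rw [prinMap_rho]; exact rho_mem_withPoles a (prin_mem u f)
  | h2 x y hx hy => rw [map_add]; exact Submodule.add_mem _ hx hy

theorem expand_prinMap (u : ℂ) (y : LL V) :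
    y - expandRat u (prinMap V u y) ∈ positivePart V := by
  induction y using LieOf.induction with
  | h0 => simp
  | h1 a f =>
    rw [prinMap_rho, expandRat_rho, ← map_sub, ← TensorProduct.tmul_sub]
    refine rho_mem_positivePart a fun n hn => ?_
    rw [HahnSeries.coeff_sub, laurentAt_prin_coeff u f n hn, sub_self]
  | h2 x y hx hy =>
    rw [map_add, map_add, add_sub_add_comm]
    exact Submodule.add_mem _ hx hy

/-- The map `L(𝓛) → Inv`, `a ⊗ f ↦ ∑_α α.(a ⊗ f₋(t - u))`. -/
def principal (u : ℂ) : LL V →ₗ[ℂ] 𝒟.inv {u} :=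
  LinearMap.codRestrict (𝒟.inv {u}).toSubmodule (𝒟.avg ∘ₗ prinMap V u) fun y =>
    𝒟.avg_mem_inv (withPoles_mono (fun _ h => 𝒟.mem_orbit h) (prinMap_mem u y))

theorem principal_coe (u : ℂ) (y : LL V) :
    ((𝒟.principal u y : 𝒟.inv {u}) : RatLie V) = 𝒟.avg (prinMap V u y) := rfl

/-- The Laurent expansion at `u` of the invariants with poles in `Γ u`. -/
def expandInv (u : ℂ) : 𝒟.inv {u} →ₗ⁅ℂ⁆ LL V := (expandRat u).comp (𝒟.inv {u}).incl

theorem expandInv_apply (u : ℂ) (h : 𝒟.inv {u}) : 𝒟.expandInv u h = expandRat u (h : RatLie V) :=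
  rfl

variable {u : ℂ} (hu : u ≠ 0)

include hu

/-- Only the term `α = 1` of the average has a pole at `u`, since `αu ≠ u` for the other `α`. This
is where `u ≠ 0` enters. -/
theorem expand_avg {x : RatLie V} (hx : x ∈ withPoles V {u}) :
    expandRat u (𝒟.avg x) - expandRat u x ∈ positivePart V := by
  obtain ⟨t, ht⟩ : ∃ t, 𝒟.T = t + 1 := ⟨𝒟.T - 1, by have := 𝒟.T_pos; omega⟩
  rw [avg_apply, ht, Finset.sum_range_succ', 𝒟.gam_of_dvd 0 (dvd_zero _), map_add,
    add_sub_cancel_right, map_sum]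
  refine Submodule.sum_mem _ fun k hk => ?_
  have : withPoles V {u} ≤
      (positivePart V).comap ((expandRat u).toLinearMap ∘ₗ (𝒟.gam (k + 1)).toLinearMap) := by
    apply withPoles_le
    intro a p hp n
    rw [Set.mem_singleton_iff] at hp
    subst hp
    change expandRat p (𝒟.gam (k + 1) (rho (a ⊗ₜ[ℂ] polePow p n))) ∈ positivePart V
    rw [gam_polePow, map_smul]
    refine Submodule.smul_mem _ _ (expandRat_mem_positivePart
      (P := {((𝒟.ω ^ (k + 1) : ℂˣ) : ℂ) * p}) ?_
      (rho_mem_withPoles _ (polePow_mem _ _ (Set.mem_singleton _) n)))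
    intro h
    rw [Set.mem_singleton_iff] at h
    have := 𝒟.mul_eq_self hu (k := k + 1) (by rw [Finset.mem_range] at hk; omega) h.symm
    omega
  exact this hx

theorem sub_expand_principal (y : LL V) :
    y - 𝒟.expandInv u (𝒟.principal u y) ∈ positivePart V := by
  rw [expandInv_apply, principal_coe]
  have h1 := expand_prinMap u y
  have h2 := 𝒟.expand_avg hu (prinMap_mem u y)
  convert Submodule.sub_mem _ h1 h2 using 1
  abel

/-- Expansion at `u` followed by the principal part isolates the term `α = 1` of an average, and
averaging it restores the invariant. -/
theorem principal_expandInv (h : 𝒟.inv {u}) : 𝒟.principal u (𝒟.expandInv u h) = h := by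
  apply Subtype.ext
  rw [principal_coe, expandInv_apply]
  have : (h : RatLie V) ∈ LinearMap.eqLocus
      (𝒟.avg ∘ₗ prinMap V u ∘ₗ (expandRat u).toLinearMap) LinearMap.id := by
    refine 𝒟.inv_le (fun a p hp n => ?_) h.2
    rw [Set.mem_singleton_iff] at hp
    subst hp
    change 𝒟.avg (prinMap V p (expandRat p (𝒟.avg (rho (a ⊗ₜ[ℂ] polePow p n))))) =
      𝒟.avg (rho (a ⊗ₜ[ℂ] polePow p n))
    have h1 := prinMap_of_mem_positivePart p (𝒟.expand_avg hu
      (rho_mem_withPoles a (polePow_mem {p} p (Set.mem_singleton p) n)))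
    rw [map_sub, sub_eq_zero] at h1
    rw [h1, expandRat_rho, prinMap_rho, laurentAt_polePow_self, prin_single]
  exact this

theorem mem_positivePart_of_principal {y : LL V} (hy : 𝒟.principal u y = 0) :
    y ∈ positivePart V := by
  have := 𝒟.sub_expand_principal hu y
  rwa [hy, map_zero, sub_zero] at this

/-- The kernel of `principal` is the positive part, which is a subalgebra. This is the matched-pair
hypothesis. -/
theorem principal_lie (x y : LL V) (hx : 𝒟.principal u x = 0) (hy : 𝒟.principal u y = 0) :
    𝒟.principal u ⁅x, y⁆ = 0 := by
  apply Subtype.ext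
  rw [principal_coe, prinMap_of_mem_positivePart u (positivePart_lie
    (𝒟.mem_positivePart_of_principal hu hx) (𝒟.mem_positivePart_of_principal hu hy)), map_zero]
  rfl

end Principal

theorem principal_of_mem_positivePart (u : ℂ) {y : LL V} (hy : y ∈ positivePart V) :
    𝒟.principal u y = 0 := by
  apply Subtype.ext
  rw [principal_coe, prinMap_of_mem_positivePart u hy, map_zero]
  rfl

/-! ### Replacing the global cyclotomic algebra by the invariants with a corrected action. -/

section Coinvariants

variable (S : Set ℂ)

theorem gammaAct_rho (ω : ℂˣ) (σ : VLAut V) (k : ℕ) (a : V) (f : poleAlg (orbit ω S)) :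
    gammaAct ω σ S k (rho (a ⊗ₜ[ℂ] f)) =
      rho (((((ω ^ k)⁻¹ : ℂˣ) : ℂ) • Rop ω σ k a) ⊗ₜ[ℂ] rotate ω S k f) := rfl

theorem toRat_gammaAct (k : ℕ) (y : LieOf V (poleAlg (orbit 𝒟.ω S))) :
    toRat _ (gammaAct 𝒟.ω 𝒟.σ S k y) = 𝒟.gam k (toRat _ y) := by
  induction y using LieOf.induction with
  | h0 => simp
  | h1 a f => rw [gammaAct_rho, toRat_rho, toRat_rho, gam_rho]; rfl
  | h2 x y hx hy => simp only [map_add, hx, hy]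

theorem gammaAct_gammaAct (j k : ℕ) (y : LieOf V (poleAlg (orbit 𝒟.ω S))) :
    gammaAct 𝒟.ω 𝒟.σ S j (gammaAct 𝒟.ω 𝒟.σ S k y) = gammaAct 𝒟.ω 𝒟.σ S (j + k) y := by
  induction y using LieOf.induction with
  | h0 => simp
  | h2 x y hx hy => simp only [map_add, hx, hy]
  | h1 a f =>
    have : rotate 𝒟.ω S j (rotate 𝒟.ω S k f) = rotate 𝒟.ω S (j + k) f := by
      apply Subtype.ext
      change scaleRat _ (scaleRat _ (f : RatFunc ℂ)) = scaleRat _ (f : RatFunc ℂ)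
      rw [scaleRat_scaleRat, pow_add, mul_inv]
    rw [gammaAct_rho, gammaAct_rho, gammaAct_rho, map_smul, Rop_Rop, smul_smul, this,
      pow_add 𝒟.ω j k, mul_inv, Units.val_mul]

theorem gammaAct_add_T (k : ℕ) (y : LieOf V (poleAlg (orbit 𝒟.ω S))) :
    gammaAct 𝒟.ω 𝒟.σ S (k + 𝒟.T) y = gammaAct 𝒟.ω 𝒟.σ S k y := by
  rw [← gammaAct_gammaAct]
  congr 1
  induction y using LieOf.induction with
  | h0 => simp
  | h2 x y hx hy => simp only [map_add, hx, hy]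
  | h1 a f =>
    have : rotate 𝒟.ω S 𝒟.T f = f := by
      apply Subtype.ext
      change scaleRat _ (f : RatFunc ℂ) = f
      rw [𝒟.prim.pow_eq_one, inv_one, scaleRat_one]
    rw [gammaAct_rho, this, Rop_of_pow_eq_one _ _ _ 𝒟.prim.pow_eq_one 𝒟.σ_pow, 𝒟.prim.pow_eq_one,
      inv_one, Units.val_one, one_smul]

/-- The image of `𝓛ᵒ ⊗ A` in `Lie_A 𝓛`. -/
def complementPart : Submodule ℂ (LieOf V (poleAlg (orbit 𝒟.ω S))) :=
  LinearMap.range (rho ∘ₗ TensorProduct.map 𝒟.Lo.subtype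
      (LinearMap.id : poleAlg (orbit 𝒟.ω S) →ₗ[ℂ] poleAlg (orbit 𝒟.ω S)))

variable {S}

theorem rho_mem_complementPart {a : V} (ha : a ∈ 𝒟.Lo) (f : poleAlg (orbit 𝒟.ω S)) :
    rho (a ⊗ₜ[ℂ] f) ∈ 𝒟.complementPart S := ⟨(⟨a, ha⟩ : 𝒟.Lo) ⊗ₜ[ℂ] f, rfl⟩

/-- `ρ(D b ⊗ f) = -ρ(b ⊗ f')` moves `D` to the function, so generation of `𝓛` over `ℂ[D]` by `𝓛ᵒ`
and `c` suffices; `c` contributes nothing because `D c = 0`. It follows that `Γ` preserves the image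
of `𝓛ᵒ ⊗ A`, although `σ` preserves `𝓛ᵒ` only modulo `Im D`. -/
theorem rho_D_mem_complementPart (b : V) (f : poleAlg (orbit 𝒟.ω S)) :
    rho (D b ⊗ₜ[ℂ] f) ∈ 𝒟.complementPart S := by
  let W : Submodule ℂ V :=
    { carrier := {b | ∀ f : poleAlg (orbit 𝒟.ω S), rho (D b ⊗ₜ[ℂ] f) ∈ 𝒟.complementPart S}
      zero_mem' := fun f => by simp
      add_mem' := fun {a b} ha hb f => by
        rw [map_add, TensorProduct.add_tmul, map_add]
        exact Submodule.add_mem _ (ha f) (hb f)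
      smul_mem' := fun r a ha f => by
        rw [map_smul, ← TensorProduct.smul_tmul', map_smul]
        exact Submodule.smul_mem _ r (ha f) }
  have hW : W = ⊤ := by
    apply eq_top_of_D_stable 𝒟.complement
    · intro a ha f
      rw [rho_D]
      exact Submodule.neg_mem _ (𝒟.rho_mem_complementPart ha _)
    · intro f
      rw [D_c, TensorProduct.zero_tmul, map_zero]
      exact Submodule.zero_mem _
    · intro w hw f
      rw [rho_D]
      exact Submodule.neg_mem _ (hw _)
  have hb : b ∈ W := by rw [hW]; trivial
  exact hb f

theorem gammaAct_mem_complementPart (k : ℕ) {a : V} (ha : a ∈ 𝒟.Lo) (f : poleAlg (orbit 𝒟.ω S)) :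
    gammaAct 𝒟.ω 𝒟.σ S k (rho (a ⊗ₜ[ℂ] f)) ∈ 𝒟.complementPart S := by
  rw [gammaAct_rho, ← TensorProduct.smul_tmul', map_smul]
  refine Submodule.smul_mem _ _ ?_
  obtain ⟨x, hx, _, ⟨y, rfl⟩, hxy⟩ :=
    Submodule.mem_sup.1 (Rop_Lo 𝒟.complement 𝒟.σ 𝒟.σ_Lo 𝒟.ω k a ha)
  rw [← hxy, TensorProduct.add_tmul, map_add]
  exact Submodule.add_mem _ (𝒟.rho_mem_complementPart hx _) (𝒟.rho_D_mem_complementPart y _)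

/-- The global cyclotomic Lie algebra contains the averages over `Γ` of the elements `a ⊗ f`, `a ∈ 𝓛ᵒ`. -/
theorem sum_gammaAct_mem {a : V} (ha : a ∈ 𝒟.Lo) (f : poleAlg (orbit 𝒟.ω S)) :
    ∑ k ∈ Finset.range 𝒟.T, gammaAct 𝒟.ω 𝒟.σ S k (rho (a ⊗ₜ[ℂ] f)) ∈
      cycloGlobal 𝒟.ω 𝒟.T 𝒟.σ 𝒟.Lo S := by
  refine ⟨Submodule.mem_sup_left (Submodule.sum_mem _ fun k _ =>
    𝒟.gammaAct_mem_complementPart k ha f), ?_⟩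
  rw [SetLike.mem_coe, Submodule.mem_iInf]
  intro j
  rw [Submodule.mem_comap, LinearMap.sub_apply, LinearMap.id_apply, map_sum]
  simp only [gammaAct_gammaAct]
  rw [sum_shift (fun k => gammaAct 𝒟.ω 𝒟.σ S k (rho (a ⊗ₜ[ℂ] f))) 𝒟.T
    (fun k => 𝒟.gammaAct_add_T S k _) j, sub_self]
  exact Submodule.zero_mem _

theorem toRat_mem_withPoles {P : Set ℂ} (y : LieOf V (poleAlg P)) : toRat P y ∈ withPoles V P := by
  induction y using LieOf.induction with
  | h0 => simp
  | h1 a f => rw [toRat_rho]; exact rho_mem_withPoles a f.2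
  | h2 x y hx hy => rw [map_add]; exact Submodule.add_mem _ hx hy

variable {N : Type*} [AddCommGroup N] [Module ℂ N] (act : RatLie V →ₗ[ℂ] Module.End ℂ N)
  (Λ : RatLie V →ₗ[ℂ] ℂ)

/-- The coinvariants of the global cyclotomic Lie algebra may be computed with the Lie algebra of
invariants, if its action is corrected by a functional in such a way that `c ⊗ A` acts by zero. -/
theorem span_cycloGlobal
    (H1 : ∀ f ∈ poleAlg (orbit 𝒟.ω S), act (rho (VertexLieAlgebra.c ⊗ₜ[ℂ] f)) =
      Λ (rho (VertexLieAlgebra.c ⊗ₜ[ℂ] f)) • 1)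
    (H2 : ∀ a ∈ 𝒟.Lo, ∀ f ∈ poleAlg (orbit 𝒟.ω S), Λ (rho (a ⊗ₜ[ℂ] f)) = 0)
    (H3 : ∀ s : S, Λ (toRat _ (centralSum V 𝒟.ω 𝒟.T S s)) = 1) :
    Submodule.span ℂ {w : N | ∃ y ∈ cycloGlobal 𝒟.ω 𝒟.T 𝒟.σ 𝒟.Lo S, ∃ n, w = act (toRat _ y) n} =
      Submodule.span ℂ {w : N | ∃ x ∈ 𝒟.inv S, ∃ n, w = act x n - Λ x • n} := by
  have hΛI : ∀ y ∈ centralIdeal V 𝒟.ω 𝒟.T S, Λ (toRat _ y) = 0 := by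
    intro y hy
    have : centralIdeal V 𝒟.ω 𝒟.T S ≤ LinearMap.ker (Λ ∘ₗ toRat _) := by
      refine Submodule.span_le.2 ?_
      rintro _ ⟨s, s', rfl⟩
      change Λ (toRat _ _) = 0
      rw [map_sub, map_sub, H3, H3, sub_self]
    exact this hy
  have hactI : ∀ y ∈ centralIdeal V 𝒟.ω 𝒟.T S, act (toRat _ y) = 0 := by
    intro y hy
    have h1 : ∀ s : S, act (toRat _ (centralSum V 𝒟.ω 𝒟.T S s)) = 1 := by
      intro s
      have h2 := H3 s
      rw [centralSum, map_sum] at h2 ⊢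
      simp only [toRat_rho, map_sum] at h2 ⊢
      refine (Finset.sum_congr rfl fun k _ => H1 _ (SetLike.coe_mem _)).trans ?_
      rw [← Finset.sum_smul, h2, one_smul]
    have : centralIdeal V 𝒟.ω 𝒟.T S ≤ LinearMap.ker (act ∘ₗ toRat _) := by
      refine Submodule.span_le.2 ?_
      rintro _ ⟨s, s', rfl⟩
      change act (toRat _ _) = 0
      rw [map_sub, map_sub, h1, h1, sub_self]
    exact this hy
  have hΛL : ∀ y ∈ 𝒟.complementPart S, Λ (toRat _ y) = 0 := by
    rintro _ ⟨x, rfl⟩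
    induction x using TensorProduct.induction_on with
    | zero => simp
    | add x y hx hy => rw [map_add, map_add, map_add, hx, hy, add_zero]
    | tmul a f => exact (congrArg Λ (toRat_rho _ _ _)).trans (H2 a a.2 f f.2)
  have hΛ : ∀ y ∈ cycloGlobal 𝒟.ω 𝒟.T 𝒟.σ 𝒟.Lo S, Λ (toRat _ y) = 0 := by
    intro y hy
    obtain ⟨y₁, h₁, y₂, h₂, rfl⟩ := Submodule.mem_sup.1 hy.1
    rw [map_add, map_add, hΛL y₁ h₁, hΛI y₂ h₂, add_zero]
  have hT : (𝒟.T : ℂ) ≠ 0 := by exact_mod_cast 𝒟.T_pos.ne'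
  apply le_antisymm
  · refine Submodule.span_le.2 ?_
    rintro _ ⟨y, hy, n, rfl⟩
    have hinv : ∀ k, gammaAct 𝒟.ω 𝒟.σ S k y - y ∈ centralIdeal V 𝒟.ω 𝒟.T S := by
      intro k
      have := hy.2
      rw [SetLike.mem_coe, Submodule.mem_iInf] at this
      exact this k
    -- Since `I` acts by zero, an element invariant modulo `I` acts as `1/T` times its average,
    -- which is an honest invariant.
    have h1 : act (𝒟.avg (toRat _ y)) = (𝒟.T : ℂ) • act (toRat _ y) := by
      rw [avg_apply, map_sum, Finset.sum_congr rfl (g := fun _ => act (toRat _ y)) (fun k _ => by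
        rw [← toRat_gammaAct, ← sub_eq_zero, ← map_sub, ← map_sub, hactI _ (hinv k)]),
        Finset.sum_const, Finset.card_range, Nat.cast_smul_eq_nsmul]
    have h2 : Λ (𝒟.avg (toRat _ y)) = 0 := by
      rw [avg_apply, map_sum]
      refine Finset.sum_eq_zero fun k _ => ?_
      rw [← toRat_gammaAct, ← hΛ y hy, ← sub_eq_zero, ← map_sub, ← map_sub, hΛI _ (hinv k)]
    have h3 : act (toRat _ y) n = (𝒟.T : ℂ)⁻¹ • (act (𝒟.avg (toRat _ y)) n -
        Λ (𝒟.avg (toRat _ y)) • n) := by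
      rw [h1, h2, zero_smul, sub_zero, LinearMap.smul_apply, smul_smul, inv_mul_cancel₀ hT, one_smul]
    rw [SetLike.mem_coe, h3]
    exact Submodule.smul_mem _ _ (Submodule.subset_span
      ⟨_, 𝒟.avg_mem_inv (toRat_mem_withPoles y), n, rfl⟩)
  · refine Submodule.span_le.2 ?_
    rintro _ ⟨_, ⟨x, hx, rfl⟩, n, rfl⟩
    set R := Submodule.span ℂ {w : N | ∃ y ∈ cycloGlobal 𝒟.ω 𝒟.T 𝒟.σ 𝒟.Lo S,
      ∃ n, w = act (toRat _ y) n} with hR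
    let tw : RatLie V →ₗ[ℂ] N := ((LinearMap.applyₗ n) ∘ₗ act - Λ.smulRight n) ∘ₗ 𝒟.avg
    have htw : ∀ x, tw x = act (𝒟.avg x) n - Λ (𝒟.avg x) • n := fun x => rfl
    suffices h : withPoles V (orbit 𝒟.ω S) ≤ R.comap tw from h hx
    refine Submodule.span_le.2 ?_
    rintro _ ⟨a, f, hf, rfl⟩
    -- The vectors `a` whose averaged elements `a ⊗ f` give relations. They include `𝓛ᵒ`, as the
    -- average lies in the global algebra, and `c`, which the correction kills; they are stable
    -- under `D` by moving `D` to `f`. Hence they are all of `𝓛`.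
    let W : Submodule ℂ V :=
      { carrier := {a | ∀ f ∈ poleAlg (orbit 𝒟.ω S), tw (rho (a ⊗ₜ[ℂ] f)) ∈ R}
        zero_mem' := fun f _ => by simp
        add_mem' := fun {a b} ha hb f hf => by
          rw [TensorProduct.add_tmul, map_add, map_add]
          exact R.add_mem (ha f hf) (hb f hf)
        smul_mem' := fun r a ha f hf => by
          rw [← TensorProduct.smul_tmul', map_smul, map_smul]
          exact R.smul_mem r (ha f hf) }
    have hW : W = ⊤ := by
      apply eq_top_of_D_stable 𝒟.complement
      · intro a ha f hf
        have hy := 𝒟.sum_gammaAct_mem ha ⟨f, hf⟩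
        have h1 : toRat _ (∑ k ∈ Finset.range 𝒟.T, gammaAct 𝒟.ω 𝒟.σ S k
            (rho (a ⊗ₜ[ℂ] (⟨f, hf⟩ : poleAlg (orbit 𝒟.ω S))))) = 𝒟.avg (rho (a ⊗ₜ[ℂ] f)) := by
          rw [avg_apply, map_sum]
          refine Finset.sum_congr rfl fun k _ => ?_
          rw [toRat_gammaAct, toRat_rho]
        have h2 := hΛ _ hy
        rw [h1] at h2
        rw [htw, h2, zero_smul, sub_zero, ← h1]
        exact Submodule.subset_span ⟨_, hy, n, rfl⟩
      · intro f hf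
        have h1 : tw (rho (VertexLieAlgebra.c ⊗ₜ[ℂ] f)) = 0 := by
          rw [htw, avg_apply, map_sum, map_sum, Finset.sum_smul, LinearMap.sum_apply,
            ← Finset.sum_sub_distrib]
          refine Finset.sum_eq_zero fun k _ => ?_
          have h2 : act (rho (VertexLieAlgebra.c ⊗ₜ[ℂ] scaleRat (𝒟.ω ^ k)⁻¹ f)) =
              Λ (rho (VertexLieAlgebra.c ⊗ₜ[ℂ] scaleRat (𝒟.ω ^ k)⁻¹ f)) • 1 :=
            H1 _ (rotate 𝒟.ω S k ⟨f, hf⟩).2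
          rw [gam_rho, Rop_c, ← TensorProduct.smul_tmul', map_smul, map_smul, map_smul,
            LinearMap.smul_apply, h2, LinearMap.smul_apply, Module.End.one_apply, smul_assoc, ← smul_sub]
          rw [sub_self, smul_zero]
        rw [h1]
        exact R.zero_mem
      · intro w hw f hf
        rw [rho_D, map_neg]
        exact R.neg_mem (hw _ ⟨hf.1.ratDeriv, hf.2.ratDeriv⟩)
    have ha : a ∈ W := by rw [hW]; trivial
    exact ha f hf

end Coinvariants

end CycloData

/-! ### The vacuum module: level, smoothness, and generation by the invariants. -/

section Vacuum

variable {V : Type*} [AddCommGroup V] [Module ℂ V] [VertexLieAlgebra V]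

/-- The vacuum module is generated by the vacuum vector. -/
theorem Vac.induction {p : Vac V → Prop} (h0 : p 0) (h1 : p (vac V))
    (hadd : ∀ v w, p v → p w → p (v + w)) (hsmul : ∀ (r : ℂ) v, p v → p (r • v))
    (hlie : ∀ (y : LL V) v, p v → p ⁅y, v⁆) (v : Vac V) : p v := by
  obtain ⟨w, rfl⟩ := Submodule.Quotient.mk_surjective (vacIdeal V) v
  induction w using UEA.induction with
  | h0 => exact h0
  | h1 => exact h1
  | hadd x y hx hy => exact hadd _ _ hx hy
  | hsmul r x hx => exact hsmul r _ hx
  | hι y w hw => exact hlie y _ hw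

theorem lie_vac_of_mem_positivePart {y : LL V} (hy : y ∈ positivePart V) : ⁅y, vac V⁆ = 0 := by
  induction hy using Submodule.span_induction with
  | zero => simp
  | add x x' _ _ hx hx' => rw [add_lie, hx, hx', add_zero]
  | smul r x _ hx => rw [smul_lie, hx, smul_zero]
  | mem y hy =>
  obtain ⟨a, f, hf, rfl⟩ := hy
  refine (Submodule.Quotient.mk_eq_zero (vacIdeal V)).2 ?_
  change UniversalEnvelopingAlgebra.ι ℂ (rho (a ⊗ₜ[ℂ] f) : LL V) * 1 ∈ vacIdeal V
  rw [mul_one]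
  exact Submodule.subset_span (Or.inl ⟨a, f, hf, rfl⟩)

theorem vac_isLevelOne : IsLevelOne V (Vac V) := by
  intro v
  induction v using Vac.induction with
  | h0 => simp
  | h1 =>
    rw [← sub_eq_zero]
    refine (Submodule.Quotient.mk_eq_zero (vacIdeal V)).2 ?_
    change UniversalEnvelopingAlgebra.ι ℂ (cMinusOne V) * 1 - 1 ∈ vacIdeal V
    rw [mul_one]
    exact Submodule.subset_span (Or.inr rfl)
  | hadd v w hv hw => rw [lie_add, hv, hw]
  | hsmul r v hv => rw [lie_smul, hv]
  | hlie y v hv => rw [leibniz_lie, cMinusOne_lie, zero_lie, zero_add, hv]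

/-- The positive part kills `|0⟩`. Moving `a ⊗ f` past `b ⊗ g` leaves finitely many commutators
`a_(n) b ⊗ (∂ⁿf) g`, which have high order when `f` does. -/
theorem vac_isSmooth : IsSmooth V (Vac V) := by
  intro v
  induction v using Vac.induction with
  | h0 => exact fun a => ⟨0, fun f _ => by simp⟩
  | h1 =>
    exact fun a => ⟨0, fun f hf => lie_vac_of_mem_positivePart
      (rho_mem_positivePart a fun n hn => hf n (by simpa using hn))⟩
  | hadd v w hv hw =>
    intro a
    obtain ⟨N, hN⟩ := hv a
    obtain ⟨N', hN'⟩ := hw a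
    refine ⟨N + N', fun f hf => ?_⟩
    rw [lie_add, hN f fun n hn => hf n (by push_cast; omega),
      hN' f fun n hn => hf n (by push_cast; omega), add_zero]
  | hsmul r v hv =>
    intro a
    obtain ⟨N, hN⟩ := hv a
    exact ⟨N, fun f hf => by rw [lie_smul, hN f hf, smul_zero]⟩
  | hlie y v hv =>
    induction y using LieOf.induction with
    | h0 => exact fun a => ⟨0, fun f _ => by simp⟩
    | h2 x y hx hy =>
      intro a
      obtain ⟨N, hN⟩ := hx a
      obtain ⟨N', hN'⟩ := hy a
      refine ⟨N + N', fun f hf => ?_⟩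
      rw [add_lie, lie_add, hN f fun n hn => hf n (by push_cast; omega),
        hN' f fun n hn => hf n (by push_cast; omega), add_zero]
    | h1 b g =>
      intro a
      obtain ⟨K, hK⟩ := VertexLieAlgebra.locality a b
      obtain ⟨G, hG⟩ := laurent_coeff_eventually g
      choose N hN using hv
      obtain ⟨s, hs⟩ : ∃ s, ∀ n ∈ Finset.range K, N (prod n a b) ≤ s :=
        ⟨_, fun n hn => Finset.single_le_sum (f := fun n => N (prod n a b))
          (fun _ _ => Nat.zero_le _) hn⟩
      -- `K` absorbs the derivatives of `f`, `G` the pole of `g`, and `s` bounds the thresholds of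
      -- the finitely many vectors `a_(n) b`.
      refine ⟨N a + K + G + s, fun f hf => ?_⟩
      rw [leibniz_lie, hN a f fun n hn => hf n (by push_cast; omega), lie_zero, add_zero,
        lie_rho_tmul a b f g K hK, sum_lie]
      refine Finset.sum_eq_zero fun n hn => ?_
      have h1 := hs n hn
      rw [Finset.mem_range] at hn
      rw [smul_lie, hN, smul_zero]
      intro k hk
      refine mul_coeff_eq_zero _ _ _ _ (delta_pow_coeff_eq_zero f _ hf n) hG k ?_
      push_cast
      omega

variable (𝒟 : CycloData V) {u : ℂ} (hu : u ≠ 0)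

include hu in
/-- The vacuum module is generated by the vacuum vector over the invariants with poles in `Γ u`. -/
theorem CycloData.vac_induction {p : Vac V → Prop} (h0 : p 0) (h1 : p (vac V))
    (hadd : ∀ v w, p v → p w → p (v + w)) (hsmul : ∀ (r : ℂ) v, p v → p (r • v))
    (hlie : ∀ (h : 𝒟.inv {u}) v, p v → p ⁅𝒟.expandInv u h, v⁆) (v : Vac V) : p v := by
  let 𝒮 : Set (Submodule ℂ (Vac V)) :=
    {W | vac V ∈ W ∧ ∀ (h : 𝒟.inv {u}), ∀ v ∈ W, ⁅𝒟.expandInv u h, v⁆ ∈ W}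
  have hvac : vac V ∈ sInf 𝒮 := (Submodule.mem_sInf).2 fun W hW => hW.1
  have hst : ∀ (h : 𝒟.inv {u}), ∀ v ∈ sInf 𝒮, ⁅𝒟.expandInv u h, v⁆ ∈ sInf 𝒮 := fun h v hv =>
    (Submodule.mem_sInf).2 fun W hW => hW.2 h v ((Submodule.mem_sInf).1 hv W hW)
  -- The vectors that all of `L(𝓛)` sends into the smallest `H`-stable subspace containing `|0⟩`.
  -- This is itself such a subspace, since on `|0⟩` every `y` acts as the expansion of `𝒟.principal
  -- u y`. So the smallest one is stable under `L(𝓛)` and is everything.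
  let W : Submodule ℂ (Vac V) :=
    { carrier := {v | v ∈ sInf 𝒮 ∧ ∀ y : LL V, ⁅y, v⁆ ∈ sInf 𝒮}
      add_mem' := fun {v w} hv hw =>
        ⟨add_mem hv.1 hw.1, fun y => by rw [lie_add]; exact add_mem (hv.2 y) (hw.2 y)⟩
      zero_mem' := ⟨zero_mem _, fun y => by rw [lie_zero]; exact zero_mem _⟩
      smul_mem' := fun r v hv => ⟨Submodule.smul_mem _ r hv.1, fun y => by
        rw [lie_smul]; exact Submodule.smul_mem _ r (hv.2 y)⟩ }
  have hW : W ∈ 𝒮 := by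
    refine ⟨⟨hvac, fun y => ?_⟩, fun h v hv => ⟨hst h v hv.1, fun y => ?_⟩⟩
    · have h2 := lie_vac_of_mem_positivePart (𝒟.sub_expand_principal hu y)
      rw [sub_lie, sub_eq_zero] at h2
      rw [h2]
      exact hst _ _ hvac
    · rw [leibniz_lie]
      exact add_mem (hv.2 _) (hst h _ (hv.2 y))
  have hle : sInf 𝒮 ≤ W := sInf_le hW
  have hmem : v ∈ sInf 𝒮 := by
    induction v using Vac.induction with
    | h0 => exact zero_mem _
    | h1 => exact hvac
    | hadd v w hv hw => exact add_mem hv hw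
    | hsmul r v hv => exact Submodule.smul_mem _ r hv
    | hlie y v hv => exact (hle hv).2 y
  exact (Submodule.mem_sInf).1 hmem
    { carrier := {v | p v}
      add_mem' := fun {v w} hv hw => hadd v w hv hw
      zero_mem' := h0
      smul_mem' := hsmul } ⟨h1, hlie⟩

end Vacuum

/-! ### Actions on the tensor products by expansion at each point. -/

section Sites

attribute [local instance] LieRing.ofAssociativeRing

variable {V : Type*} [AddCommGroup V] [Module ℂ V] [VertexLieAlgebra V]
variable {ι : Type*} [Fintype ι] [DecidableEq ι]
variable (M : ι → Type*) [∀ i, AddCommGroup (M i)] [∀ i, Module ℂ (M i)]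
  [∀ i, LieRingModule (LL V) (M i)] [∀ i, LieModule ℂ (LL V) (M i)]

/-- The action of `L(𝓛)` on `⨂ᵢ Mᵢ` through the `i`-th factor. -/
def siteAct (i : ι) : LL V →ₗ⁅ℂ⁆ Module.End ℂ (⨂[ℂ] i, M i) where
  toFun y := PiTensorProduct.map (Function.update (fun j => (LinearMap.id : M j →ₗ[ℂ] M j)) i
    (LieModule.toEnd ℂ (LL V) (M i) y))
  map_add' x y := by rw [map_add, PiTensorProduct.map_update_add]
  map_smul' r x := by rw [map_smul, PiTensorProduct.map_update_smul, RingHom.id_apply]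
  map_lie' {x y} := by
    -- An operator on one factor is the image of `Pi.mulSingle` under a monoid homomorphism.
    -- Products come from this description, the difference in the commutator from multilinearity.
    have h : ∀ f : Module.End ℂ (M i), PiTensorProduct.map
        (Function.update (fun j => (LinearMap.id : M j →ₗ[ℂ] M j)) i f) =
        PiTensorProduct.mapMonoidHom (R := ℂ) (Pi.mulSingle i f) := fun f => rfl
    simp only [h]
    rw [Ring.lie_def, ← map_mul, ← map_mul, ← Pi.mulSingle_mul, ← Pi.mulSingle_mul, ← h, ← h, ← h,
      LieHom.map_lie, Ring.lie_def, eq_sub_iff_add_eq, ← PiTensorProduct.map_update_add,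
      sub_add_cancel]

theorem siteAct_apply (i : ι) (y : LL V) : siteAct M i y =
    PiTensorProduct.map (Function.update (fun j => (LinearMap.id : M j →ₗ[ℂ] M j)) i
      (LieModule.toEnd ℂ (LL V) (M i) y)) := rfl

theorem siteAct_tprod (i : ι) (y : LL V) (m : ∀ i, M i) : siteAct M i y (PiTensorProduct.tprod ℂ m) =
    PiTensorProduct.tprod ℂ (Function.update m i ⁅y, m i⁆) := by
  rw [siteAct_apply, PiTensorProduct.map_tprod]
  congr 1
  ext j
  by_cases h : j = i
  · subst h; simp
  · simp [Function.update_of_ne h]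

theorem siteAct_commute {i j : ι} (h : i ≠ j) (x y : LL V) :
    ⁅siteAct M i x, siteAct M j y⁆ = 0 := by
  rw [Ring.lie_def, sub_eq_zero]
  exact ((Pi.mulSingle_commute (f := fun i => Module.End ℂ (M i)) h
    (LieModule.toEnd ℂ (LL V) (M i) x) (LieModule.toEnd ℂ (LL V) (M j) y)).map
    (PiTensorProduct.mapMonoidHom (R := ℂ))).eq

theorem siteAct_cMinusOne (hM : ∀ i, IsLevelOne V (M i)) (i : ι) :
    siteAct M i (cMinusOne V) = 1 := by
  refine PiTensorProduct.ext (MultilinearMap.ext fun m => ?_)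
  change siteAct M i (cMinusOne V) (PiTensorProduct.tprod ℂ m) = PiTensorProduct.tprod ℂ m
  rw [siteAct_tprod, hM i, Function.update_eq_self]

theorem lie_sum_sum {A : Type*} [LieRing A] (a b : ι → A) (h : ∀ i j, i ≠ j → ⁅a i, b j⁆ = 0) :
    ⁅∑ i, a i, ∑ i, b i⁆ = ∑ i, ⁅a i, b i⁆ := by
  simp only [sum_lie, lie_sum]
  refine Finset.sum_congr rfl fun i _ => ?_
  rw [Finset.sum_eq_single i]
  · exact fun j _ hj => h _ _ hj
  · exact fun h => absurd (Finset.mem_univ i) h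

/-- The action of `Lie_{ℂ(t)} 𝓛` on `⨂ᵢ Mᵢ` by the Laurent expansions at the points `z i`. -/
def actT (z : ι → ℂ) : RatLie V →ₗ⁅ℂ⁆ Module.End ℂ (⨂[ℂ] i, M i) where
  toFun x := ∑ i, siteAct M i (expandRat (z i) x)
  map_add' x y := by simp only [map_add, Finset.sum_add_distrib]
  map_smul' r x := by simp only [map_smul, Finset.smul_sum, RingHom.id_apply]
  map_lie' {x y} := by
    rw [lie_sum_sum _ _ fun i j h => siteAct_commute M h (expandRat (z i) x) (expandRat (z j) y)]
    exact Finset.sum_congr rfl fun i _ =>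
      (congrArg _ (LieHom.map_lie _ x y)).trans (LieHom.map_lie _ _ _)

theorem actT_apply (z : ι → ℂ) (x : RatLie V) :
    actT M z x = ∑ i, siteAct M i (expandRat (z i) x) := rfl

theorem tensorAct_eq (P : Set ℂ) (z : ι → ℂ) (x : LieOf V (poleAlg P)) :
    tensorAct M P z x = actT M z (toRat P x) := by
  rw [actT_apply]
  refine Finset.sum_congr rfl fun i _ => ?_
  rw [siteAct_apply, expandAt_eq]

theorem actT_c (hM : ∀ i, IsLevelOne V (M i)) (z : ι → ℂ) (f : RatFunc ℂ) :
    actT M z (rho ((VertexLieAlgebra.c : V) ⊗ₜ[ℂ] f)) =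
      (∑ i, (laurentAt (z i) f).coeff (-1)) • (1 : Module.End ℂ (⨂[ℂ] i, M i)) := by
  rw [actT_apply, Finset.sum_smul]
  refine Finset.sum_congr rfl fun i _ => ?_
  rw [expandRat_rho, rho_c_laurent, map_smul, siteAct_cMinusOne M hM]

/-- The action of `Lie_{ℂ(t)} 𝓛` on `𝕍(𝓛) ⊗ ⨂ᵢ Mᵢ` by the Laurent expansions at `u` and the points
`z i`. -/
def vacAct (z : ι → ℂ) (u : ℂ) : RatLie V →ₗ[ℂ] Module.End ℂ (Vac V ⊗[ℂ] (⨂[ℂ] i, M i)) :=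
  LinearMap.rTensorHom _ ∘ₗ (LieModule.toEnd ℂ (LL V) (Vac V)).toLinearMap ∘ₗ
      (expandRat u).toLinearMap +
    LinearMap.lTensorHom _ ∘ₗ (actT M z).toLinearMap

theorem vacAct_tmul (z : ι → ℂ) (u : ℂ) (x : RatLie V) (v : Vac V) (m : ⨂[ℂ] i, M i) :
    vacAct M z u x (v ⊗ₜ[ℂ] m) = ⁅expandRat u x, v⁆ ⊗ₜ[ℂ] m + v ⊗ₜ[ℂ] actT M z x m := rfl

theorem vacAct_lie (z : ι → ℂ) (u : ℂ) (x y : RatLie V) (w : Vac V ⊗[ℂ] (⨂[ℂ] i, M i)) :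
    vacAct M z u ⁅x, y⁆ w =
      vacAct M z u x (vacAct M z u y w) - vacAct M z u y (vacAct M z u x w) := by
  induction w using TensorProduct.induction_on with
  | zero => simp
  | add w w' hw hw' => simp only [map_add, hw, hw']; abel
  | tmul v m =>
    simp only [vacAct_tmul, map_add, LieHom.map_lie, lie_lie, Ring.lie_def, LinearMap.sub_apply,
      Module.End.mul_apply, TensorProduct.sub_tmul, TensorProduct.tmul_sub]
    abel

theorem vacAct_c (hM : ∀ i, IsLevelOne V (M i)) (z : ι → ℂ) (u : ℂ) (f : RatFunc ℂ) :
    vacAct M z u (rho ((VertexLieAlgebra.c : V) ⊗ₜ[ℂ] f)) =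
      ((laurentAt u f).coeff (-1) + ∑ i, (laurentAt (z i) f).coeff (-1)) • 1 := by
  refine TensorProduct.ext' fun v m => ?_
  rw [vacAct_tmul, actT_c M hM, expandRat_rho, rho_c_laurent, smul_lie, vac_isLevelOne v, add_smul]
  simp [TensorProduct.smul_tmul']

end Sites

/-! ### The residue correction and the relations rewritten with it. -/

namespace CycloData

attribute [local instance] LieRing.ofAssociativeRing

variable {V : Type*} [AddCommGroup V] [Module ℂ V] [VertexLieAlgebra V] (𝒟 : CycloData V)

section Residues

variable {ι : Type*} {z : ι → ℂ}

theorem omega_pow_mul_inv (k : ℕ) :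
    ((𝒟.ω ^ (k * (𝒟.T - 1)) : ℂˣ) : ℂ) * ((𝒟.ω ^ k : ℂˣ) : ℂ) = 1 := by
  have : k * (𝒟.T - 1) + k = 𝒟.T * k := by
    obtain ⟨t, ht⟩ : ∃ t, 𝒟.T = t + 1 := ⟨𝒟.T - 1, by have := 𝒟.T_pos; omega⟩
    rw [ht]; simp; ring
  rw [← Units.val_mul, ← pow_add, this, pow_mul, 𝒟.prim.pow_eq_one, one_pow, Units.val_one]

theorem ne_of_notMem_orbit {u : ℂ} (hu : u ∉ orbit 𝒟.ω (Set.range z) ∪ {0}) (k : ℕ) (i : ι) :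
    ((𝒟.ω ^ k : ℂˣ) : ℂ) * u ≠ z i := by
  intro h
  refine hu (Or.inl ⟨k * (𝒟.T - 1), z i, ⟨i, rfl⟩, ?_⟩)
  rw [← h, ← mul_assoc, 𝒟.omega_pow_mul_inv, one_mul]

theorem ne_zero_of_notMem {u : ℂ} {S : Set ℂ} (hu : u ∉ S ∪ {0}) : u ≠ 0 :=
  fun h => hu (Or.inr h)

theorem Distinct.option (hz : 𝒟.Distinct z) {u : ℂ} (hu : u ∉ orbit 𝒟.ω (Set.range z) ∪ {0}) :
    𝒟.Distinct fun o : Option ι => o.elim u z := by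
  refine ⟨fun o => ?_, fun o o' hne k => ?_⟩
  · cases o with
    | none => exact ne_zero_of_notMem hu
    | some i => exact hz.1 i
  · cases o with
    | none =>
      cases o' with
      | none => exact absurd rfl hne
      | some j => exact fun h => hu (Or.inl ⟨k, z j, ⟨j, rfl⟩, h⟩)
    | some i =>
      cases o' with
      | none => exact (𝒟.ne_of_notMem_orbit hu k i).symm
      | some j => exact hz.2 i j (fun h => hne (congrArg some h)) k

theorem range_option (u : ℂ) : (Set.range fun o : Option ι => o.elim u z) =
    insert u (Set.range z) := by
  ext x
  constructor
  · rintro ⟨o, rfl⟩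
    cases o with
    | none => exact Or.inl rfl
    | some i => exact Or.inr ⟨i, rfl⟩
  · rintro (rfl | ⟨i, rfl⟩)
    · exact ⟨none, rfl⟩
    · exact ⟨some i, rfl⟩

theorem kres_of_mem_positivePart {y : LL V} (hy : y ∈ positivePart V) : 𝒟.kres y = 0 := by
  have : positivePart V ≤ LinearMap.ker 𝒟.kres := by
    refine Submodule.span_le.2 ?_
    rintro _ ⟨a, f, hf, rfl⟩
    change 𝒟.kres (rho (a ⊗ₜ[ℂ] f)) = 0
    rw [kres_rho, hf _ (by norm_num), mul_zero]
  exact this hy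

theorem resAt_principal {u : ℂ} (hu : u ≠ 0) (y : LL V) :
    𝒟.resAt u (𝒟.principal u y : 𝒟.inv {u}) = 𝒟.kres y := by
  have h := 𝒟.kres_of_mem_positivePart (𝒟.sub_expand_principal hu y)
  rw [map_sub, sub_eq_zero] at h
  exact h.symm

theorem resAt_inv_lie {u : ℂ} (hu : u ≠ 0) {x y : RatLie V} (hx : x ∈ 𝒟.inv {u})
    (hy : y ∈ 𝒟.inv {u}) : 𝒟.resAt u ⁅x, y⁆ = 0 := by
  have hr : ({u} : Set ℂ) = Set.range fun _ : Unit => u := Set.range_const.symm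
  rw [hr] at hx hy
  have h := 𝒟.sum_resAt_inv_lie (z := fun _ : Unit => u)
    ⟨fun _ => hu, fun i j hij => absurd (Subsingleton.elim i j) hij⟩ hx hy
  simpa using h

theorem expandRat_mem_of_notMem_orbit {S : Set ℂ} {q : ℂ} (hq : q ∉ orbit 𝒟.ω S) {x : RatLie V}
    (hx : x ∈ 𝒟.inv S) : expandRat q x ∈ positivePart V :=
  expandRat_mem_positivePart hq (𝒟.mem_withPoles_of_mem_inv hx)

theorem notMem_orbit_singleton {u : ℂ} (hu : u ∉ orbit 𝒟.ω (Set.range z) ∪ {0}) (i : ι) :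
    z i ∉ orbit 𝒟.ω {u} := by
  rintro ⟨k, _, rfl, h⟩
  exact 𝒟.ne_of_notMem_orbit hu k i h.symm

variable [Fintype ι]

/-- The sum of the `c`-residues at the points `z i`. -/
def sumRes (z : ι → ℂ) : RatLie V →ₗ[ℂ] ℂ := ∑ i, 𝒟.resAt (z i)

theorem sumRes_apply (z : ι → ℂ) (x : RatLie V) : 𝒟.sumRes z x = ∑ i, 𝒟.resAt (z i) x := by
  rw [sumRes, LinearMap.sum_apply]

theorem sumRes_c (z : ι → ℂ) (f : RatFunc ℂ) :
    𝒟.sumRes z (rho (VertexLieAlgebra.c ⊗ₜ[ℂ] f)) = ∑ i, (laurentAt (z i) f).coeff (-1) := by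
  simp only [sumRes_apply, resAt_rho, 𝒟.κ_c, one_mul]

theorem sumRes_Lo (z : ι → ℂ) {a : V} (ha : a ∈ 𝒟.Lo) (f : RatFunc ℂ) :
    𝒟.sumRes z (rho (a ⊗ₜ[ℂ] f)) = 0 := by
  simp only [sumRes_apply, resAt_rho, 𝒟.κ_Lo a ha, zero_mul, Finset.sum_const_zero]

theorem sumRes_option (z : ι → ℂ) (u : ℂ) (x : RatLie V) :
    𝒟.sumRes (fun o : Option ι => o.elim u z) x = 𝒟.resAt u x + 𝒟.sumRes z x := by
  rw [sumRes_apply, sumRes_apply, Fintype.sum_option]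
  rfl

/-- Among the poles `α z i₀` only `α = 1` is one of the points `z i`. All the central sums thus have
the same value, and the correction vanishes on their differences. -/
theorem sumRes_centralSum (hz : 𝒟.Distinct z) {S : Set ℂ} (hS : S = Set.range z) (s : S) :
    𝒟.sumRes z (toRat _ (centralSum V 𝒟.ω 𝒟.T S s)) = 1 := by
  subst hS
  obtain ⟨_, i₀, rfl⟩ := s
  have h1 : ∀ k ∈ Finset.range 𝒟.T, ∀ hp, 𝒟.sumRes z (toRat _ (rho (VertexLieAlgebra.c ⊗ₜ[ℂ]
      simplePole (orbit 𝒟.ω (Set.range z)) (((𝒟.ω ^ k : ℂˣ) : ℂ) * z i₀) hp))) =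
      if k = 0 then 1 else 0 := by
    intro k hk hp
    rw [toRat_rho, simplePole_coe, sumRes_c]
    simp only [coeff_polePow, and_true]
    rw [Finset.sum_eq_single i₀]
    · congr 1
      refine propext ⟨fun h => 𝒟.mul_eq_self (hz.1 i₀) (Finset.mem_range.1 hk) h, fun h => ?_⟩
      rw [h]; simp
    · intro j _ hj
      rw [if_neg]
      exact fun h => hz.2 j i₀ hj k h.symm
    · exact fun h => absurd (Finset.mem_univ _) h
  rw [centralSum, map_sum, map_sum]
  refine (Finset.sum_congr rfl fun k hk => h1 k hk _).trans ?_
  rw [Finset.sum_ite_eq' (Finset.range 𝒟.T) 0, if_pos (Finset.mem_range.2 𝒟.T_pos)]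

end Residues

section TwistedActions

variable {ι : Type*} [Fintype ι] [DecidableEq ι] {z : ι → ℂ} (hz : 𝒟.Distinct z)
variable (M : ι → Type*) [∀ i, AddCommGroup (M i)] [∀ i, Module ℂ (M i)]
  [∀ i, LieRingModule (LL V) (M i)] [∀ i, LieModule ℂ (LL V) (M i)]
  (hM : ∀ i, IsLevelOne V (M i))

include hz hM

theorem coinvRel_eq : coinvRel M 𝒟.ω 𝒟.T 𝒟.σ 𝒟.Lo z =
    Submodule.span ℂ {w | ∃ x ∈ 𝒟.inv (Set.range z), ∃ m : ⨂[ℂ] i, M i,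
      w = actT M z x m - 𝒟.sumRes z x • m} := by
  rw [coinvRel]
  simp only [tensorAct_eq]
  exact 𝒟.span_cycloGlobal (actT M z).toLinearMap (𝒟.sumRes z)
    (fun f _ => by rw [sumRes_c]; exact actT_c M hM z f)
    (fun a ha f _ => 𝒟.sumRes_Lo z ha f) (𝒟.sumRes_centralSum hz rfl)

theorem vacCoinvRel_eq {u : ℂ} (hu : u ∉ orbit 𝒟.ω (Set.range z) ∪ {0}) :
    vacCoinvRel M 𝒟.ω 𝒟.T 𝒟.σ 𝒟.Lo z u =
      Submodule.span ℂ {w | ∃ x ∈ 𝒟.inv (insert u (Set.range z)), ∃ m : Vac V ⊗[ℂ] (⨂[ℂ] i, M i),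
        w = vacAct M z u x m - (𝒟.resAt u x + 𝒟.sumRes z x) • m} := by
  rw [vacCoinvRel]
  simp only [tensorAct_eq, expandAt_eq, ← sumRes_option]
  refine 𝒟.span_cycloGlobal (vacAct M z u)
    (𝒟.sumRes fun o : Option ι => o.elim u z) (fun f _ => ?_)
    (fun a ha f _ => 𝒟.sumRes_Lo _ ha f)
    (𝒟.sumRes_centralSum (hz.option 𝒟 hu) (range_option u).symm)
  rw [vacAct_c M hM, sumRes_c, Fintype.sum_option]
  rfl

end TwistedActions

/-! ### Eliminating the vacuum module: construction of `reduce`. -/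

section Vacuum

variable {ι : Type*} [Fintype ι] [DecidableEq ι] (z : ι → ℂ)
variable (M : ι → Type*) [∀ i, AddCommGroup (M i)] [∀ i, Module ℂ (M i)]
  [∀ i, LieRingModule (LL V) (M i)] [∀ i, LieModule ℂ (LL V) (M i)]
variable {u : ℂ} (hu : u ∉ orbit 𝒟.ω (Set.range z) ∪ {0})

theorem lie_sub_smul_one {A : Type*} [Ring A] [Algebra ℂ A] (a b : A) (r s : ℂ) :
    ⁅a - r • 1, b - s • 1⁆ = ⁅a, b⁆ := by
  simp only [Ring.lie_def, sub_mul, mul_sub, smul_mul_assoc, mul_smul_comm, one_mul, mul_one]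
  rw [smul_sub, smul_sub, smul_comm r s]
  abel

/-- The linear map underlying `twisted`. -/
def twistedLin (u : ℂ) : RatLie V →ₗ[ℂ] Module.End ℂ (⨂[ℂ] i, M i) :=
  (actT M z).toLinearMap - (𝒟.resAt u).smulRight (1 : Module.End ℂ (⨂[ℂ] i, M i))

theorem twistedLin_apply (u : ℂ) (x : RatLie V) :
    𝒟.twistedLin z M u x = actT M z x - 𝒟.resAt u x • 1 := rfl

/-- The action of the invariants with poles in `Γ u` on `⨂ᵢ Mᵢ`, corrected by the residue at `u`. -/
def twisted : 𝒟.inv {u} →ₗ⁅ℂ⁆ Module.End ℂ (⨂[ℂ] i, M i) :=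
  { 𝒟.twistedLin z M u ∘ₗ (𝒟.inv {u}).toSubmodule.subtype with
    map_lie' := fun {x y} => by
      change 𝒟.twistedLin z M u ⁅(x : RatLie V), (y : RatLie V)⁆ =
        ⁅𝒟.twistedLin z M u (x : RatLie V), 𝒟.twistedLin z M u (y : RatLie V)⁆
      -- The scalar correction drops out of the commutator, and the residue at `u` of a bracket of
      -- elements of `H` vanishes.
      rw [twistedLin_apply, twistedLin_apply, twistedLin_apply,
        𝒟.resAt_inv_lie (ne_zero_of_notMem hu) x.2 y.2, zero_smul, sub_zero, LieHom.map_lie,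
        lie_sub_smul_one] }

theorem twisted_apply (h : 𝒟.inv {u}) : 𝒟.twisted z M hu h =
    actT M z (h : RatLie V) - 𝒟.resAt u (h : RatLie V) • 1 := rfl

theorem principal_cMinusOne : ((𝒟.principal u (cMinusOne V) : 𝒟.inv {u}) : RatLie V) =
    𝒟.avg (rho (VertexLieAlgebra.c ⊗ₜ[ℂ] polePow u 0)) := by
  rw [principal_coe, cMinusOne, prinMap_rho]
  have := prin_single u 0
  simp only [Nat.cast_zero, zero_add] at this
  rw [this]

/-- The invariant of `c(-1)` is `∑ c/(t - αu)`. It has no residue at the `z i`, so it acts by zero,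
and the correction by its residue `1` at `u` leaves `-1`. -/
theorem twisted_cMinusOne (hM : ∀ i, IsLevelOne V (M i)) :
    𝒟.twisted z M hu (𝒟.principal u (cMinusOne V)) = -1 := by
  have h1 : 𝒟.kres (cMinusOne V) = 1 := by
    rw [cMinusOne, kres_rho, 𝒟.κ_c, HahnSeries.coeff_single_same, mul_one]
  rw [twisted_apply, 𝒟.resAt_principal (ne_zero_of_notMem hu), h1, one_smul, principal_cMinusOne,
    avg_apply, map_sum, Finset.sum_eq_zero, zero_sub]
  intro k _
  rw [gam_polePow, Rop_c, map_smul, actT_c M hM, Finset.sum_eq_zero, zero_smul, smul_zero]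
  intro i _
  rw [coeff_polePow, if_neg]
  exact fun h => 𝒟.ne_of_notMem_orbit hu k i h.1

/-- The map `U(L(𝓛)) → End(⨂ᵢ Mᵢ)` with `1 ↦ 1` and `h w ↦ -(w ↦ ·) τ(h)` for invariants `h`. -/
def univReduce : Uc (LL V) →ₗ[ℂ] Module.End ℂ (⨂[ℂ] i, M i) :=
  matchedMap (𝒟.expandInv u) (𝒟.principal u) (𝒟.principal_expandInv (ne_zero_of_notMem hu))
    (𝒟.principal_lie (ne_zero_of_notMem hu)) (𝒟.twisted z M hu)

variable (hM : ∀ i, IsLevelOne V (M i))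

include hM in
-- The generators from `ℂ[[t]]` lie in the kernel of `principal`; the generator `c(-1) - 1` is
-- killed because `c(-1)` is central and its invariant acts by `-1`.
theorem univReduce_vacIdeal (w : Uc (LL V)) (hw : w ∈ vacIdeal V) :
    𝒟.univReduce z M hu w = 0 := by
  -- The arbitrary left factor is what lets the induction run over a left ideal.
  have : ∀ w' : Uc (LL V), 𝒟.univReduce z M hu (w' * w) = 0 := by
    induction hw using Submodule.span_induction with
    | zero => simp
    | add x y _ _ hx hy => intro w'; rw [mul_add, map_add, hx, hy, add_zero]
    | smul r x _ hx => intro w'; rw [smul_eq_mul, ← mul_assoc, hx]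
    | mem x hx =>
      intro w'
      rcases hx with ⟨a, f, hf, rfl⟩ | hx
      · exact matchedMap_mul_ker _ _ _ _ _ _
          (𝒟.principal_of_mem_positivePart u (rho_mem_positivePart a hf)) _
      · rw [Set.mem_singleton_iff] at hx
        rw [hx, mul_sub, map_sub, mul_one, sub_eq_zero]
        exact matchedMap_mul_central _ _ _ _ _ _ cMinusOne_lie (𝒟.twisted_cMinusOne z M hu hM) _
  simpa using this 1

/-- The map `𝕍(𝓛) → End(⨂ᵢ Mᵢ)` by which the vacuum module at `u` is eliminated. -/
def reduceEnd : Vac V →ₗ[ℂ] Module.End ℂ (⨂[ℂ] i, M i) where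
  -- The quotient is by a `U(L)`-submodule while the map is only `ℂ`-linear, so it descends as a
  -- function first.
  toFun := Quotient.lift (𝒟.univReduce z M hu) (by
    intro a b hab
    have h := (Submodule.quotientRel_def (vacIdeal V)).1 hab
    have := 𝒟.univReduce_vacIdeal z M hu hM _ h
    rwa [map_sub, sub_eq_zero] at this)
  map_add' v w := by
    obtain ⟨v, rfl⟩ := Submodule.Quotient.mk_surjective (vacIdeal V) v
    obtain ⟨w, rfl⟩ := Submodule.Quotient.mk_surjective (vacIdeal V) w
    exact map_add (𝒟.univReduce z M hu) v w
  map_smul' r v := by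
    obtain ⟨v, rfl⟩ := Submodule.Quotient.mk_surjective (vacIdeal V) v
    exact map_smul (𝒟.univReduce z M hu) r v

theorem reduceEnd_vac : 𝒟.reduceEnd z M hu hM (vac V) = 1 := matchedMap_one _ _ _ _ _

theorem reduceEnd_lie (h : 𝒟.inv {u}) (v : Vac V) :
    𝒟.reduceEnd z M hu hM ⁅𝒟.expandInv u h, v⁆ =
      -(𝒟.reduceEnd z M hu hM v * 𝒟.twisted z M hu h) := by
  obtain ⟨w, rfl⟩ := Submodule.Quotient.mk_surjective (vacIdeal V) v
  exact matchedMap_e_mul _ _ _ _ _ h w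

/-- The map `𝕍(𝓛) ⊗ ⨂ᵢ Mᵢ → ⨂ᵢ Mᵢ` by which the vacuum module at `u` is eliminated. -/
def reduce : Vac V ⊗[ℂ] (⨂[ℂ] i, M i) →ₗ[ℂ] ⨂[ℂ] i, M i :=
  TensorProduct.lift (𝒟.reduceEnd z M hu hM)

theorem reduce_tmul (v : Vac V) (m : ⨂[ℂ] i, M i) :
    𝒟.reduce z M hu hM (v ⊗ₜ[ℂ] m) = 𝒟.reduceEnd z M hu hM v m := rfl

theorem reduce_vac (m : ⨂[ℂ] i, M i) : 𝒟.reduce z M hu hM (vac V ⊗ₜ[ℂ] m) = m := by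
  rw [reduce_tmul, reduceEnd_vac, Module.End.one_apply]

theorem reduce_lie (h : 𝒟.inv {u}) (v : Vac V) (m : ⨂[ℂ] i, M i) :
    𝒟.reduce z M hu hM (⁅𝒟.expandInv u h, v⁆ ⊗ₜ[ℂ] m) =
      -𝒟.reduce z M hu hM (v ⊗ₜ[ℂ] 𝒟.twisted z M hu h m) := by
  rw [reduce_tmul, reduceEnd_lie, reduce_tmul]
  rfl

end Vacuum

end CycloData

/-! ### The isomorphism of coinvariants and its naturality. -/

namespace CycloData

section Isomorphism

variable {V : Type*} [AddCommGroup V] [Module ℂ V] [VertexLieAlgebra V] (𝒟 : CycloData V)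
variable {ι : Type*} [Fintype ι] [DecidableEq ι] {z : ι → ℂ} (hz : 𝒟.Distinct z)
variable (M : ι → Type*) [∀ i, AddCommGroup (M i)] [∀ i, Module ℂ (M i)]
  [∀ i, LieRingModule (LL V) (M i)] [∀ i, LieModule ℂ (LL V) (M i)]
variable {u : ℂ} (hu : u ∉ orbit 𝒟.ω (Set.range z) ∪ {0}) (hM : ∀ i, IsLevelOne V (M i))

/-- The action `vacAct`, corrected by the residues in such a way that `c ⊗ A` acts by zero. -/
def star (z : ι → ℂ) (u : ℂ) (x : RatLie V) : Module.End ℂ (Vac V ⊗[ℂ] (⨂[ℂ] i, M i)) :=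
  vacAct M z u x - (𝒟.resAt u x + 𝒟.sumRes z x) • 1

theorem star_apply (z : ι → ℂ) (u : ℂ) (x : RatLie V) (w : Vac V ⊗[ℂ] (⨂[ℂ] i, M i)) :
    𝒟.star M z u x w = vacAct M z u x w - (𝒟.resAt u x + 𝒟.sumRes z x) • w := rfl

theorem star_add (z : ι → ℂ) (u : ℂ) (x y : RatLie V) :
    𝒟.star M z u (x + y) = 𝒟.star M z u x + 𝒟.star M z u y := by
  rw [star, star, star, map_add, map_add, map_add, add_add_add_comm, add_smul, add_sub_add_comm]

include hz hu in
-- The corrected action is a representation on invariants because the residues of a bracket sum to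
-- zero.
theorem star_star {x y : RatLie V} (hx : x ∈ 𝒟.inv (insert u (Set.range z)))
    (hy : y ∈ 𝒟.inv (insert u (Set.range z))) (w : Vac V ⊗[ℂ] (⨂[ℂ] i, M i)) :
    𝒟.star M z u x (𝒟.star M z u y w) =
      𝒟.star M z u y (𝒟.star M z u x w) + 𝒟.star M z u ⁅x, y⁆ w := by
  have h : 𝒟.resAt u ⁅x, y⁆ + 𝒟.sumRes z ⁅x, y⁆ = 0 := by
    rw [← range_option] at hx hy
    rw [← sumRes_option, sumRes_apply]
    exact 𝒟.sum_resAt_inv_lie (hz.option 𝒟 hu) hx hy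
  simp only [star_apply, h, zero_smul, sub_zero, vacAct_lie, map_sub, map_smul, smul_sub]
  rw [smul_comm (𝒟.resAt u x + 𝒟.sumRes z x)]
  abel

include hu in
theorem sumRes_inv_singleton {h : RatLie V} (hh : h ∈ 𝒟.inv {u}) : 𝒟.sumRes z h = 0 := by
  rw [sumRes_apply]
  exact Finset.sum_eq_zero fun i _ => 𝒟.kres_of_mem_positivePart
    (𝒟.expandRat_mem_of_notMem_orbit (𝒟.notMem_orbit_singleton hu i) hh)

/-- Elements with poles in `Γu` are regular at the `z i`, so the whole correction is the residue at
`u`, which is the one built into `twisted`. -/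
theorem star_inv_singleton (h : 𝒟.inv {u}) (v : Vac V) (m : ⨂[ℂ] i, M i) :
    𝒟.star M z u (h : RatLie V) (v ⊗ₜ[ℂ] m) =
      ⁅𝒟.expandInv u h, v⁆ ⊗ₜ[ℂ] m + v ⊗ₜ[ℂ] 𝒟.twisted z M hu h m := by
  rw [star_apply, 𝒟.sumRes_inv_singleton hu h.2, add_zero, vacAct_tmul, twisted_apply,
    expandInv_apply, LinearMap.sub_apply, LinearMap.smul_apply, Module.End.one_apply,
    TensorProduct.tmul_sub, TensorProduct.tmul_smul, add_sub_assoc]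

/-- Elements with poles in `Γz` are regular at `u`; they kill the vacuum vector and have no residue
there. -/
theorem star_vac {y : RatLie V} (hy : y ∈ 𝒟.inv (Set.range z)) (m : ⨂[ℂ] i, M i)
    (hu : u ∉ orbit 𝒟.ω (Set.range z) ∪ {0}) : 𝒟.star M z u y (vac V ⊗ₜ[ℂ] m) =
      vac V ⊗ₜ[ℂ] (actT M z y m - 𝒟.sumRes z y • m) := by
  have h1 := 𝒟.expandRat_mem_of_notMem_orbit (fun h => hu (Or.inl h)) hy
  have h2 : 𝒟.resAt u y = 0 := 𝒟.kres_of_mem_positivePart h1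
  rw [star_apply, vacAct_tmul, lie_vac_of_mem_positivePart h1, h2, TensorProduct.zero_tmul, zero_add,
    zero_add, TensorProduct.tmul_sub, TensorProduct.tmul_smul]

theorem reduce_star_inv_singleton {h : RatLie V} (hh : h ∈ 𝒟.inv {u})
    (w : Vac V ⊗[ℂ] (⨂[ℂ] i, M i)) : 𝒟.reduce z M hu hM (𝒟.star M z u h w) = 0 := by
  induction w using TensorProduct.induction_on with
  | zero => simp
  | add w w' hw hw' => rw [map_add, map_add, hw, hw', add_zero]
  | tmul v m =>
    rw [𝒟.star_inv_singleton M hu ⟨h, hh⟩, map_add, reduce_lie, neg_add_cancel]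

include hz

theorem actT_sub_mem_coinvRel {y : RatLie V} (hy : y ∈ 𝒟.inv (Set.range z)) (m : ⨂[ℂ] i, M i)
    (hM : ∀ i, IsLevelOne V (M i)) :
    actT M z y m - 𝒟.sumRes z y • m ∈ coinvRel M 𝒟.ω 𝒟.T 𝒟.σ 𝒟.Lo z := by
  rw [𝒟.coinvRel_eq hz M hM]
  exact Submodule.subset_span ⟨y, hy, m, rfl⟩

theorem star_mem_vacCoinvRel {x : RatLie V} (hx : x ∈ 𝒟.inv (insert u (Set.range z)))
    (w : Vac V ⊗[ℂ] (⨂[ℂ] i, M i)) (hM : ∀ i, IsLevelOne V (M i))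
    (hu : u ∉ orbit 𝒟.ω (Set.range z) ∪ {0}) :
    𝒟.star M z u x w ∈ vacCoinvRel M 𝒟.ω 𝒟.T 𝒟.σ 𝒟.Lo z u := by
  rw [𝒟.vacCoinvRel_eq hz M hM hu]
  exact Submodule.subset_span ⟨x, hx, w, rfl⟩

/-- Induction along `𝕍 = U(H)|0⟩`. On `|0⟩`, split `x` by its poles: the part in `H` reduces to zero
and the rest gives a relation at the `z i`. The invariant `x` must vary in the induction because the
inductive step replaces it by `⁅x, h⁆`. -/
theorem reduce_star_tmul_mem (v : Vac V) : ∀ x ∈ 𝒟.inv (insert u (Set.range z)),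
    ∀ m : ⨂[ℂ] i, M i, 𝒟.reduce z M hu hM (𝒟.star M z u x (v ⊗ₜ[ℂ] m)) ∈
      coinvRel M 𝒟.ω 𝒟.T 𝒟.σ 𝒟.Lo z := by
  induction v using 𝒟.vac_induction (ne_zero_of_notMem hu) with
  | h0 => intro x _ m; simp
  | h1 =>
    intro x hx m
    rw [← Set.singleton_union] at hx
    obtain ⟨h, hh, y, hy, rfl⟩ := 𝒟.exists_add_of_mem_inv_union hx
    rw [star_add, LinearMap.add_apply, map_add, reduce_star_inv_singleton _ _ _ _ hh, zero_add,
      𝒟.star_vac M hy m hu, reduce_vac]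
    exact 𝒟.actT_sub_mem_coinvRel hz M hy m hM
  | hadd v w hv hw =>
    intro x hx m
    rw [TensorProduct.add_tmul, map_add, map_add]
    exact Submodule.add_mem _ (hv x hx m) (hw x hx m)
  | hsmul r v hv =>
    intro x hx m
    rw [← TensorProduct.smul_tmul', map_smul, map_smul]
    exact Submodule.smul_mem _ r (hv x hx m)
  | hlie h v hv =>
    intro x hx m
    have hh : (h : RatLie V) ∈ 𝒟.inv (insert u (Set.range z)) :=
      𝒟.inv_mono (by rw [Set.singleton_subset_iff]; exact Set.mem_insert _ _) h.2
    have h1 := 𝒟.star_inv_singleton M hu h v m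
    rw [eq_comm, ← eq_sub_iff_add_eq] at h1
    -- After commuting `x` past `h`, the term with `h` on the outside reduces to zero, and the other
    -- two have the shorter vector `v`.
    rw [h1, map_sub, 𝒟.star_star hz M hu hx hh, map_sub, map_add,
      reduce_star_inv_singleton _ _ _ _ h.2, zero_add]
    exact Submodule.sub_mem _ (hv _ ((𝒟.inv _).lie_mem hx hh) m) (hv x hx _)

theorem vacCoinvRel_le_comap_reduce : vacCoinvRel M 𝒟.ω 𝒟.T 𝒟.σ 𝒟.Lo z u ≤
    (coinvRel M 𝒟.ω 𝒟.T 𝒟.σ 𝒟.Lo z).comap (𝒟.reduce z M hu hM) := by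
  rw [𝒟.vacCoinvRel_eq hz M hM hu]
  refine Submodule.span_le.2 ?_
  rintro _ ⟨x, hx, w, rfl⟩
  change 𝒟.reduce z M hu hM (𝒟.star M z u x w) ∈ coinvRel M 𝒟.ω 𝒟.T 𝒟.σ 𝒟.Lo z
  induction w using TensorProduct.induction_on with
  | zero => simp
  | add w w' hw hw' => rw [map_add, map_add]; exact Submodule.add_mem _ hw hw'
  | tmul v m => exact 𝒟.reduce_star_tmul_mem hz M hu hM v x hx m

theorem coinvRel_le_comap_vac (hM : ∀ i, IsLevelOne V (M i))
    (hu : u ∉ orbit 𝒟.ω (Set.range z) ∪ {0}) : coinvRel M 𝒟.ω 𝒟.T 𝒟.σ 𝒟.Lo z ≤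
      (vacCoinvRel M 𝒟.ω 𝒟.T 𝒟.σ 𝒟.Lo z u).comap (TensorProduct.mk ℂ _ _ (vac V)) := by
  rw [𝒟.coinvRel_eq hz M hM]
  refine Submodule.span_le.2 ?_
  rintro _ ⟨y, hy, m, rfl⟩
  change vac V ⊗ₜ[ℂ] (actT M z y m - 𝒟.sumRes z y • m) ∈ vacCoinvRel M 𝒟.ω 𝒟.T 𝒟.σ 𝒟.Lo z u
  rw [← 𝒟.star_vac M hy m hu]
  exact 𝒟.star_mem_vacCoinvRel hz M (𝒟.inv_mono (Set.subset_insert _ _) hy) _ hM hu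

/-- Modulo the relations, a factor `h` on `v` can be moved to `m` with a sign. The map `reduce` does
exactly this, one factor at a time. -/
theorem tmul_sub_mem_vacCoinvRel (v : Vac V) : ∀ m : ⨂[ℂ] i, M i,
    v ⊗ₜ[ℂ] m - vac V ⊗ₜ[ℂ] 𝒟.reduce z M hu hM (v ⊗ₜ[ℂ] m) ∈
      vacCoinvRel M 𝒟.ω 𝒟.T 𝒟.σ 𝒟.Lo z u := by
  induction v using 𝒟.vac_induction (ne_zero_of_notMem hu) with
  | h0 => intro m; simp
  | h1 => intro m; rw [reduce_vac, sub_self]; exact Submodule.zero_mem _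
  | hadd v w hv hw =>
    intro m
    rw [TensorProduct.add_tmul, map_add, TensorProduct.tmul_add, add_sub_add_comm]
    exact Submodule.add_mem _ (hv m) (hw m)
  | hsmul r v hv =>
    intro m
    rw [← TensorProduct.smul_tmul', map_smul, TensorProduct.tmul_smul, ← smul_sub]
    exact Submodule.smul_mem _ r (hv m)
  | hlie h v hv =>
    intro m
    have hh : (h : RatLie V) ∈ 𝒟.inv (insert u (Set.range z)) :=
      𝒟.inv_mono (by rw [Set.singleton_subset_iff]; exact Set.mem_insert _ _) h.2
    have h1 := 𝒟.star_inv_singleton M hu h v m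
    rw [eq_comm, ← eq_sub_iff_add_eq] at h1
    rw [reduce_lie, h1, TensorProduct.tmul_neg, sub_neg_eq_add, sub_add]
    exact Submodule.sub_mem _ (𝒟.star_mem_vacCoinvRel hz M hh _ hM hu) (hv _)

/-- The isomorphism between the coinvariants with and without the vacuum module at `u`. -/
def coinvEquiv : VacCoinv M 𝒟.ω 𝒟.T 𝒟.σ 𝒟.Lo z u ≃ₗ[ℂ] Coinv M 𝒟.ω 𝒟.T 𝒟.σ 𝒟.Lo z :=
  LinearEquiv.ofLinearMap
    (Submodule.mapQ _ _ (𝒟.reduce z M hu hM) (𝒟.vacCoinvRel_le_comap_reduce hz M hu hM))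
    (Submodule.mapQ _ _ (TensorProduct.mk ℂ _ _ (vac V)) (𝒟.coinvRel_le_comap_vac hz M hM hu))
    (by
      refine Submodule.linearMap_qext _ (LinearMap.ext fun m => ?_)
      change Submodule.Quotient.mk (𝒟.reduce z M hu hM (vac V ⊗ₜ[ℂ] m)) = Submodule.Quotient.mk m
      rw [reduce_vac])
    (by
      refine Submodule.linearMap_qext _ (TensorProduct.ext' fun v m => ?_)
      change Submodule.Quotient.mk (vac V ⊗ₜ[ℂ] 𝒟.reduce z M hu hM (v ⊗ₜ[ℂ] m)) =
        Submodule.Quotient.mk (v ⊗ₜ[ℂ] m)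
      exact ((Submodule.Quotient.eq _).2 (𝒟.tmul_sub_mem_vacCoinvRel hz M hu hM v m)).symm)

theorem coinvEquiv_mk (w : Vac V ⊗[ℂ] (⨂[ℂ] i, M i)) :
    𝒟.coinvEquiv hz M hu hM (Submodule.Quotient.mk w) =
      Submodule.Quotient.mk (𝒟.reduce z M hu hM w) := rfl

end Isomorphism

/-! ### Naturality of the reduction in the modules. -/

section Naturality

variable {V : Type*} [AddCommGroup V] [Module ℂ V] [VertexLieAlgebra V] (𝒟 : CycloData V)
variable {ι : Type*} [Fintype ι] [DecidableEq ι] {z : ι → ℂ}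
variable {M : ι → Type*} [∀ i, AddCommGroup (M i)] [∀ i, Module ℂ (M i)]
  [∀ i, LieRingModule (LL V) (M i)] [∀ i, LieModule ℂ (LL V) (M i)]
  (hM : ∀ i, IsLevelOne V (M i))
variable {M' : ι → Type*} [∀ i, AddCommGroup (M' i)] [∀ i, Module ℂ (M' i)]
  [∀ i, LieRingModule (LL V) (M' i)] [∀ i, LieModule ℂ (LL V) (M' i)]
  (hM' : ∀ i, IsLevelOne V (M' i))
variable {u : ℂ} (hu : u ∉ orbit 𝒟.ω (Set.range z) ∪ {0})
variable (f : ∀ i, M i →ₗ[ℂ] M' i) (hf : ∀ i (y : LL V) (m : M i), f i ⁅y, m⁆ = ⁅y, f i m⁆)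

include hf

theorem map_siteAct (i : ι) (y : LL V) (m : ⨂[ℂ] i, M i) :
    PiTensorProduct.map f (siteAct M i y m) = siteAct M' i y (PiTensorProduct.map f m) := by
  induction m using PiTensorProduct.induction_on with
  | smul_tprod r m =>
    simp only [map_smul, siteAct_tprod, PiTensorProduct.map_tprod]
    congr 2
    ext j
    by_cases h : j = i
    · subst h; simp [hf]
    · simp [Function.update_of_ne h]
  | add m m' hm hm' => simp only [map_add, hm, hm']

theorem map_twisted (h : 𝒟.inv {u}) (m : ⨂[ℂ] i, M i) :
    PiTensorProduct.map f (𝒟.twisted z M hu h m) =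
      𝒟.twisted z M' hu h (PiTensorProduct.map f m) := by
  simp only [twisted_apply, LinearMap.sub_apply, map_sub, LinearMap.smul_apply, map_smul,
    Module.End.one_apply, actT_apply, LinearMap.sum_apply, map_sum, map_siteAct f hf]

/-- `reduce` is determined by its value on the vacuum vector and the rule for moving `h` across, and
both are compatible with module maps. -/
theorem map_reduce (v : Vac V) : ∀ m : ⨂[ℂ] i, M i,
    PiTensorProduct.map f (𝒟.reduce z M hu hM (v ⊗ₜ[ℂ] m)) =
      𝒟.reduce z M' hu hM' (v ⊗ₜ[ℂ] PiTensorProduct.map f m) := by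
  induction v using 𝒟.vac_induction (ne_zero_of_notMem hu) with
  | h0 => intro m; simp
  | h1 => intro m; rw [reduce_vac, reduce_vac]
  | hadd v w hv hw => intro m; simp only [TensorProduct.add_tmul, map_add, hv, hw]
  | hsmul r v hv => intro m; simp only [← TensorProduct.smul_tmul', map_smul, hv]
  | hlie h v hv => intro m; rw [reduce_lie, reduce_lie, map_neg, hv, 𝒟.map_twisted hu f hf]

theorem map_reduce_apply (x : Vac V ⊗[ℂ] (⨂[ℂ] i, M i)) :
    PiTensorProduct.map f (𝒟.reduce z M hu hM x) = 𝒟.reduce z M' hu hM'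
      (TensorProduct.map LinearMap.id (PiTensorProduct.map f) x) := by
  induction x using TensorProduct.induction_on with
  | zero => simp
  | add x y hx hy => simp only [map_add, hx, hy]
  | tmul v m => exact 𝒟.map_reduce hM hM' hu f hf v m

end Naturality

end CycloData

/-! ### Calculus of rational functions with values in a vector space. -/

section RationalFunctions

variable {S : Set ℂ}

/-- Evaluation of rational functions is used as a multiplicative map only where the denominators do
not vanish. -/
theorem PolesIn.eval₂_denom_ne_zero {r : RatFunc ℂ} (hr : PolesIn S r) {u : ℂ} (hu : u ∉ S) :
    Polynomial.eval₂ (RingHom.id ℂ) u r.denom ≠ 0 := fun h => hu (hr u (by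
  rwa [Polynomial.eval₂_id] at h))

/-- A scalar function that is given off `S` by a rational function with poles in `S`. -/
def IsScalarRational (S : Set ℂ) (g : ℂ → ℂ) : Prop :=
  ∃ r : RatFunc ℂ, PolesIn S r ∧ ∀ u, u ∉ S → r.eval (RingHom.id ℂ) u = g u

theorem IsScalarRational.const (S : Set ℂ) (s : ℂ) : IsScalarRational S fun _ => s :=
  ⟨algebraMap _ _ (Polynomial.C s), PolesIn.algebraMap _, fun u _ => by
    rw [RatFunc.algebraMap_C, RatFunc.eval_C, RingHom.id_apply]⟩

theorem IsScalarRational.mul {f g : ℂ → ℂ} (hf : IsScalarRational S f)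
    (hg : IsScalarRational S g) : IsScalarRational S fun u => f u * g u := by
  obtain ⟨r, hr, hr'⟩ := hf
  obtain ⟨s, hs, hs'⟩ := hg
  exact ⟨r * s, hr.mul hs, fun u hu => by
    rw [RatFunc.eval_mul _ _ (hr.eval₂_denom_ne_zero hu) (hs.eval₂_denom_ne_zero hu), hr' u hu,
      hs' u hu]⟩

theorem IsScalarRational.inv_sub {p : ℂ} (hp : p ∈ S) :
    IsScalarRational S fun u => (u - p)⁻¹ := by
  have hr : PolesIn S (polePow p 0) := (polePow_mem S p hp 0).1
  refine ⟨polePow p 0, hr, fun u hu => ?_⟩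
  have h0 : algebraMap (Polynomial ℂ) (RatFunc ℂ) (Polynomial.X - Polynomial.C p) ≠ 0 := by
    rw [Ne, FaithfulSMul.algebraMap_eq_zero_iff]
    exact Polynomial.X_sub_C_ne_zero p
  have h1 : polePow p 0 * algebraMap (Polynomial ℂ) (RatFunc ℂ) (Polynomial.X - Polynomial.C p) =
      1 := by
    rw [polePow, zero_add, pow_one, inv_mul_cancel₀ h0]
  have h2 := congrArg (RatFunc.eval (RingHom.id ℂ) u) h1
  rw [RatFunc.eval_mul _ _ (hr.eval₂_denom_ne_zero hu)
    ((PolesIn.algebraMap (P := S) _).eval₂_denom_ne_zero hu), RatFunc.eval_one,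
    RatFunc.eval_algebraMap] at h2
  simp only [Algebra.algebraMap_self, RingHom.id_apply, Polynomial.eval₂_sub, Polynomial.eval₂_X,
    Polynomial.eval₂_C] at h2
  exact eq_inv_of_mul_eq_one_left h2

theorem IsScalarRational.inv_pow {p : ℂ} (hp : p ∈ S) (e : ℕ) :
    IsScalarRational S fun u => ((u - p) ^ e)⁻¹ := by
  induction e with
  | zero => simpa using IsScalarRational.const S 1
  | succ e ih => simpa only [pow_succ, mul_inv] using ih.mul (IsScalarRational.inv_sub hp)

variable {Q : Type*} [AddCommGroup Q] [Module ℂ Q] {Q' : Type*} [AddCommGroup Q'] [Module ℂ Q']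

theorem IsRationalWithPolesIn.of_fintype {J : Type*} [Fintype J] {g : {u : ℂ // u ∉ S} → Q}
    (r : J → RatFunc ℂ) (q : J → Q) (hr : ∀ j, PolesIn S (r j))
    (h : ∀ u, g u = ∑ j, (r j).eval (RingHom.id ℂ) (u : ℂ) • q j) :
    IsRationalWithPolesIn S g := by
  let e := Fintype.equivFin J
  refine ⟨Fintype.card J, r ∘ e.symm, q ∘ e.symm, fun j => hr _, fun u => ?_⟩
  rw [h]
  exact (Equiv.sum_comp e.symm fun j => (r j).eval (RingHom.id ℂ) (u : ℂ) • q j).symm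

theorem IsRationalWithPolesIn.congr {f g : {u : ℂ // u ∉ S} → Q} (hf : IsRationalWithPolesIn S f)
    (h : ∀ u, g u = f u) : IsRationalWithPolesIn S g := by
  rwa [show g = f from funext h]

theorem IsRationalWithPolesIn.zero : IsRationalWithPolesIn S fun _ => (0 : Q) :=
  ⟨0, Fin.elim0, Fin.elim0, fun j => j.elim0, fun u => by simp⟩

theorem IsRationalWithPolesIn.const (q : Q) : IsRationalWithPolesIn S fun _ => q :=
  .of_fintype (J := Unit) (fun _ => 1) (fun _ => q) (fun _ => by
    have := PolesIn.algebraMap (P := S) 1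
    rwa [map_one] at this) fun u => by simp

theorem IsRationalWithPolesIn.add {f g : {u : ℂ // u ∉ S} → Q} (hf : IsRationalWithPolesIn S f)
    (hg : IsRationalWithPolesIn S g) : IsRationalWithPolesIn S fun u => f u + g u := by
  obtain ⟨n, r, q, hr, h⟩ := hf
  obtain ⟨n', r', q', hr', h'⟩ := hg
  refine .of_fintype (Sum.elim r r') (Sum.elim q q') ?_ fun u => ?_
  · rintro (j | j)
    exacts [hr j, hr' j]
  · rw [h, h', Fintype.sum_sum_type]
    rfl

theorem IsRationalWithPolesIn.smul {f : ℂ → ℂ} {g : {u : ℂ // u ∉ S} → Q}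
    (hf : IsScalarRational S f) (hg : IsRationalWithPolesIn S g) :
    IsRationalWithPolesIn S fun u => f u • g u := by
  obtain ⟨s, hs, h⟩ := hf
  obtain ⟨n, r, q, hr, h'⟩ := hg
  refine ⟨n, fun j => s * r j, q, fun j => hs.mul (hr j), fun u => ?_⟩
  change f u • g u = _
  rw [h', Finset.smul_sum]
  refine Finset.sum_congr rfl fun j _ => ?_
  rw [RatFunc.eval_mul _ _ (hs.eval₂_denom_ne_zero u.2) ((hr j).eval₂_denom_ne_zero u.2), h u u.2,
    smul_smul]

theorem IsRationalWithPolesIn.const_smul {g : {u : ℂ // u ∉ S} → Q} (s : ℂ)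
    (hg : IsRationalWithPolesIn S g) : IsRationalWithPolesIn S fun u => s • g u :=
  hg.smul (IsScalarRational.const S s)

theorem IsRationalWithPolesIn.neg {g : {u : ℂ // u ∉ S} → Q} (hg : IsRationalWithPolesIn S g) :
    IsRationalWithPolesIn S fun u => -g u :=
  (hg.const_smul (-1)).congr fun u => by rw [neg_one_smul]

theorem IsRationalWithPolesIn.sum {J : Type*} (s : Finset J) {g : J → {u : ℂ // u ∉ S} → Q}
    (hg : ∀ j ∈ s, IsRationalWithPolesIn S (g j)) :
    IsRationalWithPolesIn S fun u => ∑ j ∈ s, g j u := by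
  classical
  induction s using Finset.induction_on with
  | empty => simpa using IsRationalWithPolesIn.zero
  | insert j s hj ih =>
    refine ((hg j (Finset.mem_insert_self _ _)).add
      (ih fun i hi => hg i (Finset.mem_insert_of_mem hi))).congr fun u => ?_
    rw [Finset.sum_insert hj]

/-- A family of linear maps which is pointwise rational preserves rational functions. -/
theorem IsRationalWithPolesIn.comp {g : {u : ℂ // u ∉ S} → Q} (hg : IsRationalWithPolesIn S g)
    (L : {u : ℂ // u ∉ S} → Q →ₗ[ℂ] Q') (hL : ∀ q, IsRationalWithPolesIn S fun u => L u q) :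
    IsRationalWithPolesIn S fun u => L u (g u) := by
  obtain ⟨n, r, q, hr, h⟩ := hg
  have : IsRationalWithPolesIn S fun u : {u : ℂ // u ∉ S} =>
      ∑ j, (r j).eval (RingHom.id ℂ) (u : ℂ) • L u (q j) :=
    .sum _ fun j _ => (hL (q j)).smul (f := fun u => (r j).eval (RingHom.id ℂ) u)
      ⟨r j, hr j, fun _ _ => rfl⟩
  exact this.congr fun u => by rw [h, map_sum]; simp only [map_smul]

end RationalFunctions

/-! ### Truncated expansions. -/

section Expansion

variable {V : Type*} [AddCommGroup V] [Module ℂ V] [VertexLieAlgebra V]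

/-- A map that kills `a ⊗ t^N ℂ[[t]]` sees only the first `N` coefficients of a power series. -/
theorem map_rho_eq_sum {W : Type*} [AddCommGroup W] [Module ℂ W] (ψ : LL V →ₗ[ℂ] W) (a : V) (N : ℕ)
    (hψ : ∀ f : LaurentSeries ℂ, (∀ n : ℤ, n < N → f.coeff n = 0) → ψ (rho (a ⊗ₜ[ℂ] f)) = 0)
    (f : LaurentSeries ℂ) (hf : ∀ n : ℤ, n < 0 → f.coeff n = 0) :
    ψ (rho (a ⊗ₜ[ℂ] f)) = ∑ j ∈ Finset.range N, f.coeff j •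
      ψ (rho (a ⊗ₜ[ℂ] (HahnSeries.single (j : ℤ) (1 : ℂ) : LaurentSeries ℂ))) := by
  have h := hψ (f - ∑ j ∈ Finset.range N,
    f.coeff j • (HahnSeries.single (j : ℤ) (1 : ℂ) : LaurentSeries ℂ)) (by
      intro n hn
      rw [HahnSeries.coeff_sub, HahnSeries.coeff_sum]
      simp only [HahnSeries.coeff_smul]
      by_cases h0 : n < 0
      · rw [hf n h0, Finset.sum_eq_zero, sub_zero]
        intro j _
        rw [HahnSeries.coeff_single_of_ne (by omega), smul_zero]
      · obtain ⟨k, rfl⟩ : ∃ k : ℕ, n = k := ⟨n.toNat, by omega⟩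
        rw [Finset.sum_eq_single k, HahnSeries.coeff_single_same, smul_eq_mul, mul_one, sub_self]
        · intro j _ hj
          rw [HahnSeries.coeff_single_of_ne (by omega), smul_zero]
        · intro hk
          exact absurd (Finset.mem_range.2 (by omega)) hk)
  rw [TensorProduct.tmul_sub, map_sub, map_sub, sub_eq_zero, TensorProduct.tmul_sum, map_sum,
    map_sum] at h
  simpa only [TensorProduct.tmul_smul, map_smul] using h

end Expansion

/-! ### The filtration of the vacuum module. -/

section Filtration

variable (V : Type*) [AddCommGroup V] [Module ℂ V] [VertexLieAlgebra V]

/-- The filtration of the vacuum module by the number of factors from `L(𝓛)`. -/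
def vacFilt : ℕ → Submodule ℂ (Vac V)
  | 0 => Submodule.span ℂ {vac V}
  | d + 1 => vacFilt d ⊔ Submodule.span ℂ {w | ∃ (y : LL V), ∃ v ∈ vacFilt d, w = ⁅y, v⁆}

variable {V}

theorem vacFilt_mono : Monotone (vacFilt V) := monotone_nat_of_le_succ fun _ => le_sup_left

theorem lie_mem_vacFilt_succ {d : ℕ} (y : LL V) {v : Vac V} (hv : v ∈ vacFilt V d) :
    ⁅y, v⁆ ∈ vacFilt V (d + 1) :=
  Submodule.mem_sup_right (Submodule.subset_span ⟨y, v, hv, rfl⟩)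

theorem exists_mem_vacFilt (v : Vac V) : ∃ d, v ∈ vacFilt V d := by
  induction v using Vac.induction with
  | h0 => exact ⟨0, Submodule.zero_mem _⟩
  | h1 => exact ⟨0, Submodule.subset_span rfl⟩
  | hadd v w hv hw =>
    obtain ⟨d, hd⟩ := hv
    obtain ⟨e, he⟩ := hw
    exact ⟨max d e, Submodule.add_mem _ (vacFilt_mono (le_max_left _ _) hd)
      (vacFilt_mono (le_max_right _ _) he)⟩
  | hsmul r v hv =>
    obtain ⟨d, hd⟩ := hv
    exact ⟨d, Submodule.smul_mem _ r hd⟩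
  | hlie y v hv =>
    obtain ⟨d, hd⟩ := hv
    exact ⟨d + 1, lie_mem_vacFilt_succ y hd⟩

/-- Commuting a positive element past a factor replaces that factor by a commutator, again a single
factor, and at the end the positive element kills the vacuum. -/
theorem positivePart_lie_mem_vacFilt {d : ℕ} {y : LL V} (hy : y ∈ positivePart V) {v : Vac V}
    (hv : v ∈ vacFilt V d) : ⁅y, v⁆ ∈ vacFilt V d := by
  induction d generalizing y v with
  | zero =>
    obtain ⟨r, rfl⟩ := Submodule.mem_span_singleton.1 hv
    rw [lie_smul, lie_vac_of_mem_positivePart hy, smul_zero]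
    exact Submodule.zero_mem _
  | succ d ih =>
    obtain ⟨v, hv', w, hw, rfl⟩ := Submodule.mem_sup.1 hv
    clear hv
    rw [lie_add]
    refine Submodule.add_mem _ (vacFilt_mono (Nat.le_succ d) (ih hy hv')) ?_
    induction hw using Submodule.span_induction with
    | zero => simp
    | add w w' _ _ hw hw' =>
      rw [lie_add]
      exact Submodule.add_mem _ hw hw'
    | smul r w _ hw =>
      rw [lie_smul]
      exact Submodule.smul_mem _ r hw
    | mem w hw =>
      obtain ⟨x, w, hw, rfl⟩ := hw
      rw [leibniz_lie]
      exact Submodule.add_mem _ (lie_mem_vacFilt_succ _ hw) (lie_mem_vacFilt_succ _ (ih hy hw))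

end Filtration

/-! ### Smoothness of tensor products in each factor. -/

section SmoothSites

variable {V : Type*} [AddCommGroup V] [Module ℂ V] [VertexLieAlgebra V]
variable {ι : Type*} [DecidableEq ι]
variable (M : ι → Type*) [∀ i, AddCommGroup (M i)] [∀ i, Module ℂ (M i)]
  [∀ i, LieRingModule (LL V) (M i)] [∀ i, LieModule ℂ (LL V) (M i)]

theorem siteAct_smooth (hM : ∀ i, IsSmooth V (M i)) [Fintype ι] (i : ι) (m : ⨂[ℂ] i, M i) (a : V) :
    ∃ N : ℕ, ∀ f : LaurentSeries ℂ, (∀ n : ℤ, n < N → f.coeff n = 0) →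
      siteAct M i (rho (a ⊗ₜ[ℂ] f)) m = 0 := by
  induction m using PiTensorProduct.induction_on with
  | smul_tprod r m =>
    obtain ⟨N, hN⟩ := hM i (m i) a
    refine ⟨N, fun f hf => ?_⟩
    rw [map_smul, siteAct_tprod, hN f hf, MultilinearMap.map_update_zero, smul_zero]
  | add m m' hm hm' =>
    obtain ⟨N, hN⟩ := hm
    obtain ⟨N', hN'⟩ := hm'
    refine ⟨N + N', fun f hf => ?_⟩
    rw [map_add, hN f fun n hn => hf n (by push_cast; omega),
      hN' f fun n hn => hf n (by push_cast; omega), add_zero]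

end SmoothSites

/-! ### Rationality of the reduction in `u`. -/

namespace CycloData

attribute [local instance] LieRing.ofAssociativeRing

variable {V : Type*} [AddCommGroup V] [Module ℂ V] [VertexLieAlgebra V] (𝒟 : CycloData V)
variable {ι : Type*} {z : ι → ℂ}

/-- `z i - αu = -α (u - α⁻¹ z i)`, where `α⁻¹` is written as `ω^{k (T - 1)}`. -/
theorem isScalarRational_site (k e : ℕ) (i : ι) :
    IsScalarRational (orbit 𝒟.ω (Set.range z) ∪ {0})
      fun u => ((z i - ((𝒟.ω ^ k : ℂˣ) : ℂ) * u) ^ e)⁻¹ := by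
  have h := (IsScalarRational.const (orbit 𝒟.ω (Set.range z) ∪ {0})
    (((-((𝒟.ω ^ k : ℂˣ) : ℂ)) ^ e)⁻¹)).mul
    (IsScalarRational.inv_pow (p := ((𝒟.ω ^ (k * (𝒟.T - 1)) : ℂˣ) : ℂ) * z i)
      (Or.inl ⟨_, z i, ⟨i, rfl⟩, rfl⟩) e)
  convert h using 2 with u
  rw [← mul_inv, ← mul_pow]
  congr 2
  linear_combination (-z i) * 𝒟.omega_pow_mul_inv k

/-- `u - αu = (1 - α) u`: expanding at `u` around the other points of its own orbit is what
introduces the pole at `0`. -/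
theorem isScalarRational_self (S : Set ℂ) (k e : ℕ) :
    IsScalarRational (S ∪ {0}) fun u => ((u - ((𝒟.ω ^ k : ℂˣ) : ℂ) * u) ^ e)⁻¹ := by
  have h := (IsScalarRational.const (S ∪ {0}) (((1 - ((𝒟.ω ^ k : ℂˣ) : ℂ)) ^ e)⁻¹)).mul
    (IsScalarRational.inv_pow (p := 0) (Or.inr rfl) e)
  convert h using 2 with u
  rw [← mul_inv, ← mul_pow]
  congr 2
  ring

theorem avg_polePow (a : V) (u : ℂ) (n : ℕ) : 𝒟.avg (rho (a ⊗ₜ[ℂ] polePow u n)) =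
    ∑ k ∈ Finset.range 𝒟.T, ((𝒟.ω ^ k : ℂˣ) : ℂ) ^ n •
      (rho (Rop 𝒟.ω 𝒟.σ k a ⊗ₜ[ℂ] polePow (((𝒟.ω ^ k : ℂˣ) : ℂ) * u) n) : RatLie V) := by
  rw [avg_apply]
  exact Finset.sum_congr rfl fun k _ => 𝒟.gam_polePow k a u n

theorem principal_single (a : V) (u : ℂ) (n : ℕ) :
    ((𝒟.principal u (rho (a ⊗ₜ[ℂ] (HahnSeries.single (-((n : ℤ) + 1)) (1 : ℂ) :
      LaurentSeries ℂ))) : 𝒟.inv {u}) : RatLie V) = 𝒟.avg (rho (a ⊗ₜ[ℂ] polePow u n)) := by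
  rw [principal_coe, prinMap_rho, prin_single]

/-- The term `α = 1` of the average expands to the singular monomial itself; the remaining terms
have their poles at `αu`. -/
theorem expandInv_principal_single (a : V) (u : ℂ) (n : ℕ) :
    𝒟.expandInv u (𝒟.principal u (rho (a ⊗ₜ[ℂ] (HahnSeries.single (-((n : ℤ) + 1)) (1 : ℂ) :
      LaurentSeries ℂ)))) =
    rho (a ⊗ₜ[ℂ] (HahnSeries.single (-((n : ℤ) + 1)) (1 : ℂ) : LaurentSeries ℂ)) +
      ∑ k ∈ Finset.range (𝒟.T - 1), ((𝒟.ω ^ (k + 1) : ℂˣ) : ℂ) ^ n •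
        rho (Rop 𝒟.ω 𝒟.σ (k + 1) a ⊗ₜ[ℂ]
          laurentAt u (polePow (((𝒟.ω ^ (k + 1) : ℂˣ) : ℂ) * u) n)) := by
  obtain ⟨t, ht⟩ : ∃ t, 𝒟.T = t + 1 := ⟨𝒟.T - 1, by have := 𝒟.T_pos; omega⟩
  have h0 : Rop 𝒟.ω 𝒟.σ 0 a = a := Rop_of_pow_eq_one _ _ _ (pow_zero _) (pow_zero _) a
  rw [expandInv_apply, principal_single, avg_polePow, ht, Finset.sum_range_succ', map_add, map_sum,
    Nat.add_sub_cancel, pow_zero, Units.val_one, one_pow, one_smul, one_mul, h0, expandRat_rho,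
    laurentAt_polePow_self, add_comm]
  simp only [map_smul, expandRat_rho]

/-- The bound `N` is uniform in `u`, so the expansion is a sum of fixed length. Its coefficients are
constants times powers of `(q u - p u)⁻¹`. -/
theorem isRational_expansion {S : Set ℂ} {W : Type*} [AddCommGroup W] [Module ℂ W]
    (ψ : {u : ℂ // u ∉ S} → LL V →ₗ[ℂ] W) (a : V) (N : ℕ)
    (hψ : ∀ u, ∀ f : LaurentSeries ℂ, (∀ n : ℤ, n < N → f.coeff n = 0) →
      ψ u (rho (a ⊗ₜ[ℂ] f)) = 0)
    (hψ' : ∀ j < N, IsRationalWithPolesIn S fun u =>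
      ψ u (rho (a ⊗ₜ[ℂ] (HahnSeries.single (j : ℤ) (1 : ℂ) : LaurentSeries ℂ))))
    (p q : ℂ → ℂ) (hpq : ∀ u, u ∉ S → p u ≠ q u)
    (hr : ∀ e : ℕ, IsScalarRational S fun u => ((q u - p u) ^ e)⁻¹) (n : ℕ) :
    IsRationalWithPolesIn S fun u => ψ u (rho (a ⊗ₜ[ℂ] laurentAt (q u) (polePow (p u) n))) := by
  obtain ⟨C, hC⟩ := exists_coeff_polePow
  have h : IsRationalWithPolesIn S fun u : {u : ℂ // u ∉ S} => ∑ j ∈ Finset.range N,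
      (C n j * ((q u - p u) ^ (n + 1 + j))⁻¹) •
        ψ u (rho (a ⊗ₜ[ℂ] (HahnSeries.single (j : ℤ) (1 : ℂ) : LaurentSeries ℂ))) :=
    .sum _ fun j hj => (hψ' j (Finset.mem_range.1 hj)).smul
      (f := fun u => C n j * ((q u - p u) ^ (n + 1 + j))⁻¹) ((IsScalarRational.const S _).mul (hr _))
  refine h.congr fun u => ?_
  obtain ⟨h1, h2⟩ := hC n (p u) (q u) (hpq u u.2)
  rw [map_rho_eq_sum (ψ u) a N (hψ u) _ h2]
  simp only [h1]

theorem rop_ne {u : ℂ} (hu : u ≠ 0) {k : ℕ} (hk : k + 1 < 𝒟.T) :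
    ((𝒟.ω ^ (k + 1) : ℂˣ) : ℂ) * u ≠ u := fun h => by
  have := 𝒟.mul_eq_self hu hk h
  omega

variable [Fintype ι] [DecidableEq ι]
variable (M : ι → Type*) [∀ i, AddCommGroup (M i)] [∀ i, Module ℂ (M i)]
  [∀ i, LieRingModule (LL V) (M i)] [∀ i, LieModule ℂ (LL V) (M i)]
  (hM : ∀ i, IsLevelOne V (M i)) (hS : ∀ i, IsSmooth V (M i))

include hS in
-- Each term has its pole at `αu`, away from `z i`; smoothness at the site `i` truncates its
-- expansion there, and the residue correction does not depend on `u`.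
theorem isRational_twisted (a : V) (n : ℕ) (m : ⨂[ℂ] i, M i) :
    IsRationalWithPolesIn (orbit 𝒟.ω (Set.range z) ∪ {0}) fun u =>
      𝒟.twisted z M u.2 (𝒟.principal u (rho (a ⊗ₜ[ℂ]
        (HahnSeries.single (-((n : ℤ) + 1)) (1 : ℂ) : LaurentSeries ℂ)))) m := by
  have h1 : IsRationalWithPolesIn (orbit 𝒟.ω (Set.range z) ∪ {0})
      fun u : {u : ℂ // u ∉ orbit 𝒟.ω (Set.range z) ∪ {0}} =>
        ∑ k ∈ Finset.range 𝒟.T, ((𝒟.ω ^ k : ℂˣ) : ℂ) ^ n • ∑ i, siteAct M i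
          (rho (Rop 𝒟.ω 𝒟.σ k a ⊗ₜ[ℂ] laurentAt (z i) (polePow (((𝒟.ω ^ k : ℂˣ) : ℂ) * u) n))) m := by
    refine .sum _ fun k _ => .const_smul _ (.sum _ fun i _ => ?_)
    obtain ⟨N, hN⟩ := siteAct_smooth M hS i m (Rop 𝒟.ω 𝒟.σ k a)
    exact isRational_expansion
      (fun _ => (LinearMap.applyₗ m) ∘ₗ (siteAct M i).toLinearMap) (Rop 𝒟.ω 𝒟.σ k a) N
      (fun _ => hN) (fun j _ => .const _) (fun u => ((𝒟.ω ^ k : ℂˣ) : ℂ) * u) (fun _ => z i)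
      (fun u hu => 𝒟.ne_of_notMem_orbit hu k i) (fun e => 𝒟.isScalarRational_site k e i) n
  have h2 : IsRationalWithPolesIn (orbit 𝒟.ω (Set.range z) ∪ {0})
      fun _ : {u : ℂ // u ∉ orbit 𝒟.ω (Set.range z) ∪ {0}} => 𝒟.kres (rho (a ⊗ₜ[ℂ]
        (HahnSeries.single (-((n : ℤ) + 1)) (1 : ℂ) : LaurentSeries ℂ))) • m := .const _
  refine (h1.add h2.neg).congr fun u => ?_
  rw [twisted_apply, 𝒟.resAt_principal (ne_zero_of_notMem u.2), principal_single, avg_polePow,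
    ← sub_eq_add_neg, LinearMap.sub_apply, LinearMap.smul_apply, Module.End.one_apply, map_sum,
    LinearMap.sum_apply]
  congr 1
  refine Finset.sum_congr rfl fun k _ => ?_
  rw [map_smul, LinearMap.smul_apply, actT_apply, LinearMap.sum_apply]
  simp only [expandRat_rho]

/-- Subtracting the principal part leaves a positive element, and the principal part is a
combination of the monomials. The base point `0` is arbitrary. -/
theorem laurent_le {W : Submodule ℂ (LL V)} (h0 : positivePart V ≤ W)
    (h1 : ∀ (a : V) (n : ℕ), rho (a ⊗ₜ[ℂ] (HahnSeries.single (-((n : ℤ) + 1)) (1 : ℂ) :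
      LaurentSeries ℂ)) ∈ W) (y : LL V) : y ∈ W := by
  have h2 : withPoles V {0} ≤ W.comap (expandRat 0).toLinearMap := by
    apply withPoles_le
    intro a p hp n
    rw [Set.mem_singleton_iff] at hp
    subst hp
    change expandRat 0 (rho (a ⊗ₜ[ℂ] polePow 0 n)) ∈ W
    rw [expandRat_rho, laurentAt_polePow_self]
    exact h1 a n
  have h3 : expandRat 0 (prinMap V 0 y) ∈ W := h2 (prinMap_mem 0 y)
  have h4 := W.add_mem (h0 (expand_prinMap 0 y)) h3
  rwa [sub_add_cancel] at h4

include hS in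
-- Induction on the filtration degree. For positive `y` the vector `⁅y, w⁆` stays in the lower step,
-- so only the monomials `a ⊗ t^{-n-1}` remain. They are the expansion of an element of `H`, which
-- moves to `m`, minus terms regular at `u`.
theorem isRational_reduce_of_mem_vacFilt {d : ℕ} {v : Vac V} (hv : v ∈ vacFilt V d) :
    ∀ m : ⨂[ℂ] i, M i, IsRationalWithPolesIn (orbit 𝒟.ω (Set.range z) ∪ {0})
      fun u => 𝒟.reduce z M u.2 hM (v ⊗ₜ[ℂ] m) := by
  let R : Submodule ℂ (Vac V) :=
    { carrier := {v | ∀ m : ⨂[ℂ] i, M i, IsRationalWithPolesIn (orbit 𝒟.ω (Set.range z) ∪ {0})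
        fun u => 𝒟.reduce z M u.2 hM (v ⊗ₜ[ℂ] m)}
      add_mem' := fun {v w} hv hw m => ((hv m).add (hw m)).congr fun u => by
        rw [TensorProduct.add_tmul, map_add]
      zero_mem' := fun m => IsRationalWithPolesIn.zero.congr fun u => by
        rw [TensorProduct.zero_tmul, map_zero]
      smul_mem' := fun r v hv m => ((hv m).const_smul r).congr fun u => by
        rw [← TensorProduct.smul_tmul', map_smul] }
  suffices h : vacFilt V d ≤ R from h hv
  clear hv v
  induction d with
  | zero =>
    refine Submodule.span_le.2 ?_
    rintro _ rfl m
    exact (IsRationalWithPolesIn.const m).congr fun u => by rw [reduce_vac]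
  | succ d ih =>
    refine sup_le ih (Submodule.span_le.2 ?_)
    rintro _ ⟨y, w, hw, rfl⟩
    let W : Submodule ℂ (LL V) := R.comap ((LieModule.toEnd ℂ (LL V) (Vac V)).toLinearMap.flip w)
    refine laurent_le (W := W) (fun x hx => ih (positivePart_lie_mem_vacFilt hx hw))
      (fun a n m => ?_) y
    -- The vector moved to `m` depends on `u` rationally, and `reduce` of `w` with each fixed vector
    -- is rational by induction.
    have h1 := (𝒟.isRational_twisted (z := z) M hS a n m).comp
      (fun u => (𝒟.reduce z M u.2 hM) ∘ₗ TensorProduct.mk ℂ _ _ w) (ih hw)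
    have h2 : IsRationalWithPolesIn (orbit 𝒟.ω (Set.range z) ∪ {0})
        fun u : {u : ℂ // u ∉ orbit 𝒟.ω (Set.range z) ∪ {0}} =>
          ∑ k ∈ Finset.range (𝒟.T - 1), ((𝒟.ω ^ (k + 1) : ℂˣ) : ℂ) ^ n •
            𝒟.reduce z M u.2 hM (⁅(rho (Rop 𝒟.ω 𝒟.σ (k + 1) a ⊗ₜ[ℂ]
              laurentAt u (polePow (((𝒟.ω ^ (k + 1) : ℂˣ) : ℂ) * u) n)) : LL V), w⁆ ⊗ₜ[ℂ] m) := by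
      refine .sum _ fun k hk => .const_smul _ ?_
      rw [Finset.mem_range] at hk
      obtain ⟨N, hN⟩ := vac_isSmooth w (Rop 𝒟.ω 𝒟.σ (k + 1) a)
      refine isRational_expansion (fun u => (𝒟.reduce z M u.2 hM) ∘ₗ
        (TensorProduct.mk ℂ (Vac V) (⨂[ℂ] i, M i)).flip m ∘ₗ
          (LieModule.toEnd ℂ (LL V) (Vac V)).toLinearMap.flip w) (Rop 𝒟.ω 𝒟.σ (k + 1) a) N
        (fun u f hf => ?_) (fun j _ => ?_) (fun u => ((𝒟.ω ^ (k + 1) : ℂˣ) : ℂ) * u) (fun u => u)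
        (fun u hu => 𝒟.rop_ne (ne_zero_of_notMem hu) (by omega))
        (fun e => 𝒟.isScalarRational_self _ (k + 1) e) n
      · change 𝒟.reduce z M u.2 hM
          (⁅(rho (Rop 𝒟.ω 𝒟.σ (k + 1) a ⊗ₜ[ℂ] f) : LL V), w⁆ ⊗ₜ[ℂ] m) = 0
        rw [hN f hf, TensorProduct.zero_tmul, map_zero]
      -- The coefficients of the regular terms are positive monomials applied to `w`, so they stay
      -- in the lower filtration step.
      · exact ih (positivePart_lie_mem_vacFilt (rho_mem_positivePart _ fun n hn =>
          HahnSeries.coeff_single_of_ne (by omega)) hw) m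
    refine (h1.neg.add h2.neg).congr fun u => ?_
    change 𝒟.reduce z M u.2 hM (⁅(rho (a ⊗ₜ[ℂ]
      (HahnSeries.single (-((n : ℤ) + 1)) (1 : ℂ) : LaurentSeries ℂ)) : LL V), w⁆ ⊗ₜ[ℂ] m) = _
    have h3 := 𝒟.reduce_lie z M u.2 hM (𝒟.principal u (rho (a ⊗ₜ[ℂ]
      (HahnSeries.single (-((n : ℤ) + 1)) (1 : ℂ) : LaurentSeries ℂ)))) w m
    rw [expandInv_principal_single, add_lie, TensorProduct.add_tmul, map_add, sum_lie,
      TensorProduct.sum_tmul, map_sum] at h3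
    rw [eq_sub_of_add_eq h3, sub_eq_add_neg]
    simp only [smul_lie, ← TensorProduct.smul_tmul', map_smul]
    rfl

include hS in
theorem isRational_reduce (x : Vac V ⊗[ℂ] (⨂[ℂ] i, M i)) :
    IsRationalWithPolesIn (orbit 𝒟.ω (Set.range z) ∪ {0})
      fun u => 𝒟.reduce z M u.2 hM x := by
  induction x using TensorProduct.induction_on with
  | zero => exact IsRationalWithPolesIn.zero.congr fun u => by rw [map_zero]
  | add x y hx hy => exact (hx.add hy).congr fun u => by rw [map_add]
  | tmul v m =>
    obtain ⟨d, hd⟩ := exists_mem_vacFilt v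
    exact 𝒟.isRational_reduce_of_mem_vacFilt M hM hS hd m

end CycloData

end CycloCoinv

end

/-! ### The proposition. -/

theorem proposition3p3 {V : Type uV} [AddCommGroup V] [Module ℂ V]
    [CycloCoinv.VertexLieAlgebra V]
    (Lo : Submodule ℂ V) (hLo : CycloCoinv.IsGradedComplement Lo)
    (T : ℕ) (hT : 0 < T) (ω : ℂˣ) (hω : IsPrimitiveRoot ω T)
    (σ : CycloCoinv.VLAut V) (hσ : σ.lin ^ T = 1)
    (hLoσ : ∀ a ∈ Lo, σ.lin a ∈
      Lo ⊔ LinearMap.range (CycloCoinv.VertexLieAlgebra.D : V →ₗ[ℂ] V))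
    {ι : Type uI} [Fintype ι] [DecidableEq ι] [Nonempty ι]
    (z : ι → ℂ) (hz0 : ∀ i, z i ≠ 0)
    (hz : ∀ i j, i ≠ j → ∀ k : ℕ, z i ≠ ((ω ^ k : ℂˣ) : ℂ) * z j) :
    (∀ (M : ι → Type uM) [∀ i, AddCommGroup (M i)] [∀ i, Module ℂ (M i)]
        [∀ i, LieRingModule (CycloCoinv.LL V) (M i)]
        [∀ i, LieModule ℂ (CycloCoinv.LL V) (M i)],
      (∀ i, CycloCoinv.IsLevelOne V (M i)) → (∀ i, CycloCoinv.IsSmooth V (M i)) →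
      ∃ E : ∀ u : {u : ℂ // u ∉ CycloCoinv.orbit ω (Set.range z) ∪ {0}},
          CycloCoinv.VacCoinv M ω T σ Lo z u ≃ₗ[ℂ] CycloCoinv.Coinv M ω T σ Lo z,
        (∀ u (m : ⨂[ℂ] i, M i),
          E u (Submodule.Quotient.mk (CycloCoinv.vac V ⊗ₜ[ℂ] m)) = Submodule.Quotient.mk m) ∧
        ∀ x : CycloCoinv.Vac V ⊗[ℂ] (⨂[ℂ] i, M i),
          CycloCoinv.IsRationalWithPolesIn (CycloCoinv.orbit ω (Set.range z) ∪ {0})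
            (fun u => E u (Submodule.Quotient.mk x))) ∧
    (∀ (X : ι → CycloCoinv.SmoothInvSystem.{uV, uM} V)
        (N : ∀ i, LieSubmodule ℂ (CycloCoinv.LL V) (X i).lim),
      ∃ E : ∀ u : {u : ℂ // u ∉ CycloCoinv.orbit ω (Set.range z) ∪ {0}},
          CycloCoinv.VacCoinv (fun i => N i) ω T σ Lo z u ≃ₗ[ℂ]
            CycloCoinv.Coinv (fun i => N i) ω T σ Lo z,
        (∀ u (m : ⨂[ℂ] i, N i),
          E u (Submodule.Quotient.mk (CycloCoinv.vac V ⊗ₜ[ℂ] m)) = Submodule.Quotient.mk m) ∧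
        ∀ x : CycloCoinv.Vac V ⊗[ℂ] (⨂[ℂ] i, N i),
          ∃ G : {u : ℂ // u ∉ CycloCoinv.orbit ω (Set.range z) ∪ {0}} → ⨂[ℂ] i, N i,
            (∀ u, E u (Submodule.Quotient.mk x) = Submodule.Quotient.mk (G u)) ∧
            ∀ k : ι → ℕ,
              CycloCoinv.IsRationalWithPolesIn (CycloCoinv.orbit ω (Set.range z) ∪ {0})
                (fun u => PiTensorProduct.map (fun i => (X i).proj (N i) (k i)) (G u))) := by
  obtain ⟨κ, hκ, hκD, hκc⟩ := CycloCoinv.exists_kappa hLo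
  let 𝒟 : CycloCoinv.CycloData V :=
    { ω := ω, T := T, T_pos := hT, prim := hω, σ := σ, σ_pow := hσ, Lo := Lo, complement := hLo,
      σ_Lo := hLoσ, κ := κ, κ_Lo := hκ, κ_D := hκD, κ_c := hκc }
  have hd : 𝒟.Distinct z := ⟨hz0, hz⟩
  constructor
  · intro M _ _ _ _ hM hS
    refine ⟨fun u => 𝒟.coinvEquiv hd M u.2 hM, fun u m => ?_, fun x => ?_⟩
    · exact (𝒟.coinvEquiv_mk hd M u.2 hM _).trans
        (congrArg Submodule.Quotient.mk (𝒟.reduce_vac z M u.2 hM m))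
    · exact (𝒟.isRational_reduce M hM hS x).comp
        (fun _ => (CycloCoinv.coinvRel M ω T σ Lo z).mkQ) fun q => .const _
  · intro X N
    have hN : ∀ i, CycloCoinv.IsLevelOne V (N i) := fun i m =>
      Subtype.ext (Subtype.ext (funext fun k => (X i).level_one k _))
    refine ⟨fun u => 𝒟.coinvEquiv hd (fun i => N i) u.2 hN, fun u m => ?_, fun x =>
      ⟨fun u => 𝒟.reduce z (fun i => N i) u.2 hN x, fun u => ?_, fun k => ?_⟩⟩
    · exact (𝒟.coinvEquiv_mk hd (fun i => N i) u.2 hN _).trans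
        (congrArg Submodule.Quotient.mk (𝒟.reduce_vac z (fun i => N i) u.2 hN m))
    · exact 𝒟.coinvEquiv_mk hd (fun i => N i) u.2 hN x
    -- By naturality the projection of `reduce` is `reduce` of the projected vector, over the smooth
    -- modules `(X i).M (k i)`; the submodules of the limits themselves need not be smooth.
    · refine (𝒟.isRational_reduce (z := z) (fun i => (X i).M (k i))
        (fun i => (X i).level_one (k i)) (fun i => (X i).smooth (k i))
        (TensorProduct.map LinearMap.id
          (PiTensorProduct.map fun i => (X i).proj (N i) (k i)) x)).congr fun u => ?_
      exact 𝒟.map_reduce_apply hN (fun i => (X i).level_one (k i)) u.2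
        (fun i => (X i).proj (N i) (k i)) (fun i y m => rfl) x
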